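/- Let $m$ be such that $2m\ge 3$ is an integer (so that $I_2(2m)$ is a dihedral group) and let $c\in\mathbb R$, $c\ne 0,\pm2$. Consider, on an open set $U\subset\{(u,v)\in\mathbb R^2: u>0\}$, the primary flow of the principal hierarchy of $I_2(2m)$ with parameter $c$, $$u_t=\partial_x\big[-2c\,u^m+v\big],\qquad v_t=\partial_x\Big[-\tfrac{m^2}{2m-1}(c^2-4)u^{2m-1}\Big],\tag{1}$$ and its second order deformations $$\begin{aligned}u_t&=\partial_x\big[-2cu^m+v+\epsilon^2(a_{13}u_{xx}+a_{14}v_{xx}+a_{15}u_x^2+a_{16}v_x^2+a_{17}u_xv_x)\big],\\ v_t&=\partial_x\big[-\tfrac{m^2}{2m-1}(c^2-4)u^{2m-1}+\epsilon^2(a_{23}u_{xx}+a_{24}v_{xx}+a_{25}u_x^2+a_{26}v_x^2+a_{27}u_xv_x)\big],\end{aligned}\tag{2}$$ whose coefficients $a_{ij}$ are smooth functions of $(u,v)\in U$. The deformation (2) is called integrable on $U$ if its dispersionless limit (1) has Riemann invariants on $U$ and every symmetry of (1), i.e. every flow $(u,v)_\tau=\partial_x(\beta(u,v))$ with $\beta$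 smooth on $U$ that commutes with (1), extends, by adding $\epsilon^2\partial_x$ of a homogeneous differential polynomial of degree two with smooth coefficients, to a flow that commutes with (2) up to the order $\epsilon^2$. Miura transformations are taken of the form $w\mapsto w+\epsilon^2\partial_x(B(w)w_x)$, $w=(u,v)$, with $B$ a smooth $2\times2$ matrix function, and all transformations of systems are considered up to the order $\epsilon^2$. **Theorem.** (a) The functions $r_1=v-(c+2)u^m$ and $r_2=v-(c-2)u^m$ are Riemann invariants of (1). (b) Suppose that the deformation (2) is integrable on $U$, and let $V\subseteq U$ be an open set in which the level sets of $r_1$ and of $r_2$ are connected (for example $V=U=\{u>0\}$; every point of $U$ has arbitrarily small neighbourhoods $V$ of this kind). Then there are smooth functions $F_1$ on $r_1(V)$ and $F_2$ on $r_2(V)$ such that on $V$ a Miura transformation reduces (2) to the normal form $$\begin{aligned}u_t&=\partial_x\big[-2cu^m+v+\epsilon^2a_{16}\big(m^2(c^2-4)u^{2m-2}u_x^2-2cm\,u^{m-1}u_xv_x+v_x^2\big)\big],\\ v_t&=\partial_x\big[-\tfrac{m^2}{2m-1}(c^2-4)u^{2m-1}+\epsilon^2(a_{23}u_{xx}+a_{24}v_{xx}+a_{25}u_x^2+a_{26}v_x^2+a_{27}u_xv_x)\big],\end{aligned}\tag{3}$$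 where $$a_{23}=u^{\frac12c(m-1)+2m-3}F_1\big(v-(c+2)u^m\big)+u^{-\frac12c(m-1)+2m-3}F_2\big(v-(c-2)u^m\big)\tag{4}$$ and, writing $g=a_{23}$, $D=c^2-4$, $P=c^4(m-1)^2+12c^2m^2-4c^2m-4c^2+16m$, $Q=(m-1)^2c^4+4(6m^2-3m-2)c^2+16(m^2+m+1)$, $R=(m-1)^2c^6+4(6m^2-3m-2)c^4+16(m^2-m+3)c^2+128(m-1)$, $$\begin{aligned} a_{16}={}&\tfrac{P\,u^{2-m}}{16m^2(m-1)^2cD}g_{vv}+\tfrac{P\,u^{3-2m}}{8m^3(m-1)^2D^2}g_{uv}+\tfrac{P\,u^{4-3m}}{16m^4(m-1)^2cD^2}g_{uu}-\tfrac{(m-2)P\,u^{2-2m}}{8m^3(m-1)^2D^2}g_v-\tfrac{(5m-7)P\,u^{3-3m}}{16m^4(m-1)^2cD^2}g_u\\ &+\tfrac{c^2(19m^3-32m^2+3m+9)+24m^2-36m}{4(m-1)m^4cD^2}u^{2-3m}g-\tfrac{c^6(m-1)^2-4c^4(6m^2-15m+10)}{64m^4cD^2}u^{2-3m}g,\\ a_{24}={}&-\tfrac{4u^{m+1}}{(m-1)c}g_{vv}-\tfrac{8u^2}{m(m-1)D}g_{uv}-\tfrac{4u^{3-m}}{m^2(m-1)cD}g_{uu}+\tfrac{8(m-2)u}{m(m-1)D}g_v+\tfrac{4(5m-7)u^{2-m}}{m^2(m-1)cD}g_u-\tfrac{(c^2+24m-36)u^{1-m}}{m^2cD}g,\\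 a_{25}={}&\tfrac{mQ\,u^{2m-1}}{16(m-1)^2}g_{vv}+\tfrac{cQ\,u^m}{8(m-1)^2D}g_{uv}+\tfrac{Q\,u}{16m(m-1)^2D}g_{uu}\\ &-\tfrac{((m-2)c^6-32m)u^{m-1}}{8cD}g_v-\tfrac{((22m^3-56m^2+14m+16)c^4+(32m^3-48m^2-32)c^2)u^{m-1}}{8(m-1)^2cD}g_v\\ &-\tfrac{(5m-7)c^4}{16mD}g_u-\tfrac{(104m^3-196m^2+28m+56)c^2+144m^3-160m^2+32m-112}{16m(m-1)^2D}g_u\\ &-\tfrac{(m-1)^3c^6-(24m^3-88m^2+108m-44)c^4-(560m^3-976m^2+112m+304)c^2}{64m(m-1)D\,u}g+\tfrac{8m^3-8m^2+m-9}{m(m-1)D\,u}g,\\ a_{26}={}&\tfrac{Q\,u}{16m(m-1)^2D}g_{vv}+\tfrac{cQ\,u^{2-m}}{8m^2(m-1)^2D^2}g_{uv}+\tfrac{Q\,u^{3-2m}}{16m^3(m-1)^2D^2}g_{uu}\\ &-\tfrac{(m-2)c^6+32m}{8m^2cD^2}u^{1-m}g_v-\tfrac{(34m^3-80m^2+26m+16)c^4+(-32m^3+80m^2-64m-32)c^2}{8m^2(m-1)^2cD^2}u^{1-m}g_v\\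 &-\tfrac{(5m-7)c^4}{16m^3D^2}u^{2-2m}g_u-\tfrac{(128m^3-244m^2+52m+56)c^2+48m^3+32m^2-64m-112}{16m^3(m-1)^2D^2}u^{2-2m}g_u\\ &-\tfrac{(-656m^3+1200m^2-240m-304)c^2-128m^3-384m^2+448m+576}{64m^3(m-1)D^2}u^{1-2m}g-\tfrac{(m-1)^2c^6-4(6m^2-16m+11)c^4}{64m^3D^2}u^{1-2m}g,\\ a_{27}={}&-\tfrac{R\,u^m}{8(m-1)^2cD}g_{vv}-\tfrac{R\,u}{4m(m-1)^2D^2}g_{uv}-\tfrac{R\,u^{2-m}}{8m^2(m-1)^2cD^2}g_{uu}\\ &+\tfrac{(5m-7)c^6}{8m^2cD^2}u^{1-m}g_u+\tfrac{(29m^3-55m^2+10m+14)c^4+4(7m^3-16m^2+24m-21)c^2-16(m^3-12m^2+25m-14)}{2m^2(m-1)^2cD^2}u^{1-m}g_u\\ &+\tfrac{(m-2)c^6}{4mD^2}g_v+\tfrac{(28m^3-68m^2+20m+16)c^4+(-16m^3+16m^2+48m-96)c^2+64m^3-320m+256}{4m(m-1)^2D^2}g_v\\ &+\tfrac{(-768m^3+1920m^2-2496m+1856)c^2+512m^3-4352m^2+8448m-4608}{32m^2(m-1)cD^2}u^{-m}g+\tfrac{(m-1)^2c^8-4(6m^2-16m+11)c^6-16(33m^2-23m-21)c^4}{32m^2cD^2}u^{-m}g.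 \end{aligned}$$ (c) Conversely $F_1$ and $F_2$ are arbitrary: for all smooth functions $F_1$ on $r_1(U)$ and $F_2$ on $r_2(U)$, the coefficients of the normal form (3), with $a_{23}$ given by (4), are smooth on $U$ and the deformation (3) is integrable on $U$. -/

import Mathlib

open scoped ContDiff Topology

namespace DihedralFlow

/-! ### Differential functions of two dependent variables -/

/-- A jet `(w, w_x, w_xx, …)` of the unknown `w = (u, v)`: the value `j k` stands for the `k`-th
`x`-derivative of `w`. -/
abbrev Jet : Type := ℕ → ℝ × ℝ

section Jets

variable {E : Type*} [NormedAddCommGroup E] [NormedSpace ℝ E]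

/-- Partial derivative of a differential function with respect to the jet variable of index `k`. -/
noncomputable def jetDeriv (f : Jet → E) (j : Jet) (k : ℕ) : ℝ × ℝ →L[ℝ] E :=
  fderiv ℝ (fun p => f (Function.update j k p)) (j k)

/-- The total `x`-derivative. The sum is finite, since the differential functions that are used
depend on finitely many jet variables only. -/
noncomputable def Dx (f : Jet → E) (j : Jet) : E :=
  ∑ᶠ k, jetDeriv f j k (j (k + 1))

/-- The derivative of `f` along the evolutionary system `w_t = X(w, w_x, …)`. -/
noncomputable def evol (X : Jet → ℝ × ℝ) (f : Jet → E) (j : Jet) : E :=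
  ∑ᶠ k, jetDeriv f j k ((Dx^[k] X) j)

end Jets

/-- The commutator of the systems `w_t = X` and `w_τ = Y`; the two flows commute when it is 0. -/
noncomputable def commutator (X Y : Jet → ℝ × ℝ) (j : Jet) : ℝ × ℝ :=
  evol X Y j - evol Y X j

/-! ### Systems of conservation laws and their second order deformations -/

/-- The ten coefficients of a homogeneous differential polynomial of degree two with values in
`ℝ × ℝ`, namely `(a13 u_xx + a14 v_xx + a15 u_x² + a16 v_x² + a17 u_x v_x,
a23 u_xx + a24 v_xx + a25 u_x² + a26 v_x² + a27 u_x v_x)`; each coefficient is a function of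
`(u, v)`. -/
structure SecondOrder where
  a13 : ℝ × ℝ → ℝ
  a14 : ℝ × ℝ → ℝ
  a15 : ℝ × ℝ → ℝ
  a16 : ℝ × ℝ → ℝ
  a17 : ℝ × ℝ → ℝ
  a23 : ℝ × ℝ → ℝ
  a24 : ℝ × ℝ → ℝ
  a25 : ℝ × ℝ → ℝ
  a26 : ℝ × ℝ → ℝ
  a27 : ℝ × ℝ → ℝ

/-- All coefficients are smooth on `U`. -/
def SecondOrder.SmoothOn (a : SecondOrder) (U : Set (ℝ × ℝ)) : Prop :=
  ContDiffOn ℝ ∞ a.a13 U ∧ ContDiffOn ℝ ∞ a.a14 U ∧ ContDiffOn ℝ ∞ a.a15 U ∧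
  ContDiffOn ℝ ∞ a.a16 U ∧ ContDiffOn ℝ ∞ a.a17 U ∧ ContDiffOn ℝ ∞ a.a23 U ∧
  ContDiffOn ℝ ∞ a.a24 U ∧ ContDiffOn ℝ ∞ a.a25 U ∧ ContDiffOn ℝ ∞ a.a26 U ∧
  ContDiffOn ℝ ∞ a.a27 U

/-- The differential polynomial with the coefficients `a`. -/
def SecondOrder.toFun (a : SecondOrder) (j : Jet) : ℝ × ℝ :=
  (a.a13 (j 0) * (j 2).1 + a.a14 (j 0) * (j 2).2 + a.a15 (j 0) * (j 1).1 ^ 2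
      + a.a16 (j 0) * (j 1).2 ^ 2 + a.a17 (j 0) * ((j 1).1 * (j 1).2),
   a.a23 (j 0) * (j 2).1 + a.a24 (j 0) * (j 2).2 + a.a25 (j 0) * (j 1).1 ^ 2
      + a.a26 (j 0) * (j 1).2 ^ 2 + a.a27 (j 0) * ((j 1).1 * (j 1).2))

/-- The dispersionless system of conservation laws `w_t = ∂_x (α(w))`. -/
noncomputable def conservationLaw (α : ℝ × ℝ → ℝ × ℝ) : Jet → ℝ × ℝ :=
  Dx (fun j => α (j 0))

/-- The deformed system `w_t = ∂_x (α(w) + ε² a(w, w_x, w_xx))`. -/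
noncomputable def deformedLaw (α : ℝ × ℝ → ℝ × ℝ) (a : SecondOrder) (ε : ℝ) : Jet → ℝ × ℝ :=
  Dx (fun j => α (j 0) + ε ^ 2 • a.toFun j)

/-- Two systems depending on `ε` commute up to the order `ε²`, over the domain `U`. -/
def CommuteToOrderTwo (U : Set (ℝ × ℝ)) (X Y : ℝ → Jet → ℝ × ℝ) : Prop :=
  ∀ j : Jet, j 0 ∈ U →
    (fun ε : ℝ => commutator (X ε) (Y ε) j) =o[𝓝 0] (fun ε : ℝ => ε ^ 2)

/-- `w_τ = ∂_x (β(w))` is a symmetry of the dispersionless system `w_t = ∂_x (α(w))` over `U`. -/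
def IsSymmetry (U : Set (ℝ × ℝ)) (α β : ℝ × ℝ → ℝ × ℝ) : Prop :=
  ContDiffOn ℝ ∞ β U ∧
  ∀ j : Jet, j 0 ∈ U → commutator (conservationLaw α) (conservationLaw β) j = 0

/-- `(r₁, r₂)` is a pair of Riemann invariants on `U` of the dispersionless system
`w_t = ∂_x (α(w))`: the `r_i` are local coordinates in which the system reads
`(r_i)_t = l_i (r_i)_x`, with distinct characteristic velocities `l_i`. -/
def AreRiemannInvariants (U : Set (ℝ × ℝ)) (α : ℝ × ℝ → ℝ × ℝ) (r₁ r₂ : ℝ × ℝ → ℝ) : Prop :=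
  ContDiffOn ℝ ∞ r₁ U ∧ ContDiffOn ℝ ∞ r₂ U ∧
  (∀ p ∈ U, Function.Bijective (fderiv ℝ (fun q => (r₁ q, r₂ q)) p)) ∧
  ∃ l₁ l₂ : ℝ × ℝ → ℝ, ContDiffOn ℝ ∞ l₁ U ∧ ContDiffOn ℝ ∞ l₂ U ∧ (∀ p ∈ U, l₁ p ≠ l₂ p) ∧
    ∀ j : Jet, j 0 ∈ U →
      evol (conservationLaw α) (fun i => r₁ (i 0)) j = l₁ (j 0) * Dx (fun i => r₁ (i 0)) j ∧
      evol (conservationLaw α) (fun i => r₂ (i 0)) j = l₂ (j 0) * Dx (fun i => r₂ (i 0)) j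

/-- The second order deformation `w_t = ∂_x (α(w) + ε² a)` is integrable (up to the order `ε²`):
its dispersionless limit possesses Riemann invariants (for two components the semi-Hamiltonian
condition, which involves three different indices, is void), and every symmetry of the
dispersionless limit extends to a symmetry of the deformed system up to the order `ε²`.
A term of order `ε` in the extension would have to commute with the dispersionless limit by itself
and could be dropped, so that none is written. -/
def IsIntegrable (U : Set (ℝ × ℝ)) (α : ℝ × ℝ → ℝ × ℝ) (a : SecondOrder) : Prop :=
  (∃ r₁ r₂ : ℝ × ℝ → ℝ, AreRiemannInvariants U α r₁ r₂) ∧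
  ∀ β : ℝ × ℝ → ℝ × ℝ, IsSymmetry U α β →
    ∃ b : SecondOrder, b.SmoothOn U ∧ CommuteToOrderTwo U (deformedLaw α a) (deformedLaw β b)

/-! ### Miura transformations -/

/-- The four coefficients of a differential polynomial of degree one with values in `ℝ × ℝ`,
`(b11 u_x + b12 v_x, b21 u_x + b22 v_x)`. -/
structure FirstOrder where
  b11 : ℝ × ℝ → ℝ
  b12 : ℝ × ℝ → ℝ
  b21 : ℝ × ℝ → ℝ
  b22 : ℝ × ℝ → ℝ

/-- All coefficients are smooth on `U`. -/
def FirstOrder.SmoothOn (b : FirstOrder) (U : Set (ℝ × ℝ)) : Prop :=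
  ContDiffOn ℝ ∞ b.b11 U ∧ ContDiffOn ℝ ∞ b.b12 U ∧ ContDiffOn ℝ ∞ b.b21 U ∧
  ContDiffOn ℝ ∞ b.b22 U

/-- The differential polynomial with the coefficients `b`. -/
def FirstOrder.toFun (b : FirstOrder) (j : Jet) : ℝ × ℝ :=
  (b.b11 (j 0) * (j 1).1 + b.b12 (j 0) * (j 1).2,
   b.b21 (j 0) * (j 1).1 + b.b22 (j 0) * (j 1).2)

/-- The Miura transformation `w ↦ w + ε² ∂_x (b(w, w_x))`, which preserves the dispersionless limit
and the form of a system of conservation laws. -/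
noncomputable def miura (b : FirstOrder) (ε : ℝ) (j : Jet) : ℝ × ℝ :=
  j 0 + ε ^ 2 • Dx b.toFun j

/-- The jet of `φ(w, w_x, …)` as a function of the jet of `w`. -/
noncomputable def prolong (φ : Jet → ℝ × ℝ) (j : Jet) : Jet :=
  fun k => (Dx^[k] φ) j

/-- The change of unknown `w̃ = φ(w, w_x, …)` takes the system `w_t = X` to the system `w̃_t = Y`,
up to the order `ε²`, over the domain `U`. -/
def TransformsToOrderTwo (U : Set (ℝ × ℝ)) (φ X Y : ℝ → Jet → ℝ × ℝ) : Prop :=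
  ∀ j : Jet, j 0 ∈ U →
    (fun ε : ℝ => Y ε (prolong (φ ε) j) - evol (X ε) (φ ε) j) =o[𝓝 0] (fun ε : ℝ => ε ^ 2)

/-- The deformation `a` of `w_t = ∂_x (α(w))` can be reduced, over `U`, to the deformation `a'` by
a Miura transformation. -/
def MiuraReducesTo (U : Set (ℝ × ℝ)) (α : ℝ × ℝ → ℝ × ℝ) (a a' : SecondOrder) : Prop :=
  ∃ b : FirstOrder, b.SmoothOn U ∧
    TransformsToOrderTwo U (miura b) (deformedLaw α a) (deformedLaw α a')

/-! ### The primary flow and the normal form -/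

/-- The flux of the primary flow of the dihedral group `I₂(2m)` with parameter `c`. -/
noncomputable def primaryFlux (c m : ℝ) (p : ℝ × ℝ) : ℝ × ℝ :=
  (-2 * c * p.1 ^ m + p.2,
   -(m ^ 2 / (2 * m - 1)) * (c ^ 2 - 4) * p.1 ^ (2 * m - 1))

/-- The Riemann invariant `v - (c+2) u^m`. -/
noncomputable def riemann₁ (c m : ℝ) (p : ℝ × ℝ) : ℝ := p.2 - (c + 2) * p.1 ^ m

/-- The Riemann invariant `v - (c-2) u^m`. -/
noncomputable def riemann₂ (c m : ℝ) (p : ℝ × ℝ) : ℝ := p.2 - (c - 2) * p.1 ^ m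

/-- The function `a₂₃` with the functional parameters `F₁`, `F₂`. -/
noncomputable def leading (c m : ℝ) (F₁ F₂ : ℝ → ℝ) (p : ℝ × ℝ) : ℝ :=
  p.1 ^ (c * (m - 1) / 2 + 2 * m - 3) * F₁ (riemann₁ c m p)
    + p.1 ^ (-(c * (m - 1) / 2) + 2 * m - 3) * F₂ (riemann₂ c m p)

/-- `∂g/∂u`. -/
noncomputable def du (g : ℝ × ℝ → ℝ) (p : ℝ × ℝ) : ℝ := fderiv ℝ g p (1, 0)

/-- `∂g/∂v`. -/
noncomputable def dv (g : ℝ × ℝ → ℝ) (p : ℝ × ℝ) : ℝ := fderiv ℝ g p (0, 1)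

/-- A polynomial in the coefficient `a₁₆`. -/
def polyP (c m : ℝ) : ℝ :=
  c ^ 4 * m ^ 2 - 2 * c ^ 4 * m + c ^ 4 + 12 * c ^ 2 * m ^ 2 - 4 * c ^ 2 * m - 4 * c ^ 2 + 16 * m

/-- A polynomial in the coefficients `a₂₅` and `a₂₆`. -/
def polyQ (c m : ℝ) : ℝ :=
  (m - 1) ^ 2 * c ^ 4 + 4 * (6 * m ^ 2 - 3 * m - 2) * c ^ 2 + 16 * (m ^ 2 + m + 1)

/-- A polynomial in the coefficient `a₂₇`. -/
def polyR (c m : ℝ) : ℝ :=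
  (m - 1) ^ 2 * c ^ 6 + 4 * (6 * m ^ 2 - 3 * m - 2) * c ^ 4 + 16 * (m ^ 2 - m + 3) * c ^ 2
    + 128 * (m - 1)

/-- The coefficient `a₁₆`, as a differential expression in `g = a₂₃`. -/
noncomputable def coeff16 (c m : ℝ) (g : ℝ × ℝ → ℝ) (p : ℝ × ℝ) : ℝ :=
  polyP c m / (16 * m ^ 2 * (m - 1) ^ 2 * (c - 2) * (c + 2) * c * p.1 ^ (m - 2)) * dv (dv g) p
  + polyP c m / (8 * m ^ 3 * (m - 1) ^ 2 * (c - 2) ^ 2 * (c + 2) ^ 2 * p.1 ^ (2 * m - 3))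
      * du (dv g) p
  + polyP c m / (16 * m ^ 4 * (m - 1) ^ 2 * (c - 2) ^ 2 * (c + 2) ^ 2 * c * p.1 ^ (3 * m - 4))
      * du (du g) p
  - (m - 2) * polyP c m
      / (8 * m ^ 3 * (m - 1) ^ 2 * (c - 2) ^ 2 * (c + 2) ^ 2 * p.1 ^ (2 * m - 2)) * dv g p
  - (5 * m - 7) * polyP c m
      / (16 * m ^ 4 * (m - 1) ^ 2 * (c - 2) ^ 2 * (c + 2) ^ 2 * c * p.1 ^ (3 * m - 3)) * du g p
  + (c ^ 2 * (19 * m ^ 3 - 32 * m ^ 2 + 3 * m + 9) + 24 * m ^ 2 - 36 * m)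
      / (4 * (m - 1) * m ^ 4 * c * (c - 2) ^ 2 * (c + 2) ^ 2 * p.1 ^ (3 * m - 2)) * g p
  - (c ^ 6 * (m - 1) ^ 2 - 4 * c ^ 4 * (6 * m ^ 2 - 15 * m + 10))
      / (64 * m ^ 4 * c * (c - 2) ^ 2 * (c + 2) ^ 2 * p.1 ^ (3 * m - 2)) * g p

/-- The coefficient `a₂₄`, as a differential expression in `g = a₂₃`. -/
noncomputable def coeff24 (c m : ℝ) (g : ℝ × ℝ → ℝ) (p : ℝ × ℝ) : ℝ :=
  - (4 * p.1 ^ (m + 1) / ((m - 1) * c)) * dv (dv g) p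
  - 8 * p.1 ^ 2 / (m * (m - 1) * (c - 2) * (c + 2)) * du (dv g) p
  - 4 * p.1 ^ (-m + 3) / (m ^ 2 * (m - 1) * c * (c - 2) * (c + 2)) * du (du g) p
  + 8 * p.1 * (m - 2) / (m * (m - 1) * (c - 2) * (c + 2)) * dv g p
  + 4 * (5 * m - 7) * p.1 ^ (-m + 2) / (m ^ 2 * (m - 1) * c * (c - 2) * (c + 2)) * du g p
  - (c ^ 2 + 24 * m - 36) * p.1 ^ (-m + 1) / (c * (c - 2) * (c + 2) * m ^ 2) * g p

/-- The coefficient `a₂₅`, as a differential expression in `g = a₂₃`. -/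
noncomputable def coeff25 (c m : ℝ) (g : ℝ × ℝ → ℝ) (p : ℝ × ℝ) : ℝ :=
  m * polyQ c m * p.1 ^ (2 * m - 1) / (16 * (m - 1) ^ 2) * dv (dv g) p
  + c * polyQ c m * p.1 ^ m / (8 * (m - 1) ^ 2 * (c - 2) * (c + 2)) * du (dv g) p
  + polyQ c m * p.1 / (16 * m * (m - 1) ^ 2 * (c - 2) * (c + 2)) * du (du g) p
  - ((m - 2) * c ^ 6 - 32 * m) * p.1 ^ (m - 1) / (8 * c * (c - 2) * (c + 2)) * dv g p
  - (5 * m - 7) * c ^ 4 / (16 * m * (c - 2) * (c + 2)) * du g p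
  - ((22 * m ^ 3 - 56 * m ^ 2 + 14 * m + 16) * c ^ 4 + (32 * m ^ 3 - 48 * m ^ 2 - 32) * c ^ 2)
      * p.1 ^ (m - 1) / (8 * (m - 1) ^ 2 * c * (c - 2) * (c + 2)) * dv g p
  - ((104 * m ^ 3 - 196 * m ^ 2 + 28 * m + 56) * c ^ 2
        + 144 * m ^ 3 - 160 * m ^ 2 + 32 * m - 112)
      / (16 * m * (m - 1) ^ 2 * (c - 2) * (c + 2)) * du g p
  - ((m - 1) ^ 3 * c ^ 6 - (24 * m ^ 3 - 88 * m ^ 2 + 108 * m - 44) * c ^ 4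
        - (560 * m ^ 3 - 976 * m ^ 2 + 112 * m + 304) * c ^ 2)
      / (64 * (m - 1) * m * (c - 2) * (c + 2) * p.1) * g p
  + (8 * m ^ 3 - 8 * m ^ 2 + m - 9) / ((m - 1) * m * (c - 2) * (c + 2) * p.1) * g p

/-- The coefficient `a₂₆`, as a differential expression in `g = a₂₃`. -/
noncomputable def coeff26 (c m : ℝ) (g : ℝ × ℝ → ℝ) (p : ℝ × ℝ) : ℝ :=
  polyQ c m * p.1 / (16 * m * (m - 1) ^ 2 * (c - 2) * (c + 2)) * dv (dv g) p
  + c * polyQ c m / (8 * m ^ 2 * (m - 1) ^ 2 * (c - 2) ^ 2 * (c + 2) ^ 2 * p.1 ^ (m - 2))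
      * du (dv g) p
  + polyQ c m / (16 * m ^ 3 * (m - 1) ^ 2 * (c - 2) ^ 2 * (c + 2) ^ 2 * p.1 ^ (2 * m - 3))
      * du (du g) p
  - ((m - 2) * c ^ 6 + 32 * m)
      / (8 * m ^ 2 * c * (c - 2) ^ 2 * (c + 2) ^ 2 * p.1 ^ (m - 1)) * dv g p
  - (5 * m - 7) * c ^ 4 / (16 * m ^ 3 * (c - 2) ^ 2 * (c + 2) ^ 2 * p.1 ^ (2 * m - 2)) * du g p
  - ((34 * m ^ 3 - 80 * m ^ 2 + 26 * m + 16) * c ^ 4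
        + (-32 * m ^ 3 + 80 * m ^ 2 - 64 * m - 32) * c ^ 2)
      / (8 * m ^ 2 * (m - 1) ^ 2 * c * (c - 2) ^ 2 * (c + 2) ^ 2 * p.1 ^ (m - 1)) * dv g p
  - ((128 * m ^ 3 - 244 * m ^ 2 + 52 * m + 56) * c ^ 2
        + 48 * m ^ 3 + 32 * m ^ 2 - 64 * m - 112)
      / (16 * m ^ 3 * (m - 1) ^ 2 * (c - 2) ^ 2 * (c + 2) ^ 2 * p.1 ^ (2 * m - 2)) * du g p
  - ((-656 * m ^ 3 + 1200 * m ^ 2 - 240 * m - 304) * c ^ 2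
        - 128 * m ^ 3 - 384 * m ^ 2 + 448 * m + 576)
      / (64 * m ^ 3 * (m - 1) * (c - 2) ^ 2 * (c + 2) ^ 2 * p.1 ^ (2 * m - 1)) * g p
  - ((m - 1) ^ 2 * c ^ 6 - 4 * (6 * m ^ 2 - 16 * m + 11) * c ^ 4)
      / (64 * m ^ 3 * (c - 2) ^ 2 * (c + 2) ^ 2 * p.1 ^ (2 * m - 1)) * g p

/-- The coefficient `a₂₇`, as a differential expression in `g = a₂₃`. -/
noncomputable def coeff27 (c m : ℝ) (g : ℝ × ℝ → ℝ) (p : ℝ × ℝ) : ℝ :=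
  - (polyR c m * p.1 ^ m / (8 * (m - 1) ^ 2 * c * (c - 2) * (c + 2))) * dv (dv g) p
  - polyR c m * p.1 / (4 * m * (m - 1) ^ 2 * (c - 2) ^ 2 * (c + 2) ^ 2) * du (dv g) p
  - polyR c m / (8 * m ^ 2 * (m - 1) ^ 2 * c * (c - 2) ^ 2 * (c + 2) ^ 2 * p.1 ^ (m - 2))
      * du (du g) p
  + (5 * m - 7) * c ^ 6 / (8 * m ^ 2 * c * (c - 2) ^ 2 * (c + 2) ^ 2 * p.1 ^ (m - 1)) * du g p
  + (m - 2) * c ^ 6 / (4 * m * (c - 2) ^ 2 * (c + 2) ^ 2) * dv g p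
  + ((28 * m ^ 3 - 68 * m ^ 2 + 20 * m + 16) * c ^ 4
        + (-16 * m ^ 3 + 16 * m ^ 2 + 48 * m - 96) * c ^ 2 + 64 * m ^ 3 - 320 * m + 256)
      / (4 * m * (c - 2) ^ 2 * (c + 2) ^ 2 * (m - 1) ^ 2) * dv g p
  + ((29 * m ^ 3 - 55 * m ^ 2 + 10 * m + 14) * c ^ 4
        + 4 * (7 * m ^ 3 - 16 * m ^ 2 + 24 * m - 21) * c ^ 2
        - 16 * (m ^ 3 - 12 * m ^ 2 + 25 * m - 14))
      / (2 * m ^ 2 * (m - 1) ^ 2 * c * (c - 2) ^ 2 * (c + 2) ^ 2 * p.1 ^ (m - 1)) * du g p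
  + ((-768 * m ^ 3 + 1920 * m ^ 2 - 2496 * m + 1856) * c ^ 2
        + 512 * m ^ 3 - 4352 * m ^ 2 + 8448 * m - 4608)
      / (32 * m ^ 2 * (m - 1) * c * (c - 2) ^ 2 * (c + 2) ^ 2 * p.1 ^ m) * g p
  + ((m - 1) ^ 2 * c ^ 8 - 4 * (6 * m ^ 2 - 16 * m + 11) * c ^ 6
        - 16 * (33 * m ^ 2 - 23 * m - 21) * c ^ 4)
      / (32 * m ^ 2 * c * (c - 2) ^ 2 * (c + 2) ^ 2 * p.1 ^ m) * g p

/-- The normal form of the second order deformations, with `a₂₃ = g`. -/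
noncomputable def normalForm (c m : ℝ) (g : ℝ × ℝ → ℝ) : SecondOrder where
  a13 := fun _ => 0
  a14 := fun _ => 0
  a15 := fun p => coeff16 c m g p * (p.1 ^ (2 * m - 2) * m ^ 2 * (c ^ 2 - 4))
  a16 := coeff16 c m g
  a17 := fun p => coeff16 c m g p * (-2 * c * m * p.1 ^ (m - 1))
  a23 := g
  a24 := coeff24 c m g
  a25 := coeff25 c m g
  a26 := coeff26 c m g
  a27 := coeff27 c m g

end DihedralFlow

/-! At order `ε²` the problem is linear. Let `L_β = fluxOp β` be the linearisation of `w_τ = ∂_x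
β(w)` acting on fluxes. The flows `∂_x(α + ε² a)` and `∂_x(β + ε² b)`, with commuting dispersionless
limits, commute up to order `ε²` when `L_α b = L_β a` (`commutator_deformed`, `isLittleO_sq_iff`).
The Miura transformation `w ↦ w + ε² ∂_x k` replaces `a` by `a + L_α k` (`transformsToOrderTwo`).
The operators of commuting flows commute (`SymPair.fluxOp_comm`), so any `k` yields compatible
fluxes `L_β k`, one for each symmetry. A polynomial `k` gives only trivial deformations; nontrivial
ones come from a rational `k` whose images under all `L_β` are polynomial.

In Riemann invariants every symmetry is diagonal, with velocities `μ₁`, `μ₂` for which `∂₂μ₁/(μ₂ -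
μ₁)` and `∂₁μ₂/(μ₁ - μ₂)` do not depend on the symmetry. Take `k_i = φ_i r_{i,xx}/r_{i,x} + Σ_j b_ij
r_{j,x}`, a `Generator`. In component `i` of `L_β k` the only nonpolynomial monomial is `r_{i,xx}
r_{j,x}/r_{i,x}` with `j ≠ i`; its coefficient vanishes for all `β` at once when `φ_i` solves a
linear first order equation in the direction of the other frame vector. Each solution is a power of
`u` times an arbitrary function of `r_i`: these are the functional parameters `F₁`, `F₂`. So every
regular generator gives an integrable deformation (`Generator.Regular.isIntegrable`).

Conversely, one further symmetry is enough to force this shape, namely the one with Jacobian matrix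
`v + uA`, where `A` is the Jacobian matrix of the primary flux. Comparing monomials in `L_α b = L_β
a` gives the equations on `φ_i`; after subtraction of the flux of a suitable generator, all
remaining coefficients vanish (`Compatible.eq_zero`, `Compatible.exists_generator`).

Two generators with the same `φ_i` differ by a polynomial `k`, hence by a Miura transformation, so
the `b_ij` are free. They are fixed by requiring that the two frame components of the flux agree
except in the coefficient of `r_{1,x} r_{2,x}`. The first component of the flux is then a multiple
of `r_{1,x} r_{2,x} = m²(c²-4)u^{2m-2}u_x² - 2cm u^{m-1}u_x v_x + v_x²`, as in (3). The explicit
coefficients become rational identities in `u`, `u^m`, `c`, `m` and the frame derivatives of the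
`φ_i` (`IsSolution.normalForm_eqOn`). -/

namespace DihedralFlow

/-! ### Calculus on jet space: total and evolutionary derivatives as directional derivatives. -/

section Calculus

variable {E G H : Type*} [NormedAddCommGroup E] [NormedSpace ℝ E] [NormedAddCommGroup G]
  [NormedSpace ℝ G] [NormedAddCommGroup H] [NormedSpace ℝ H]

/-- Truncation of a jet to its first `n` entries. -/
noncomputable def jetTrunc (n : ℕ) : Jet →L[ℝ] (Fin n → ℝ × ℝ) :=
  ContinuousLinearMap.pi fun i => ContinuousLinearMap.proj (R := ℝ) (φ := fun _ : ℕ => ℝ × ℝ) i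

@[simp] lemma jetTrunc_apply (n : ℕ) (j : Jet) (i : Fin n) : jetTrunc n j i = j i := rfl

/-- On `Ω`, the function `f` is a smooth function of finitely many jet variables. -/
def JetSmooth (Ω : Set Jet) (f : Jet → E) : Prop :=
  ∃ (n : ℕ) (F : (Fin n → ℝ × ℝ) → E) (O : Set (Fin n → ℝ × ℝ)), IsOpen O ∧
    ContDiffOn ℝ ∞ F O ∧ ∀ j ∈ Ω, jetTrunc n j ∈ O ∧ f j = F (jetTrunc n j)

/-- Directional derivative of a differential function. -/
noncomputable def jetDir (f : Jet → E) (j η : Jet) : E := deriv (fun t : ℝ => f (j + t • η)) 0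

lemma eventually_line {Ω : Set Jet} (hΩ : IsOpen Ω) {j : Jet} (hj : j ∈ Ω) (η : Jet) :
    ∀ᶠ t : ℝ in 𝓝 0, j + t • η ∈ Ω := by
  have hc : Continuous fun t : ℝ => j + t • η := by fun_prop
  refine hc.continuousAt.eventually_mem ?_
  simpa using hΩ.mem_nhds hj

lemma hasDerivAt_line {n : ℕ} {F : (Fin n → ℝ × ℝ) → E} {O : Set (Fin n → ℝ × ℝ)}
    (hO : IsOpen O) (hF : ContDiffOn ℝ ∞ F O) {Ω : Set Jet} (hΩ : IsOpen Ω) {f : Jet → E}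
    (hf : ∀ j ∈ Ω, jetTrunc n j ∈ O ∧ f j = F (jetTrunc n j)) {j : Jet} (hj : j ∈ Ω) (η : Jet) :
    HasDerivAt (fun t : ℝ => f (j + t • η)) (fderiv ℝ F (jetTrunc n j) (jetTrunc n η)) 0 := by
  have h1 : HasFDerivAt F (fderiv ℝ F (jetTrunc n j)) (jetTrunc n j) :=
    ((hF.contDiffAt (hO.mem_nhds (hf j hj).1)).differentiableAt (by simp)).hasFDerivAt
  have h2 : HasDerivAt (fun t : ℝ => jetTrunc n j + t • jetTrunc n η) (jetTrunc n η) 0 := by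
    simpa using ((hasDerivAt_id (0 : ℝ)).smul_const (jetTrunc n η)).const_add (jetTrunc n j)
  have h3 : HasFDerivAt F (fderiv ℝ F (jetTrunc n j)) (jetTrunc n j + (0 : ℝ) • jetTrunc n η) := by
    simpa using h1
  refine (h3.comp_hasDerivAt 0 h2).congr_of_eventuallyEq ?_
  filter_upwards [eventually_line hΩ hj η] with t ht
  simp [(hf _ ht).2]

lemma JetSmooth.hasDerivAt {Ω : Set Jet} (hΩ : IsOpen Ω) {f : Jet → E} (hf : JetSmooth Ω f)
    {j : Jet} (hj : j ∈ Ω) (η : Jet) :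
    HasDerivAt (fun t : ℝ => f (j + t • η)) (jetDir f j η) 0 := by
  obtain ⟨n, F, O, hO, hF, h⟩ := hf
  exact (hasDerivAt_line hO hF hΩ h hj η).differentiableAt.hasDerivAt

lemma jetDir_eq {n : ℕ} {F : (Fin n → ℝ × ℝ) → E} {O : Set (Fin n → ℝ × ℝ)}
    (hO : IsOpen O) (hF : ContDiffOn ℝ ∞ F O) {Ω : Set Jet} (hΩ : IsOpen Ω) {f : Jet → E}
    (hf : ∀ j ∈ Ω, jetTrunc n j ∈ O ∧ f j = F (jetTrunc n j)) {j : Jet} (hj : j ∈ Ω) (η : Jet) :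
    jetDir f j η = fderiv ℝ F (jetTrunc n j) (jetTrunc n η) :=
  (hasDerivAt_line hO hF hΩ hf hj η).deriv

lemma jetDir_congr {Ω : Set Jet} (hΩ : IsOpen Ω) {f g : Jet → E} (h : Set.EqOn f g Ω) {j : Jet}
    (hj : j ∈ Ω) (η : Jet) : jetDir f j η = jetDir g j η := by
  refine Filter.EventuallyEq.deriv_eq ?_
  filter_upwards [eventually_line hΩ hj η] with t ht using h ht

/-! ### Closure properties -/

lemma JetSmooth.congr {Ω : Set Jet} {f g : Jet → E} (hf : JetSmooth Ω f) (h : Set.EqOn g f Ω) :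
    JetSmooth Ω g := by
  obtain ⟨n, F, O, hO, hF, H⟩ := hf
  exact ⟨n, F, O, hO, hF, fun j hj => ⟨(H j hj).1, (h hj).trans (H j hj).2⟩⟩

lemma JetSmooth.mono {Ω Ω' : Set Jet} {f : Jet → E} (hf : JetSmooth Ω f) (h : Ω' ⊆ Ω) :
    JetSmooth Ω' f := by
  obtain ⟨n, F, O, hO, hF, H⟩ := hf
  exact ⟨n, F, O, hO, hF, fun j hj => H j (h hj)⟩

lemma JetSmooth.comp {Ω : Set Jet} {f : Jet → E} {g : E → G} {O' : Set E} (hg : ContDiffOn ℝ ∞ g O')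
    (hO' : IsOpen O') (hf : JetSmooth Ω f) (hm : ∀ j ∈ Ω, f j ∈ O') :
    JetSmooth Ω fun j => g (f j) := by
  obtain ⟨n, F, O, hO, hF, H⟩ := hf
  refine ⟨n, g ∘ F, O ∩ F ⁻¹' O', hF.continuousOn.isOpen_inter_preimage hO hO', ?_, ?_⟩
  · exact hg.comp (hF.mono Set.inter_subset_left) fun x hx => hx.2
  · intro j hj
    have := H j hj
    refine ⟨⟨this.1, ?_⟩, by simp [this.2]⟩
    simpa [← this.2] using hm j hj

lemma JetSmooth.compContDiff {Ω : Set Jet} {f : Jet → E} {g : E → G} (hg : ContDiff ℝ ∞ g)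
    (hf : JetSmooth Ω f) : JetSmooth Ω fun j => g (f j) :=
  hf.comp hg.contDiffOn isOpen_univ fun _ _ => Set.mem_univ _

lemma jetSmooth_const (Ω : Set Jet) (x : E) : JetSmooth Ω fun _ => x :=
  ⟨0, fun _ => x, Set.univ, isOpen_univ, contDiffOn_const, fun _ _ => ⟨trivial, rfl⟩⟩

lemma jetSmooth_eval (Ω : Set Jet) (k : ℕ) : JetSmooth Ω fun j => j k :=
  ⟨k + 1, fun x => x (Fin.last k), Set.univ, isOpen_univ,
    (contDiff_apply ℝ (ℝ × ℝ) (Fin.last k)).contDiffOn, fun _ _ => ⟨trivial, rfl⟩⟩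

/-- Allows two differential functions of different orders to be written with the same number of jet
variables. -/
lemma JetSmooth.raise {Ω : Set Jet} {n : ℕ} {F : (Fin n → ℝ × ℝ) → E} {O : Set (Fin n → ℝ × ℝ)}
    {f : Jet → E} (hO : IsOpen O) (hF : ContDiffOn ℝ ∞ F O)
    (hf : ∀ j ∈ Ω, jetTrunc n j ∈ O ∧ f j = F (jetTrunc n j)) {N : ℕ} (hN : n ≤ N) :
    ∃ (F' : (Fin N → ℝ × ℝ) → E) (O' : Set (Fin N → ℝ × ℝ)), IsOpen O' ∧
    ContDiffOn ℝ ∞ F' O' ∧ ∀ j ∈ Ω, jetTrunc N j ∈ O' ∧ f j = F' (jetTrunc N j) := by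
  let L : (Fin N → ℝ × ℝ) →L[ℝ] (Fin n → ℝ × ℝ) :=
    ContinuousLinearMap.pi fun i =>
      ContinuousLinearMap.proj (R := ℝ) (φ := fun _ : Fin N => ℝ × ℝ) (Fin.castLE hN i)
  refine ⟨F ∘ L, L ⁻¹' O, hO.preimage L.continuous, ?_, fun j hj => ?_⟩
  · exact hF.comp L.contDiff.contDiffOn fun x hx => hx
  · exact hf j hj

lemma JetSmooth.pi {Ω : Set Jet} {d : ℕ} {f : Fin d → Jet → E} (hf : ∀ i, JetSmooth Ω (f i)) :
    JetSmooth Ω fun j i => f i j := by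
  choose n F O hO hF H using hf
  have hle : ∀ i, n i ≤ Finset.univ.sup n := fun i => Finset.le_sup (Finset.mem_univ i)
  choose F' O' hO' hF' H' using fun i => JetSmooth.raise (hO i) (hF i) (H i) (hle i)
  refine ⟨Finset.univ.sup n, fun x i => F' i x, ⋂ i, O' i, isOpen_iInter_of_finite hO', ?_, ?_⟩
  · exact contDiffOn_pi.2 fun i => (hF' i).mono (Set.iInter_subset _ i)
  · intro j hj
    exact ⟨Set.mem_iInter.2 fun i => (H' i j hj).1, funext fun i => (H' i j hj).2⟩

lemma JetSmooth.prodMk {Ω : Set Jet} {f : Jet → E} {g : Jet → G} (hf : JetSmooth Ω f)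
    (hg : JetSmooth Ω g) : JetSmooth Ω fun j => (f j, g j) := by
  obtain ⟨n, F, O, hO, hF, H⟩ := hf
  obtain ⟨n', F', O', hO', hF', H'⟩ := hg
  obtain ⟨F, O, hO, hF, H⟩ := JetSmooth.raise hO hF H (le_max_left n n')
  obtain ⟨F', O', hO', hF', H'⟩ := JetSmooth.raise hO' hF' H' (le_max_right n n')
  refine ⟨_, fun x => (F x, F' x), O ∩ O', hO.inter hO', ?_, fun j hj => ?_⟩
  · exact (hF.mono Set.inter_subset_left).prodMk (hF'.mono Set.inter_subset_right)
  · exact ⟨⟨(H j hj).1, (H' j hj).1⟩, Prod.ext (H j hj).2 (H' j hj).2⟩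

lemma JetSmooth.add {Ω : Set Jet} {f g : Jet → E} (hf : JetSmooth Ω f) (hg : JetSmooth Ω g) :
    JetSmooth Ω fun j => f j + g j :=
  (hf.prodMk hg).compContDiff (g := fun x : E × E => x.1 + x.2) (by fun_prop)

lemma JetSmooth.sub {Ω : Set Jet} {f g : Jet → E} (hf : JetSmooth Ω f) (hg : JetSmooth Ω g) :
    JetSmooth Ω fun j => f j - g j :=
  (hf.prodMk hg).compContDiff (g := fun x : E × E => x.1 - x.2) (by fun_prop)

lemma JetSmooth.smul {Ω : Set Jet} {f : Jet → ℝ} {g : Jet → E} (hf : JetSmooth Ω f)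
    (hg : JetSmooth Ω g) : JetSmooth Ω fun j => f j • g j :=
  (hf.prodMk hg).compContDiff (g := fun x : ℝ × E => x.1 • x.2) (by fun_prop)

lemma JetSmooth.mul {Ω : Set Jet} {f g : Jet → ℝ} (hf : JetSmooth Ω f) (hg : JetSmooth Ω g) :
    JetSmooth Ω fun j => f j * g j := hf.smul hg

lemma JetSmooth.pow {Ω : Set Jet} {f : Jet → ℝ} (hf : JetSmooth Ω f) (n : ℕ) :
    JetSmooth Ω fun j => f j ^ n :=
  hf.compContDiff (g := fun x : ℝ => x ^ n) (by fun_prop)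

lemma JetSmooth.inv {Ω : Set Jet} {f : Jet → ℝ} (hf : JetSmooth Ω f) (h0 : ∀ j ∈ Ω, f j ≠ 0) :
    JetSmooth Ω fun j => (f j)⁻¹ :=
  hf.comp (g := fun x : ℝ => x⁻¹) (O' := {0}ᶜ) (contDiffOn_inv ℝ) isOpen_compl_singleton h0

lemma JetSmooth.div {Ω : Set Jet} {f g : Jet → ℝ} (hf : JetSmooth Ω f) (hg : JetSmooth Ω g)
    (h0 : ∀ j ∈ Ω, g j ≠ 0) : JetSmooth Ω fun j => f j / g j := by
  simpa [div_eq_mul_inv] using hf.mul (hg.inv h0)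

/-! ### Directional derivatives -/

lemma jetDir_linear_right {Ω : Set Jet} (hΩ : IsOpen Ω) {f : Jet → E} (hf : JetSmooth Ω f)
    {j : Jet} (hj : j ∈ Ω) (η ζ : Jet) (s : ℝ) :
    jetDir f j (η + s • ζ) = jetDir f j η + s • jetDir f j ζ := by
  obtain ⟨n, F, O, hO, hF, H⟩ := hf
  simp only [jetDir_eq hO hF hΩ H hj, map_add, map_smul]

lemma jetDir_add {Ω : Set Jet} (hΩ : IsOpen Ω) {f g : Jet → E} (hf : JetSmooth Ω f)
    (hg : JetSmooth Ω g) {j : Jet} (hj : j ∈ Ω) (η : Jet) :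
    jetDir (fun i => f i + g i) j η = jetDir f j η + jetDir g j η :=
  ((hf.hasDerivAt hΩ hj η).add (hg.hasDerivAt hΩ hj η)).deriv

lemma jetDir_sub {Ω : Set Jet} (hΩ : IsOpen Ω) {f g : Jet → E} (hf : JetSmooth Ω f)
    (hg : JetSmooth Ω g) {j : Jet} (hj : j ∈ Ω) (η : Jet) :
    jetDir (fun i => f i - g i) j η = jetDir f j η - jetDir g j η :=
  ((hf.hasDerivAt hΩ hj η).sub (hg.hasDerivAt hΩ hj η)).deriv

lemma jetDir_smul {Ω : Set Jet} (hΩ : IsOpen Ω) {f : Jet → ℝ} {g : Jet → E} (hf : JetSmooth Ω f)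
    (hg : JetSmooth Ω g) {j : Jet} (hj : j ∈ Ω) (η : Jet) :
    jetDir (fun i => f i • g i) j η = f j • jetDir g j η + jetDir f j η • g j := by
  have := ((hf.hasDerivAt hΩ hj η).smul (hg.hasDerivAt hΩ hj η)).deriv
  rw [zero_smul, add_zero] at this
  exact this

lemma jetDir_eval (j η : Jet) (k : ℕ) : jetDir (fun i => i k) j η = η k := by
  have h2 : HasDerivAt (fun t : ℝ => (j + t • η) k) (η k) 0 := by
    simpa using ((hasDerivAt_id (0 : ℝ)).smul_const (η k)).const_add (j k)
  exact h2.deriv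

lemma jetDir_comp {f : Jet → E} {g : E → G} {j η : Jet} (hg : DifferentiableAt ℝ g (f j))
    {Ω : Set Jet} (hΩ : IsOpen Ω) (hf : JetSmooth Ω f) (hj : j ∈ Ω) :
    jetDir (fun i => g (f i)) j η = fderiv ℝ g (f j) (jetDir f j η) := by
  have h := hf.hasDerivAt hΩ hj η
  have h1 : HasFDerivAt g (fderiv ℝ g (f j)) (f (j + (0 : ℝ) • η)) := by
    simpa using hg.hasFDerivAt
  exact (h1.comp_hasDerivAt 0 h).deriv

lemma jetDir_base {g : ℝ × ℝ → G} {j : Jet} (hg : DifferentiableAt ℝ g (j 0)) (η : Jet) :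
    jetDir (fun i => g (i 0)) j η = fderiv ℝ g (j 0) (η 0) := by
  rw [jetDir_comp (f := fun i => i 0) hg isOpen_univ (jetSmooth_eval _ 0) (Set.mem_univ j),
    jetDir_eval]

lemma JetSmooth.jetDir {Ω : Set Jet} (hΩ : IsOpen Ω) {f : Jet → E} (hf : JetSmooth Ω f)
    {ξ : Jet → Jet} (hξ : ∀ k, JetSmooth Ω fun j => ξ j k) :
    JetSmooth Ω fun j => jetDir f j (ξ j) := by
  obtain ⟨n, F, O, hO, hF, H⟩ := hf
  have h1 : JetSmooth Ω fun j => jetTrunc n j := JetSmooth.pi fun i => jetSmooth_eval Ω i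
  have h2 : JetSmooth Ω fun j => jetTrunc n (ξ j) := JetSmooth.pi fun i => hξ i
  have h3 : ContDiffOn ℝ ∞ (fun x : (Fin n → ℝ × ℝ) × (Fin n → ℝ × ℝ) => fderiv ℝ F x.1 x.2)
      (O ×ˢ Set.univ) := by
    have : ContDiffOn ℝ ∞ (fderiv ℝ F) O := hF.fderiv_of_isOpen hO (by simp)
    exact (this.comp contDiff_fst.contDiffOn fun x hx => hx.1).clm_apply contDiff_snd.contDiffOn
  refine ((h1.prodMk h2).comp h3 (hO.prod isOpen_univ) ?_).congr ?_
  · exact fun j hj => ⟨(H j hj).1, trivial⟩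
  · exact fun j hj => jetDir_eq hO hF hΩ H hj _

/-- For vector fields `ξ`, `ζ` on jet space, the second derivative of `f` is symmetric, so the two
iterated derivatives differ only by the derivative of `f` along the bracket, which `h` makes zero.
-/
lemma jetDir_bracket {Ω : Set Jet} (hΩ : IsOpen Ω) {f : Jet → E} (hf : JetSmooth Ω f)
    {ξ ζ : Jet → Jet} (hξ : ∀ k, JetSmooth Ω fun j => ξ j k) (hζ : ∀ k, JetSmooth Ω fun j => ζ j k)
    {j : Jet} (hj : j ∈ Ω)
    (h : ∀ k, jetDir (fun i => ζ i k) j (ξ j) = jetDir (fun i => ξ i k) j (ζ j)) :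
    jetDir (fun i => jetDir f i (ζ i)) j (ξ j) = jetDir (fun i => jetDir f i (ξ i)) j (ζ j) := by
  obtain ⟨n, F, O, hO, hF, H⟩ := hf
  have hF' : ContDiffOn ℝ ∞ (fderiv ℝ F) O := hF.fderiv_of_isOpen hO (by simp)
  have hmem := hO.mem_nhds (H j hj).1
  have key : ∀ {ξ ζ : Jet → Jet}, (∀ k, JetSmooth Ω fun j => ξ j k) →
      (∀ k, JetSmooth Ω fun j => ζ j k) →
      jetDir (fun i => jetDir f i (ζ i)) j (ξ j) =
        fderiv ℝ (fderiv ℝ F) (jetTrunc n j) (jetTrunc n (ξ j)) (jetTrunc n (ζ j)) +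
        fderiv ℝ F (jetTrunc n j) (fun k => jetDir (fun i => ζ i k) j (ξ j)) := by
    intro ξ ζ hξ hζ
    rw [jetDir_congr hΩ (g := fun i => fderiv ℝ F (jetTrunc n i) (jetTrunc n (ζ i)))
      (fun i hi => jetDir_eq hO hF hΩ H hi _) hj]
    have h1 : HasDerivAt (fun t : ℝ => fderiv ℝ F (jetTrunc n (j + t • ξ j)))
        (fderiv ℝ (fderiv ℝ F) (jetTrunc n j) (jetTrunc n (ξ j))) 0 :=
      hasDerivAt_line hO hF' hΩ (f := fun i => fderiv ℝ F (jetTrunc n i))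
        (fun i hi => ⟨(H i hi).1, rfl⟩) hj _
    have h2 : HasDerivAt (fun t : ℝ => jetTrunc n (ζ (j + t • ξ j)))
        (fun k : Fin n => jetDir (fun i => ζ i k) j (ξ j)) 0 :=
      hasDerivAt_pi.2 fun k => (hζ k).hasDerivAt hΩ hj _
    have := (h1.clm_apply h2).deriv
    simpa [jetDir] using this
  rw [key hξ hζ, key hζ hξ]
  have hs : IsSymmSndFDerivAt ℝ F (jetTrunc n j) :=
    (hF.contDiffAt hmem).isSymmSndFDerivAt (by simpa using WithTop.coe_le_coe.2 (le_top : (2 : ℕ∞) ≤ ⊤))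
  rw [hs.eq]
  congr 2
  funext k
  exact h k

/-! ### Total derivatives and evolutionary derivatives -/

/-- The differential of a function of `n` jet variables is the sum of its partial derivatives; those
of index at least `n` contribute zero. All later computations use directional derivatives in place
of the formal sums. -/
lemma finsum_jetDeriv {Ω : Set Jet} (hΩ : IsOpen Ω) {f : Jet → E} (hf : JetSmooth Ω f) {j : Jet}
    (hj : j ∈ Ω) (η : Jet) : ∑ᶠ k, jetDeriv f j k (η k) = jetDir f j η := by
  obtain ⟨n, F, O, hO, hF, H⟩ := hf
  have hk : ∀ k, jetDeriv f j k (η k)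
      = fderiv ℝ F (jetTrunc n j) (jetTrunc n (Pi.single k (η k))) := by
    intro k
    have hd : DifferentiableAt ℝ F (jetTrunc n j) :=
      (hF.contDiffAt (hO.mem_nhds (H j hj).1)).differentiableAt (by simp)
    let L : ℝ × ℝ →L[ℝ] Jet := ContinuousLinearMap.single ℝ (fun _ : ℕ => ℝ × ℝ) k
    have he : ∀ p, Function.update j k p = j + L (p - j k) := by
      intro p
      ext i : 1
      by_cases hi : i = k
      · subst hi; simp [L]
      · simp [L, hi]
    have hev : ∀ᶠ p in 𝓝 (j k), f (Function.update j k p)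
        = F (jetTrunc n j + (jetTrunc n ∘L L) (p - j k)) := by
      have hc : Continuous fun p => Function.update j k p := by fun_prop
      have : ∀ᶠ p in 𝓝 (j k), Function.update j k p ∈ Ω :=
        hc.continuousAt.eventually_mem (by simpa using hΩ.mem_nhds hj)
      filter_upwards [this] with p hp
      rw [(H _ hp).2, he]
      simp
    have h1 : HasFDerivAt (fun p => jetTrunc n j + (jetTrunc n ∘L L) (p - j k))
        (jetTrunc n ∘L L) (j k) := by
      simp only [map_sub]
      exact ((jetTrunc n ∘L L).hasFDerivAt.sub_const _).const_add _
    have h2 : HasFDerivAt F (fderiv ℝ F (jetTrunc n j))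
        (jetTrunc n j + (jetTrunc n ∘L L) (j k - j k)) := by simpa using hd.hasFDerivAt
    have h3 := (h2.comp (j k) h1).congr_of_eventuallyEq hev
    rw [jetDeriv, h3.fderiv]
    rfl
  have hzero : ∀ k, n ≤ k → jetTrunc n (Pi.single k (η k)) = 0 := by
    intro k hk
    ext i : 1
    have : (i : ℕ) ≠ k := by have := i.2; omega
    simp [this]
  rw [jetDir_eq hO hF hΩ H hj]
  have hsub : Function.support (fun k => jetDeriv f j k (η k)) ⊆
      ((Finset.range n : Finset ℕ) : Set ℕ) := by
    intro k hk'
    by_contra hcon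
    apply hk'
    simp only [Finset.coe_range, Set.mem_Iio, not_lt] at hcon
    exact (hk k).trans (by rw [hzero k hcon, map_zero])
  rw [finsum_eq_sum_of_support_subset _ hsub]
  simp only [hk]
  rw [← map_sum, ← map_sum]
  congr 1
  ext i : 1
  simp [Finset.sum_apply, Pi.single_apply]

/-- The shifted jet. -/
def jetShift (j : Jet) : Jet := fun k => j (k + 1)

lemma Dx_eq {Ω : Set Jet} (hΩ : IsOpen Ω) {f : Jet → E} (hf : JetSmooth Ω f) {j : Jet}
    (hj : j ∈ Ω) : Dx f j = jetDir f j (jetShift j) :=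
  finsum_jetDeriv hΩ hf hj (jetShift j)

lemma evol_eq {Ω : Set Jet} (hΩ : IsOpen Ω) {f : Jet → E} (hf : JetSmooth Ω f) {j : Jet}
    (hj : j ∈ Ω) (X : Jet → ℝ × ℝ) : evol X f j = jetDir f j (prolong X j) :=
  finsum_jetDeriv hΩ hf hj (prolong X j)

lemma JetSmooth.Dx {Ω : Set Jet} (hΩ : IsOpen Ω) {f : Jet → E} (hf : JetSmooth Ω f) :
    JetSmooth Ω (Dx f) :=
  (hf.jetDir hΩ fun k => jetSmooth_eval Ω (k + 1)).congr fun _ hj => Dx_eq hΩ hf hj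

lemma JetSmooth.iterate_Dx {Ω : Set Jet} (hΩ : IsOpen Ω) {f : Jet → E} (hf : JetSmooth Ω f)
    (k : ℕ) : JetSmooth Ω (DihedralFlow.Dx^[k] f) := by
  induction k with
  | zero => exact hf
  | succ k ih => rw [Function.iterate_succ_apply']; exact ih.Dx hΩ

lemma JetSmooth.evol {Ω : Set Jet} (hΩ : IsOpen Ω) {f : Jet → E} (hf : JetSmooth Ω f)
    {X : Jet → ℝ × ℝ} (hX : JetSmooth Ω X) : JetSmooth Ω (evol X f) :=
  (hf.jetDir hΩ fun k => hX.iterate_Dx hΩ k).congr fun _ hj => evol_eq hΩ hf hj X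

lemma Dx_eqOn {Ω : Set Jet} (hΩ : IsOpen Ω) {f g : Jet → E} (hf : JetSmooth Ω f)
    (h : Set.EqOn f g Ω) : Set.EqOn (Dx f) (Dx g) Ω := by
  intro j hj
  rw [Dx_eq hΩ hf hj, Dx_eq hΩ (hf.congr h.symm) hj]
  exact jetDir_congr hΩ h hj _

lemma iterate_Dx_eqOn {Ω : Set Jet} (hΩ : IsOpen Ω) {f g : Jet → E} (hf : JetSmooth Ω f)
    (h : Set.EqOn f g Ω) (k : ℕ) : Set.EqOn (Dx^[k] f) (Dx^[k] g) Ω := by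
  induction k with
  | zero => exact h
  | succ k ih =>
    rw [Function.iterate_succ_apply', Function.iterate_succ_apply']
    exact Dx_eqOn hΩ (hf.iterate_Dx hΩ k) ih

lemma prolong_eq {Ω : Set Jet} (hΩ : IsOpen Ω) {X Y : Jet → ℝ × ℝ} (hX : JetSmooth Ω X)
    (h : Set.EqOn X Y Ω) {j : Jet} (hj : j ∈ Ω) : prolong X j = prolong Y j :=
  funext fun k => iterate_Dx_eqOn hΩ hX h k hj

/-- The total derivative is the vector field with components `j (k + 1)`, the evolutionary
derivative the one with components `D^k X`. Their bracket vanishes, since either field applied to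
the other's `k`-th component gives `D^(k+1) X`. -/
lemma evol_Dx {Ω : Set Jet} (hΩ : IsOpen Ω) {f : Jet → E} (hf : JetSmooth Ω f) {X : Jet → ℝ × ℝ}
    (hX : JetSmooth Ω X) {j : Jet} (hj : j ∈ Ω) : evol X (Dx f) j = Dx (evol X f) j := by
  rw [evol_eq hΩ (hf.Dx hΩ) hj, Dx_eq hΩ (hf.evol hΩ hX) hj,
    jetDir_congr hΩ (fun i hi => Dx_eq hΩ hf hi) hj,
    jetDir_congr hΩ (fun i hi => evol_eq hΩ hf hi X) hj]
  refine jetDir_bracket hΩ hf (fun k => hX.iterate_Dx hΩ k) (fun k => jetSmooth_eval Ω (k + 1))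
    hj ?_
  intro k
  have h1 : jetDir (fun i => prolong X i k) j (jetShift j) = (Dx^[k + 1] X) j := by
    rw [Function.iterate_succ_apply', Dx_eq hΩ (hX.iterate_Dx hΩ k) hj]; rfl
  exact (jetDir_eval j (prolong X j) (k + 1)).trans h1.symm

lemma evol_iterate_Dx {Ω : Set Jet} (hΩ : IsOpen Ω) {f : Jet → E} (hf : JetSmooth Ω f)
    {X : Jet → ℝ × ℝ} (hX : JetSmooth Ω X) (k : ℕ) :
    Set.EqOn (evol X (Dx^[k] f)) (Dx^[k] (evol X f)) Ω := by
  induction k with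
  | zero => exact fun _ _ => rfl
  | succ k ih =>
    intro j hj
    rw [Function.iterate_succ_apply', Function.iterate_succ_apply',
      evol_Dx hΩ (hf.iterate_Dx hΩ k) hX hj]
    exact Dx_eqOn hΩ ((hf.iterate_Dx hΩ k).evol hΩ hX) ih hj

/-- The `k`-th component of the bracket of the two prolonged vector fields is `D^k` of the
commutator of the systems. -/
lemma evol_comm {Ω : Set Jet} (hΩ : IsOpen Ω) {f : Jet → E} (hf : JetSmooth Ω f)
    {X Y : Jet → ℝ × ℝ} (hX : JetSmooth Ω X) (hY : JetSmooth Ω Y)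
    (h : ∀ i ∈ Ω, commutator X Y i = 0) {j : Jet} (hj : j ∈ Ω) :
    evol X (evol Y f) j = evol Y (evol X f) j := by
  rw [evol_eq hΩ (hf.evol hΩ hY) hj, evol_eq hΩ (hf.evol hΩ hX) hj,
    jetDir_congr hΩ (fun i hi => evol_eq hΩ hf hi Y) hj,
    jetDir_congr hΩ (fun i hi => evol_eq hΩ hf hi X) hj]
  refine jetDir_bracket hΩ hf (fun k => hX.iterate_Dx hΩ k) (fun k => hY.iterate_Dx hΩ k) hj ?_
  intro k
  have h1 := evol_iterate_Dx hΩ hY hX k hj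
  have h2 := evol_iterate_Dx hΩ hX hY k hj
  rw [evol_eq hΩ (hY.iterate_Dx hΩ k) hj] at h1
  rw [evol_eq hΩ (hX.iterate_Dx hΩ k) hj] at h2
  refine h1.trans (Eq.trans ?_ h2.symm)
  exact iterate_Dx_eqOn hΩ (hY.evol hΩ hX) (fun i hi => sub_eq_zero.1 (h i hi)) k hj

end Calculus

/-! ### Order `ε²`: commutation and Miura transformations in terms of fluxes. -/

section Deformations

variable {E : Type*} [NormedAddCommGroup E] [NormedSpace ℝ E]

/-- The jets of functions with values in `U`. -/
def jetDomain (U : Set (ℝ × ℝ)) : Set Jet := {j | j 0 ∈ U}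

lemma isOpen_jetDomain {U : Set (ℝ × ℝ)} (hU : IsOpen U) : IsOpen (jetDomain U) :=
  hU.preimage (continuous_apply 0)

lemma jetSmooth_base {Ω : Set Jet} {U : Set (ℝ × ℝ)} (hU : IsOpen U) (hΩ : Ω ⊆ jetDomain U)
    {h : ℝ × ℝ → E} (hh : ContDiffOn ℝ ∞ h U) : JetSmooth Ω fun j => h (j 0) :=
  (jetSmooth_eval Ω 0).comp hh hU fun _ hj => hΩ hj

lemma iterate_Dx_add_smul {Ω : Set Jet} (hΩ : IsOpen Ω) {f g : Jet → E} (hf : JetSmooth Ω f)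
    (hg : JetSmooth Ω g) (s : ℝ) (k : ℕ) :
    Set.EqOn (Dx^[k] fun j => f j + s • g j) (fun j => (Dx^[k] f) j + s • (Dx^[k] g) j) Ω := by
  induction k with
  | zero => exact fun _ _ => rfl
  | succ k ih =>
    intro j hj
    have hs : JetSmooth Ω fun j => f j + s • g j := hf.add ((jetSmooth_const Ω s).smul hg)
    have hf' := hf.iterate_Dx hΩ k
    have hg' := hg.iterate_Dx hΩ k
    have hsg : JetSmooth Ω fun j => s • (Dx^[k] g) j := (jetSmooth_const Ω s).smul hg'
    simp only [Function.iterate_succ_apply']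
    rw [Dx_eqOn hΩ (hs.iterate_Dx hΩ k) ih hj, Dx_eq hΩ (hf'.add hsg) hj, jetDir_add hΩ hf' hsg hj,
      jetDir_smul hΩ (jetSmooth_const Ω s) hg' hj, Dx_eq hΩ hf' hj, Dx_eq hΩ hg' hj]
    simp [jetDir]

lemma Dx_add_smul {Ω : Set Jet} (hΩ : IsOpen Ω) {f g : Jet → E} (hf : JetSmooth Ω f)
    (hg : JetSmooth Ω g) (s : ℝ) {j : Jet} (hj : j ∈ Ω) :
    Dx (fun j => f j + s • g j) j = Dx f j + s • Dx g j :=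
  iterate_Dx_add_smul hΩ hf hg s 1 hj

lemma prolong_add_smul {Ω : Set Jet} (hΩ : IsOpen Ω) {X Y : Jet → ℝ × ℝ} (hX : JetSmooth Ω X)
    (hY : JetSmooth Ω Y) (s : ℝ) {j : Jet} (hj : j ∈ Ω) :
    prolong (fun j => X j + s • Y j) j = prolong X j + s • prolong Y j :=
  funext fun k => iterate_Dx_add_smul hΩ hX hY s k hj

lemma iterate_Dx_eval {Ω : Set Jet} (hΩ : IsOpen Ω) (k : ℕ) :
    Set.EqOn (Dx^[k] fun j => j 0) (fun j => j k) Ω := by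
  induction k with
  | zero => exact fun _ _ => rfl
  | succ k ih =>
    intro j hj
    rw [Function.iterate_succ_apply',
      Dx_eqOn hΩ ((jetSmooth_eval Ω 0).iterate_Dx hΩ k) ih hj, Dx_eq hΩ (jetSmooth_eval Ω k) hj,
      jetDir_eval]
    rfl

lemma evol_add_smul {Ω : Set Jet} (hΩ : IsOpen Ω) {f : Jet → E} (hf : JetSmooth Ω f)
    {X Y : Jet → ℝ × ℝ} (hX : JetSmooth Ω X) (hY : JetSmooth Ω Y) (s : ℝ) {j : Jet} (hj : j ∈ Ω) :
    evol (fun j => X j + s • Y j) f j = evol X f j + s • evol Y f j := by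
  rw [evol_eq hΩ hf hj, evol_eq hΩ hf hj, evol_eq hΩ hf hj, prolong_add_smul hΩ hX hY s hj,
    jetDir_linear_right hΩ hf hj]

lemma evol_add_smul_right {Ω : Set Jet} (hΩ : IsOpen Ω) {f g : Jet → E} (hf : JetSmooth Ω f)
    (hg : JetSmooth Ω g) (X : Jet → ℝ × ℝ) (s : ℝ) {j : Jet} (hj : j ∈ Ω) :
    evol X (fun j => f j + s • g j) j = evol X f j + s • evol X g j := by
  have hsg : JetSmooth Ω fun j => s • g j := (jetSmooth_const Ω s).smul hg
  rw [evol_eq hΩ (hf.add hsg) hj, evol_eq hΩ hf hj, evol_eq hΩ hg hj, jetDir_add hΩ hf hsg hj,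
    jetDir_smul hΩ (jetSmooth_const Ω s) hg hj]
  simp [jetDir]

lemma evol_congr {Ω : Set Jet} (hΩ : IsOpen Ω) {f g : Jet → E} (hf : JetSmooth Ω f)
    {X Y : Jet → ℝ × ℝ} (hX : JetSmooth Ω X) (hfg : Set.EqOn f g Ω) (hXY : Set.EqOn X Y Ω)
    {j : Jet} (hj : j ∈ Ω) : evol X f j = evol Y g j := by
  rw [evol_eq hΩ hf hj, evol_eq hΩ (hf.congr hfg.symm) hj, prolong_eq hΩ hX hXY hj,
    jetDir_congr hΩ hfg hj]

lemma evol_base {U : Set (ℝ × ℝ)} (hU : IsOpen U) {h : ℝ × ℝ → E} (hh : ContDiffOn ℝ ∞ h U)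
    (X : Jet → ℝ × ℝ) {j : Jet} (hj : j 0 ∈ U) :
    evol X (fun i => h (i 0)) j = fderiv ℝ h (j 0) (X j) := by
  rw [evol_eq (isOpen_jetDomain hU) (jetSmooth_base hU subset_rfl hh) hj,
    jetDir_base ((hh.contDiffAt (hU.mem_nhds hj)).differentiableAt (by simp))]
  rfl

lemma Dx_base {U : Set (ℝ × ℝ)} (hU : IsOpen U) {h : ℝ × ℝ → E} (hh : ContDiffOn ℝ ∞ h U)
    {j : Jet} (hj : j 0 ∈ U) : Dx (fun i => h (i 0)) j = fderiv ℝ h (j 0) (j 1) := by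
  rw [Dx_eq (isOpen_jetDomain hU) (jetSmooth_base hU subset_rfl hh) hj,
    jetDir_base ((hh.contDiffAt (hU.mem_nhds hj)).differentiableAt (by simp))]
  rfl

lemma jetSmooth_conservationLaw {Ω : Set Jet} (hΩ : IsOpen Ω) {U : Set (ℝ × ℝ)} (hU : IsOpen U)
    (hΩU : Ω ⊆ jetDomain U) {β : ℝ × ℝ → ℝ × ℝ} (hβ : ContDiffOn ℝ ∞ β U) :
    JetSmooth Ω (conservationLaw β) :=
  (jetSmooth_base hU hΩU hβ).Dx hΩ

/-- The linearisation of the flow `w_t = ∂_x (β(w))` acting on the fluxes `k`: the flux of the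
commutator of this flow with `w_s = ∂_x k`. -/
noncomputable def fluxOp (β : ℝ × ℝ → ℝ × ℝ) (k : Jet → ℝ × ℝ) (j : Jet) : ℝ × ℝ :=
  evol (conservationLaw β) k j - fderiv ℝ β (j 0) (Dx k j)

lemma jetSmooth_fderiv_apply {Ω : Set Jet} {U : Set (ℝ × ℝ)} (hU : IsOpen U)
    (hΩU : Ω ⊆ jetDomain U) {β : ℝ × ℝ → E} (hβ : ContDiffOn ℝ ∞ β U) {k : Jet → ℝ × ℝ}
    (hk : JetSmooth Ω k) : JetSmooth Ω fun j => fderiv ℝ β (j 0) (k j) := by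
  have h : JetSmooth Ω fun j => fderiv ℝ β (j 0) :=
    jetSmooth_base hU hΩU (hβ.fderiv_of_isOpen hU (by simp))
  exact (h.prodMk hk).compContDiff (g := fun x : (ℝ × ℝ →L[ℝ] E) × (ℝ × ℝ) => x.1 x.2)
    (contDiff_fst.clm_apply contDiff_snd)

lemma JetSmooth.fluxOp {Ω : Set Jet} (hΩ : IsOpen Ω) {U : Set (ℝ × ℝ)} (hU : IsOpen U)
    (hΩU : Ω ⊆ jetDomain U) {β : ℝ × ℝ → ℝ × ℝ} (hβ : ContDiffOn ℝ ∞ β U) {k : Jet → ℝ × ℝ}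
    (hk : JetSmooth Ω k) : JetSmooth Ω (fluxOp β k) :=
  (hk.evol hΩ (jetSmooth_conservationLaw hΩ hU hΩU hβ)).sub
    (jetSmooth_fderiv_apply hU hΩU hβ (hk.Dx hΩ))

lemma evol_law {U : Set (ℝ × ℝ)} (hU : IsOpen U) {β : ℝ × ℝ → ℝ × ℝ} (hβ : ContDiffOn ℝ ∞ β U)
    {Z : Jet → ℝ × ℝ} (hZ : JetSmooth (jetDomain U) Z) {j : Jet} (hj : j ∈ jetDomain U) :
    evol Z (conservationLaw β) j = Dx (fun i => fderiv ℝ β (i 0) (Z i)) j := by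
  have hΩ := isOpen_jetDomain hU
  have hb := jetSmooth_base hU subset_rfl hβ
  rw [conservationLaw, evol_Dx hΩ hb hZ hj]
  exact Dx_eqOn hΩ (hb.evol hΩ hZ) (fun i hi => evol_base hU hβ Z hi) hj

/-- `evol` is linear both in the flow and in the function, so the commutator is a quadratic
polynomial in `s`. The terms linear in `s` are total derivatives, because evolutionary derivatives
commute with `Dx`, and their fluxes assemble into the two linearised operators. -/
lemma commutator_deformed {U : Set (ℝ × ℝ)} (hU : IsOpen U) {α β : ℝ × ℝ → ℝ × ℝ}
    (hα : ContDiffOn ℝ ∞ α U) (hβ : ContDiffOn ℝ ∞ β U) {a b : Jet → ℝ × ℝ}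
    (ha : JetSmooth (jetDomain U) a) (hb : JetSmooth (jetDomain U) b) {j : Jet}
    (hj : j ∈ jetDomain U) (s : ℝ) :
    commutator (Dx fun i => α (i 0) + s • a i) (Dx fun i => β (i 0) + s • b i) j =
      commutator (conservationLaw α) (conservationLaw β) j
        + s • Dx (fun i => fluxOp α b i - fluxOp β a i) j
        + s ^ 2 • commutator (Dx a) (Dx b) j := by
  have hΩ := isOpen_jetDomain hU
  have hα' := jetSmooth_base hU subset_rfl hα
  have hβ' := jetSmooth_base hU subset_rfl hβ
  have key : ∀ {α β : ℝ × ℝ → ℝ × ℝ} (_ : ContDiffOn ℝ ∞ α U) (_ : ContDiffOn ℝ ∞ β U)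
      {a b : Jet → ℝ × ℝ} (_ : JetSmooth (jetDomain U) a) (_ : JetSmooth (jetDomain U) b),
      evol (Dx fun i => α (i 0) + s • a i) (Dx fun i => β (i 0) + s • b i) j =
      evol (conservationLaw α) (conservationLaw β) j
      + s • (Dx (evol (conservationLaw α) b) j + Dx (fun i => fderiv ℝ β (i 0) (Dx a i)) j)
      + s ^ 2 • evol (Dx a) (Dx b) j := by
    intro α β hα hβ a b ha hb
    have hα' := jetSmooth_base hU subset_rfl hα
    have hβ' := jetSmooth_base hU subset_rfl hβ
    have hs := jetSmooth_const (jetDomain U) s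
    rw [evol_congr hΩ ((hβ'.add (hs.smul hb)).Dx hΩ) ((hα'.add (hs.smul ha)).Dx hΩ)
      (fun i hi => Dx_add_smul hΩ hβ' hb s hi) (fun i hi => Dx_add_smul hΩ hα' ha s hi) hj,
      evol_add_smul_right hΩ (hβ'.Dx hΩ) (hb.Dx hΩ) _ _ hj,
      evol_add_smul hΩ (hβ'.Dx hΩ) (hα'.Dx hΩ) (ha.Dx hΩ) _ hj,
      evol_add_smul hΩ (hb.Dx hΩ) (hα'.Dx hΩ) (ha.Dx hΩ) _ hj, evol_Dx hΩ hb (hα'.Dx hΩ) hj]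
    have := evol_law hU hβ (ha.Dx hΩ) hj
    rw [conservationLaw] at this
    rw [this]
    simp only [conservationLaw]
    module
  have e1 := hb.evol hΩ (jetSmooth_conservationLaw hΩ hU subset_rfl hα)
  have e2 := jetSmooth_fderiv_apply hU subset_rfl hα (hb.Dx hΩ)
  have e3 := ha.evol hΩ (jetSmooth_conservationLaw hΩ hU subset_rfl hβ)
  have e4 := jetSmooth_fderiv_apply hU subset_rfl hβ (ha.Dx hΩ)
  have h5 : Dx (fun i => fluxOp α b i - fluxOp β a i) j =
      Dx (evol (conservationLaw α) b) j - Dx (fun i => fderiv ℝ α (i 0) (Dx b i)) j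
      - (Dx (evol (conservationLaw β) a) j - Dx (fun i => fderiv ℝ β (i 0) (Dx a i)) j) := by
    unfold fluxOp
    rw [Dx_eq hΩ ((e1.sub e2).sub (e3.sub e4)) hj, jetDir_sub hΩ (e1.sub e2) (e3.sub e4) hj,
      jetDir_sub hΩ e1 e2 hj, jetDir_sub hΩ e3 e4 hj, Dx_eq hΩ e1 hj, Dx_eq hΩ e2 hj,
      Dx_eq hΩ e3 hj, Dx_eq hΩ e4 hj]
  rw [commutator, commutator, commutator, key hα hβ ha hb, key hβ hα hb ha, h5]
  module

/-- Applied with `s = ε²` in `commutator_deformed`: the quadratic term is of order `ε⁴` and imposes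
no condition. -/
lemma isLittleO_sq_iff (x y : E) :
    (fun ε : ℝ => ε ^ 2 • x + (ε ^ 2) ^ 2 • y) =o[𝓝 0] (fun ε : ℝ => ε ^ 2) ↔ x = 0 := by
  have hy : (fun ε : ℝ => (ε ^ 2) ^ 2 • y) =o[𝓝 0] (fun ε : ℝ => ε ^ 2) := by
    have h1 : (fun ε : ℝ => (ε ^ 2) ^ 2) =o[𝓝 0] (fun ε : ℝ => ε ^ 2) := by
      simpa [← pow_mul] using (Asymptotics.isLittleO_pow_pow (𝕜 := ℝ) (by norm_num : 2 < 4))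
    have h2 : (fun _ : ℝ => y) =O[𝓝 0] (fun _ : ℝ => (1 : ℝ)) :=
      Asymptotics.isBigO_const_const y one_ne_zero _
    simpa using h1.smul_isBigO h2
  constructor
  · intro h
    have h1 : (fun ε : ℝ => ε ^ 2 • x) =o[𝓝 0] (fun ε : ℝ => ε ^ 2) := by
      simpa using h.sub hy
    by_contra hx
    have h2 := (h1.bound (half_pos (norm_pos_iff.2 hx)))
    have h3 : ∀ᶠ ε : ℝ in 𝓝[≠] 0, ‖ε ^ 2 • x‖ ≤ ‖x‖ / 2 * ‖ε ^ 2‖ :=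
        h2.filter_mono nhdsWithin_le_nhds
    obtain ⟨ε, h4, h5⟩ := (h3.and self_mem_nhdsWithin).exists
    rw [norm_smul] at h4
    have h6 : 0 < ‖ε ^ 2‖ := norm_pos_iff.2 (pow_ne_zero 2 h5)
    have h7 : 0 < ‖x‖ := norm_pos_iff.2 hx
    nlinarith
  · rintro rfl
    simpa using hy

/-- A differential function whose total derivative vanishes depends on `w` only. -/
lemma eq_of_Dx_eq_zero {U : Set (ℝ × ℝ)} (hU : IsOpen U) {f : Jet → E}
    (hf : JetSmooth (jetDomain U) f) (h : ∀ j ∈ jetDomain U, Dx f j = 0) {j j' : Jet}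
    (hj : j ∈ jetDomain U) (h0 : j 0 = j' 0) : f j = f j' := by
  have hΩ := isOpen_jetDomain hU
  -- Induction on the number of jet variables on which `f` depends, removing the highest one at each
  -- step.
  have key : ∀ n : ℕ, (∀ j ∈ jetDomain U, ∀ j' ∈ jetDomain U,
      (∀ k < n + 1, j k = j' k) → f j = f j') →
      ∀ j ∈ jetDomain U, ∀ j' ∈ jetDomain U, j 0 = j' 0 → f j = f j' := by
    intro n
    induction n with
    | zero =>
      intro H j hj j' hj' h0
      exact H j hj j' hj' fun k hk => by obtain rfl : k = 0 := by omega
                                         exact h0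
    | succ n ih =>
      intro H
      refine ih fun j hj j' hj' hjj => ?_
      set δ : ℝ × ℝ := j' (n + 1) - j (n + 1)
      set e : Jet := Pi.single (n + 1) δ
      have he0 : e 0 = 0 := by simp [e]
      have hmem : ∀ t : ℝ, j + t • e ∈ jetDomain U := fun t => by
        have : (j + t • e) 0 = j 0 := by simp [he0]
        simpa [jetDomain, this] using hj
      -- If `f` depends on variables up to `n + 1`, changing the variable `n + 2` leaves the
      -- differential of `f` alone but adds `e` to the shifted jet. Since `Dx f` vanishes at both
      -- jets, the derivative along `e` is zero.
      have hdir : ∀ i ∈ jetDomain U, jetDir f i e = 0 := by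
        intro i hi
        set i' : Jet := i + (Pi.single (n + 2) δ : Jet)
        have hi'k : ∀ k < n + 2, i' k = i k := by
          intro k hk
          have : k ≠ n + 2 := by omega
          simp [i', this]
        have hi' : i' ∈ jetDomain U := by
          have := hi'k 0 (by omega)
          simpa [jetDomain, this] using hi
        have h1 : jetDir f i' (jetShift i') = 0 := by rw [← Dx_eq hΩ hf hi']; exact h i' hi'
        have h2 : jetDir f i (jetShift i) = 0 := by rw [← Dx_eq hΩ hf hi]; exact h i hi
        have h3 : ∀ η : Jet, jetDir f i' η = jetDir f i η := by
          intro η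
          refine Filter.EventuallyEq.deriv_eq ?_
          filter_upwards [eventually_line hΩ hi η, eventually_line hΩ hi' η] with t ht ht'
          exact H _ ht' _ ht fun k hk => by simp [hi'k k hk]
        have h4 : jetShift i' = jetShift i + (1 : ℝ) • e := by
          funext k
          by_cases hk : k = n + 1
          · subst hk; simp [jetShift, i', e]
          · have : k + 1 ≠ n + 2 := by omega
            simp [jetShift, i', e, hk]
        rw [h3, h4, jetDir_linear_right hΩ hf hi, h2, zero_add, one_smul] at h1
        exact h1
      have hd : ∀ t : ℝ, HasDerivAt (fun t : ℝ => f (j + t • e)) 0 t := by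
        intro t
        have h1 := hf.hasDerivAt hΩ (hmem t) e
        rw [hdir _ (hmem t)] at h1
        have h1' : HasDerivAt (fun s : ℝ => f (j + t • e + s • e)) 0 (t - t) := by simpa using h1
        have h0 : HasDerivAt (fun s : ℝ => s - t) 1 t := (hasDerivAt_id t).sub_const t
        have h2 := HasDerivAt.scomp (h := fun s : ℝ => s - t) t h1' h0
        rw [smul_zero] at h2
        refine (h2.congr_of_eventuallyEq (.of_forall fun s => ?_))
        simp only [Function.comp]
        congr 1
        module
      have hc := is_const_of_deriv_eq_zero (fun t => (hd t).differentiableAt)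
        (fun t => (hd t).deriv) 0 1
      simp only [zero_smul, add_zero, one_smul] at hc
      rw [hc]
      refine H _ (by simpa using hmem 1) _ hj' fun k hk => ?_
      by_cases hk' : k = n + 1
      · subst hk'; simp [e, δ]
      · simp [e, hk', hjj k (by omega)]
  obtain ⟨n, F, O, -, -, H⟩ := hf
  refine key n (fun i hi i' hi' hii => ?_) j hj j' (by simpa [jetDomain, ← h0] using hj) h0
  rw [(H i hi).2, (H i' hi').2]
  congr 1
  funext k
  exact hii k (by omega)

/-- To first order in `s = ε²`, the flow `∂_x α` at the displaced jet gains its derivative along the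
prolongation of `∂_x b`, while the time derivative of the new unknown gains `∂_x` of the time
derivative of `b`. The difference of these gains is `∂_x` of `fluxOp α b`, up to sign, and `h` makes
it compensate `a' - a`. -/
lemma transformsToOrderTwo {U : Set (ℝ × ℝ)} (hU : IsOpen U) {α : ℝ × ℝ → ℝ × ℝ}
    (hα : ContDiffOn ℝ ∞ α U) {a a' b : Jet → ℝ × ℝ} (ha : JetSmooth (jetDomain U) a)
    (ha' : JetSmooth (jetDomain U) a') (hb : JetSmooth (jetDomain U) b)
    (h : ∀ j ∈ jetDomain U, a' j = a j + fluxOp α b j) :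
    TransformsToOrderTwo U (fun ε j => j 0 + ε ^ 2 • Dx b j)
      (fun ε => Dx fun j => α (j 0) + ε ^ 2 • a j)
      (fun ε => Dx fun j => α (j 0) + ε ^ 2 • a' j) := by
  intro j hj
  have hΩ := isOpen_jetDomain hU
  have hα' := jetSmooth_base hU subset_rfl hα
  have hX := jetSmooth_conservationLaw hΩ hU subset_rfl hα
  have hA := ha.Dx hΩ
  have hA' := ha'.Dx hΩ
  have hB := hb.Dx hΩ
  set ζ : Jet := prolong (Dx b) j with hζ
  set D : ℝ × ℝ := jetDir (conservationLaw α) j ζ with hD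
  set C : ℝ × ℝ := evol (Dx a) (Dx b) j with hC
  have e1 := hb.evol hΩ hX
  have e2 := jetSmooth_fderiv_apply hU subset_rfl hα hB
  have hrel : Dx a' j = Dx a j + (evol (conservationLaw α) (Dx b) j - D) := by
    refine (Dx_eqOn hΩ ha' h hj).trans ((Dx_eq hΩ (ha.add (e1.sub e2)) hj).trans ?_)
    rw [jetDir_add hΩ ha (e1.sub e2) hj, ← Dx_eq hΩ ha hj]
    congr 1
    have hE : evol (conservationLaw α) (Dx b) j = Dx (evol (conservationLaw α) b) j :=
      evol_Dx hΩ hb hX hj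
    have hE' : D = Dx (fun i => fderiv ℝ α (i 0) (Dx b i)) j := by
      rw [← evol_law hU hα hB hj, evol_eq hΩ hX hj]
    rw [hE, hE', Dx_eq hΩ e1 hj, Dx_eq hΩ e2 hj]
    exact jetDir_sub hΩ e1 e2 hj _
  have hprol : ∀ ε : ℝ, prolong (fun i : Jet => i 0 + ε ^ 2 • Dx b i) j = j + ε ^ 2 • ζ := by
    intro ε
    rw [prolong_add_smul hΩ (jetSmooth_eval _ 0) hB _ hj]
    congr 1
    exact funext fun k => iterate_Dx_eval hΩ k hj
  have hevol : ∀ ε : ℝ, evol (Dx fun j => α (j 0) + ε ^ 2 • a j)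
      (fun i : Jet => i 0 + ε ^ 2 • Dx b i) j =
      conservationLaw α j + ε ^ 2 • Dx a j
        + ε ^ 2 • (evol (conservationLaw α) (Dx b) j + ε ^ 2 • C) := by
    intro ε
    have h0 : evol (fun i => conservationLaw α i + ε ^ 2 • Dx a i) (fun i : Jet => i 0) j
        = conservationLaw α j + ε ^ 2 • Dx a j := by
      rw [evol_eq hΩ (jetSmooth_eval _ 0) hj, jetDir_eval]; rfl
    rw [evol_congr hΩ ((jetSmooth_eval _ 0).add ((jetSmooth_const _ _).smul hB))
      ((hα'.add ((jetSmooth_const _ (ε ^ 2)).smul ha)).Dx hΩ) (fun _ _ => rfl)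
      (fun i hi => Dx_add_smul hΩ hα' ha _ hi) hj,
      evol_add_smul_right hΩ (jetSmooth_eval _ 0) hB _ _ hj,
      evol_add_smul hΩ hB (hα'.Dx hΩ) hA _ hj]
    exact congrArg (· + _) h0
  -- With `t = ε²` this is the exact discrepancy: a first order Taylor remainder, plus `t` times an
  -- increment that tends to zero, plus a term in `t²`.
  have ho : (fun t : ℝ => (conservationLaw α (j + t • ζ) - conservationLaw α j - t • D)
      + t • (Dx a' (j + t • ζ) - Dx a' j) - t • t • C) =o[𝓝 0] (fun t : ℝ => t) := by
    have o1 := (hasDerivAt_iff_isLittleO_nhds_zero.1 (hX.hasDerivAt hΩ hj ζ))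
    have o1' : (fun t : ℝ => conservationLaw α (j + t • ζ) - conservationLaw α j - t • D)
        =o[𝓝 0] (fun t : ℝ => t) := by
      simpa [conservationLaw, D] using o1
    have small : ∀ g : ℝ → ℝ × ℝ, Filter.Tendsto g (𝓝 0) (𝓝 0) →
        (fun t : ℝ => t • g t) =o[𝓝 0] (fun t : ℝ => t) := by
      intro g hg
      simpa using (Asymptotics.isBigO_refl (fun t : ℝ => t) (𝓝 0)).smul_isLittleO
        ((Asymptotics.isLittleO_one_iff ℝ).2 hg)
    refine (o1'.add (small _ ?_)).sub (small _ ?_)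
    · have := (hA'.hasDerivAt hΩ hj ζ).continuousAt.tendsto.sub_const (Dx a' j)
      simpa using this
    · have : ContinuousAt (fun t : ℝ => t • C) 0 := by fun_prop
      simpa using this.tendsto
  have hsq : Filter.Tendsto (fun ε : ℝ => ε ^ 2) (𝓝 0) (𝓝 0) := by
    have : ContinuousAt (fun ε : ℝ => ε ^ 2) 0 := by fun_prop
    simpa using this.tendsto
  refine (ho.comp_tendsto hsq).congr' ?_ (.of_forall fun _ => rfl)
  filter_upwards [hsq.eventually (eventually_line hΩ hj ζ)] with ε hε
  simp only [Function.comp, hprol, hevol]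
  rw [Dx_add_smul hΩ hα' ha' _ hε, hrel]
  simp only [conservationLaw]
  module

end Deformations

/-! ### The coordinate frame of the Riemann invariants and the velocities of symmetries. -/

section Frame

/-- An open set in the half plane `u > 0`, with `m > 1`. -/
structure AdmissibleDomain (m : ℝ) (U : Set (ℝ × ℝ)) : Prop where
  one_lt : 1 < m
  isOpen : IsOpen U
  pos : ∀ p ∈ U, 0 < p.1

/-- Derivative of `h` along the vector field `X`. -/
noncomputable def along (X : ℝ × ℝ → ℝ × ℝ) (h : ℝ × ℝ → ℝ) (p : ℝ × ℝ) : ℝ := fderiv ℝ h p (X p)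

/-- Since `r₂ - r₁ = 4 u^m`, `kap` is `∂u/∂r₂ = -∂u/∂r₁`, and `rho` is the logarithmic derivative of
`kap` with respect to `u`. The constants `sig` and `tau` come from `v = tau r₁ + sig r₂`. -/
noncomputable def kap (m : ℝ) (p : ℝ × ℝ) : ℝ := p.1 ^ (1 - m) / (4 * m)
noncomputable def rho (m : ℝ) (p : ℝ × ℝ) : ℝ := (1 - m) / p.1
noncomputable def sig (c : ℝ) : ℝ := (2 + c) / 4
noncomputable def tau (c : ℝ) : ℝ := (2 - c) / 4

/-- The coordinate vector field of the Riemann invariant `r₁`. -/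
noncomputable def frame₁ (c m : ℝ) (p : ℝ × ℝ) : ℝ × ℝ := (-kap m p, tau c)

/-- The coordinate vector field of the Riemann invariant `r₂`. -/
noncomputable def frame₂ (c m : ℝ) (p : ℝ × ℝ) : ℝ × ℝ := (kap m p, sig c)

/-- The characteristic velocities. -/
noncomputable def lam₁ (c m : ℝ) (p : ℝ × ℝ) : ℝ := -sig c / kap m p
noncomputable def lam₂ (c m : ℝ) (p : ℝ × ℝ) : ℝ := tau c / kap m p

lemma sig_add_tau (c : ℝ) : sig c + tau c = 1 := by unfold sig tau; ring

variable {c m : ℝ} {U : Set (ℝ × ℝ)}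

lemma along_add {X : ℝ × ℝ → ℝ × ℝ} {f g : ℝ × ℝ → ℝ} (hU : IsOpen U) (hf : ContDiffOn ℝ ∞ f U)
    (hg : ContDiffOn ℝ ∞ g U) {p : ℝ × ℝ} (hp : p ∈ U) :
    along X (fun w => f w + g w) p = along X f p + along X g p := by
  have h1 := (hf.contDiffAt (hU.mem_nhds hp)).differentiableAt (by simp)
  have h2 := (hg.contDiffAt (hU.mem_nhds hp)).differentiableAt (by simp)
  simp [along, fderiv_fun_add h1 h2]

lemma along_mul {X : ℝ × ℝ → ℝ × ℝ} {f g : ℝ × ℝ → ℝ} (hU : IsOpen U) (hf : ContDiffOn ℝ ∞ f U)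
    (hg : ContDiffOn ℝ ∞ g U) {p : ℝ × ℝ} (hp : p ∈ U) :
    along X (fun w => f w * g w) p = f p * along X g p + along X f p * g p := by
  have h1 := (hf.contDiffAt (hU.mem_nhds hp)).differentiableAt (by simp)
  have h2 := (hg.contDiffAt (hU.mem_nhds hp)).differentiableAt (by simp)
  simp [along, fderiv_fun_mul h1 h2, mul_comm]

lemma along_const {X : ℝ × ℝ → ℝ × ℝ} (a : ℝ) (p : ℝ × ℝ) : along X (fun _ => a) p = 0 := by
  simp [along]

lemma along_fst {X : ℝ × ℝ → ℝ × ℝ} (p : ℝ × ℝ) : along X (fun w => w.1) p = (X p).1 := by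
  simp [along, fderiv_fst]

lemma along_snd {X : ℝ × ℝ → ℝ × ℝ} (p : ℝ × ℝ) : along X (fun w => w.2) p = (X p).2 := by
  simp [along, fderiv_snd]

lemma along_congr {X : ℝ × ℝ → ℝ × ℝ} {f g : ℝ × ℝ → ℝ} (hU : IsOpen U) (h : Set.EqOn f g U)
    {p : ℝ × ℝ} (hp : p ∈ U) : along X f p = along X g p := by
  have : f =ᶠ[𝓝 p] g := Filter.eventuallyEq_of_mem (hU.mem_nhds hp) h
  rw [along, along, this.fderiv_eq]

lemma contDiffOn_along {X : ℝ × ℝ → ℝ × ℝ} {f : ℝ × ℝ → ℝ} (hU : IsOpen U)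
    (hX : ContDiffOn ℝ ∞ X U) (hf : ContDiffOn ℝ ∞ f U) : ContDiffOn ℝ ∞ (along X f) U :=
  (hf.fderiv_of_isOpen hU (by simp)).clm_apply hX

lemma along_of_hasDerivAt {X : ℝ × ℝ → ℝ × ℝ} {f : ℝ → ℝ} {f' : ℝ} {p : ℝ × ℝ}
    (hf : HasDerivAt f f' p.1) : along X (fun w => f w.1) p = f' * (X p).1 := by
  have h1 : HasFDerivAt (fun w : ℝ × ℝ => f w.1) (f' • ContinuousLinearMap.fst ℝ ℝ ℝ) p :=
    hf.comp_hasFDerivAt p hasFDerivAt_fst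
  rw [along, h1.fderiv]
  simp

namespace AdmissibleDomain

variable (hU : AdmissibleDomain m U)
include hU

lemma m_pos : 0 < m := by linarith [hU.one_lt]

lemma kap_pos {p : ℝ × ℝ} (hp : p ∈ U) : 0 < kap m p :=
  div_pos (Real.rpow_pos_of_pos (hU.pos p hp) _) (by linarith [hU.one_lt])

lemma contDiffOn_rpow (s : ℝ) : ContDiffOn ℝ ∞ (fun p : ℝ × ℝ => p.1 ^ s) U := by
  intro p hp
  exact ((contDiffAt_fst).rpow_const_of_ne (hU.pos p hp).ne').contDiffWithinAt

lemma contDiffOn_kap : ContDiffOn ℝ ∞ (kap m) U := (hU.contDiffOn_rpow _).div_const _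

lemma contDiffOn_rho : ContDiffOn ℝ ∞ (rho m) U :=
  contDiffOn_const.div contDiff_fst.contDiffOn fun p hp => (hU.pos p hp).ne'

lemma contDiffOn_lam₁ : ContDiffOn ℝ ∞ (lam₁ c m) U :=
  contDiffOn_const.div hU.contDiffOn_kap fun _ hp => (hU.kap_pos hp).ne'

lemma contDiffOn_lam₂ : ContDiffOn ℝ ∞ (lam₂ c m) U :=
  contDiffOn_const.div hU.contDiffOn_kap fun _ hp => (hU.kap_pos hp).ne'

lemma contDiffOn_frame₁ : ContDiffOn ℝ ∞ (frame₁ c m) U :=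
  hU.contDiffOn_kap.neg.prodMk contDiffOn_const

lemma contDiffOn_frame₂ : ContDiffOn ℝ ∞ (frame₂ c m) U :=
  hU.contDiffOn_kap.prodMk contDiffOn_const

lemma along_rpow {X : ℝ × ℝ → ℝ × ℝ} (s : ℝ) {p : ℝ × ℝ} (hp : p ∈ U) :
    along X (fun w => w.1 ^ s) p = s * p.1 ^ s / p.1 * (X p).1 := by
  have h0 := hU.pos p hp
  rw [along_of_hasDerivAt (Real.hasDerivAt_rpow_const (Or.inl h0.ne')), Real.rpow_sub_one h0.ne']
  ring

lemma along_kap {X : ℝ × ℝ → ℝ × ℝ} {p : ℝ × ℝ} (hp : p ∈ U) :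
    along X (kap m) p = rho m p * kap m p * (X p).1 := by
  have h0 := hU.pos p hp
  have h := along_of_hasDerivAt (X := X) (p := p) ((Real.hasDerivAt_rpow_const (p := 1 - m)
    (Or.inl h0.ne')).div_const (4 * m))
  refine h.trans ?_
  rw [Real.rpow_sub_one h0.ne', rho, kap]
  ring

lemma along_rho {X : ℝ × ℝ → ℝ × ℝ} {p : ℝ × ℝ} (hp : p ∈ U) :
    along X (rho m) p = -rho m p / p.1 * (X p).1 := by
  have h0 := hU.pos p hp
  have h := along_of_hasDerivAt (X := X) (p := p) ((hasDerivAt_inv h0.ne').const_mul (1 - m))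
  refine (along_congr hU.isOpen (fun w _ => ?_) hp).trans (h.trans ?_)
  · rw [rho, div_eq_mul_inv]
  · rw [rho]
    field_simp

lemma along_div_kap {X : ℝ × ℝ → ℝ × ℝ} (s : ℝ) {p : ℝ × ℝ} (hp : p ∈ U) :
    along X (fun w => s / kap m w) p = -(s * rho m p) / kap m p * (X p).1 := by
  have hk := (hU.kap_pos hp).ne'
  have h1 : ContDiffOn ℝ ∞ (fun w => s / kap m w) U :=
    contDiffOn_const.div hU.contDiffOn_kap fun _ hp => (hU.kap_pos hp).ne'
  have h := along_mul (X := X) hU.isOpen h1 hU.contDiffOn_kap hp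
  rw [along_congr hU.isOpen (g := fun _ => s)
    (fun w hw => div_mul_cancel₀ _ (hU.kap_pos hw).ne') hp, along_const, hU.along_kap hp] at h
  field_simp at h ⊢
  linarith

lemma d1_lam₁ {p : ℝ × ℝ} (hp : p ∈ U) :
    along (frame₁ c m) (lam₁ c m) p = -(sig c * rho m p) := by
  have hk := (hU.kap_pos hp).ne'
  refine (hU.along_div_kap _ hp).trans ?_
  simp only [frame₁]; field_simp

lemma d2_lam₁ {p : ℝ × ℝ} (hp : p ∈ U) :
    along (frame₂ c m) (lam₁ c m) p = sig c * rho m p := by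
  have hk := (hU.kap_pos hp).ne'
  refine (hU.along_div_kap _ hp).trans ?_
  simp only [frame₂]; field_simp

lemma d1_lam₂ {p : ℝ × ℝ} (hp : p ∈ U) :
    along (frame₁ c m) (lam₂ c m) p = tau c * rho m p := by
  have hk := (hU.kap_pos hp).ne'
  refine (hU.along_div_kap _ hp).trans ?_
  simp only [frame₁]; field_simp

lemma d2_lam₂ {p : ℝ × ℝ} (hp : p ∈ U) :
    along (frame₂ c m) (lam₂ c m) p = -(tau c * rho m p) := by
  have hk := (hU.kap_pos hp).ne'
  refine (hU.along_div_kap _ hp).trans ?_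
  simp only [frame₂]; field_simp

lemma rpow_m_sub_one {p : ℝ × ℝ} (hp : p ∈ U) : p.1 ^ (m - 1) = 1 / (4 * m * kap m p) := by
  have h0 := hU.pos p hp
  have hm := hU.m_pos
  rw [kap, show m - 1 = -(1 - m) by ring, Real.rpow_neg h0.le]
  field_simp

lemma contDiffOn_riemann (d : ℝ) : ContDiffOn ℝ ∞ (fun p : ℝ × ℝ => p.2 - d * p.1 ^ m) U :=
  contDiff_snd.contDiffOn.sub (contDiffOn_const.mul (hU.contDiffOn_rpow m))

lemma fderiv_riemann (d : ℝ) {p : ℝ × ℝ} (hp : p ∈ U) (z : ℝ × ℝ) :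
    fderiv ℝ (fun p : ℝ × ℝ => p.2 - d * p.1 ^ m) p z = z.2 - d / (4 * kap m p) * z.1 := by
  have h0 := hU.pos p hp
  have hm := hU.m_pos
  have hk := hU.kap_pos hp
  have h1 : HasFDerivAt (fun w : ℝ × ℝ => w.1 ^ m)
      ((m * p.1 ^ (m - 1)) • ContinuousLinearMap.fst ℝ ℝ ℝ) p :=
    (Real.hasDerivAt_rpow_const (Or.inl h0.ne')).comp_hasFDerivAt p hasFDerivAt_fst
  have h2 : HasFDerivAt (fun p : ℝ × ℝ => p.2 - d * p.1 ^ m) (ContinuousLinearMap.snd ℝ ℝ ℝ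
    - d • ((m * p.1 ^ (m - 1)) • ContinuousLinearMap.fst ℝ ℝ ℝ)) p :=
    (hasFDerivAt_snd).sub (h1.const_mul d)
  rw [h2.fderiv, hU.rpow_m_sub_one hp]
  simp
  field_simp

lemma fderiv_riemann₁ {p : ℝ × ℝ} (hp : p ∈ U) (z : ℝ × ℝ) :
    fderiv ℝ (riemann₁ c m) p z = z.2 - sig c / kap m p * z.1 := by
  refine (hU.fderiv_riemann (c + 2) hp z).trans ?_
  unfold sig; ring

lemma fderiv_riemann₂ {p : ℝ × ℝ} (hp : p ∈ U) (z : ℝ × ℝ) :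
    fderiv ℝ (riemann₂ c m) p z = z.2 + tau c / kap m p * z.1 := by
  refine (hU.fderiv_riemann (c - 2) hp z).trans ?_
  unfold tau; ring

end AdmissibleDomain

/-! ### Symmetries in terms of the frame -/

/-- The Jacobian matrix of `β` is `p + q A`, where `A` is the Jacobian matrix of the primary
flux. -/
structure SymPair (c m : ℝ) (U : Set (ℝ × ℝ)) (β : ℝ × ℝ → ℝ × ℝ) (p q : ℝ × ℝ → ℝ) : Prop where
  smooth : ContDiffOn ℝ ∞ β U
  smooth_p : ContDiffOn ℝ ∞ p U
  smooth_q : ContDiffOn ℝ ∞ q U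
  jacobian : ∀ w ∈ U, ∀ z : ℝ × ℝ, fderiv ℝ β w z =
    ((p w + (tau c - sig c) / kap m w * q w) * z.1 + q w * z.2,
      sig c * tau c / kap m w ^ 2 * q w * z.1 + p w * z.2)
  d1_p : ∀ w ∈ U, along (frame₁ c m) p w = -lam₂ c m w * along (frame₁ c m) q w
  d2_p : ∀ w ∈ U, along (frame₂ c m) p w = -lam₁ c m w * along (frame₂ c m) q w

/-- The characteristic velocities of a symmetry. -/
noncomputable def mu₁ (c m : ℝ) (p q : ℝ × ℝ → ℝ) (w : ℝ × ℝ) : ℝ := p w + q w * lam₁ c m w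
noncomputable def mu₂ (c m : ℝ) (p q : ℝ × ℝ → ℝ) (w : ℝ × ℝ) : ℝ := p w + q w * lam₂ c m w

namespace SymPair

variable {β : ℝ × ℝ → ℝ × ℝ} {p q : ℝ × ℝ → ℝ} (hS : SymPair c m U β p q)
  (hU : AdmissibleDomain m U)
include hS hU

lemma contDiffOn_mu₁ : ContDiffOn ℝ ∞ (mu₁ c m p q) U :=
  hS.smooth_p.add (hS.smooth_q.mul hU.contDiffOn_lam₁)

lemma contDiffOn_mu₂ : ContDiffOn ℝ ∞ (mu₂ c m p q) U :=
  hS.smooth_p.add (hS.smooth_q.mul hU.contDiffOn_lam₂)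

lemma along_mu₁ {X : ℝ × ℝ → ℝ × ℝ} {w : ℝ × ℝ} (hw : w ∈ U) :
    along X (mu₁ c m p q) w
      = along X p w + (q w * along X (lam₁ c m) w + along X q w * lam₁ c m w) :=
  (along_add hU.isOpen hS.smooth_p (hS.smooth_q.mul hU.contDiffOn_lam₁) hw).trans
    (congrArg _ (along_mul hU.isOpen hS.smooth_q hU.contDiffOn_lam₁ hw))

lemma along_mu₂ {X : ℝ × ℝ → ℝ × ℝ} {w : ℝ × ℝ} (hw : w ∈ U) :
    along X (mu₂ c m p q) w
      = along X p w + (q w * along X (lam₂ c m) w + along X q w * lam₂ c m w) :=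
  (along_add hU.isOpen hS.smooth_p (hS.smooth_q.mul hU.contDiffOn_lam₂) hw).trans
    (congrArg _ (along_mul hU.isOpen hS.smooth_q hU.contDiffOn_lam₂ hw))

/-- The closedness relation on `p`, `q` removes the derivative of `q`, leaving `q ∂₂λ₁`. As `μ₂ - μ₁
= q / kap`, the ratio `∂₂μ₁/(μ₂ - μ₁) = sig rho kap` is common to all symmetries; this is what makes
one generator serve them all. -/
lemma d2_mu₁ {w : ℝ × ℝ} (hw : w ∈ U) :
    along (frame₂ c m) (mu₁ c m p q) w = sig c * rho m w * q w := by
  rw [hS.along_mu₁ hU hw, hS.d2_p w hw, hU.d2_lam₁ hw]; ring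

lemma d1_mu₂ {w : ℝ × ℝ} (hw : w ∈ U) :
    along (frame₁ c m) (mu₂ c m p q) w = tau c * rho m w * q w := by
  rw [hS.along_mu₂ hU hw, hS.d1_p w hw, hU.d1_lam₂ hw]; ring

lemma d1_mu₁ {w : ℝ × ℝ} (hw : w ∈ U) :
    along (frame₁ c m) (mu₁ c m p q) w =
      -(along (frame₁ c m) q w / kap m w) - q w * (sig c * rho m w) := by
  rw [hS.along_mu₁ hU hw, hS.d1_p w hw, hU.d1_lam₁ hw, lam₁, lam₂, tau, sig]; ring

lemma d2_mu₂ {w : ℝ × ℝ} (hw : w ∈ U) :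
    along (frame₂ c m) (mu₂ c m p q) w =
      along (frame₂ c m) q w / kap m w - q w * (tau c * rho m w) := by
  rw [hS.along_mu₂ hU hw, hS.d2_p w hw, hU.d2_lam₂ hw, lam₁, lam₂, tau, sig]; ring

omit hS hU in
lemma mu₂_sub_mu₁ (p q : ℝ × ℝ → ℝ) (w : ℝ × ℝ) :
    mu₂ c m p q w = mu₁ c m p q w + q w / kap m w := by
  simp only [mu₁, mu₂, lam₁, lam₂, tau, sig]; ring

end SymPair

end Frame

/-! ### Flows and linearised operators written in the frame. -/

section FrameCalculus

variable {c m : ℝ} {U : Set (ℝ × ℝ)}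

/-- The `x`-derivatives of the Riemann invariants. -/
noncomputable def jetR₁ (c m : ℝ) : Jet → ℝ := Dx fun j => riemann₁ c m (j 0)
noncomputable def jetR₂ (c m : ℝ) : Jet → ℝ := Dx fun j => riemann₂ c m (j 0)
noncomputable def jetS₁ (c m : ℝ) : Jet → ℝ := Dx (jetR₁ c m)
noncomputable def jetS₂ (c m : ℝ) : Jet → ℝ := Dx (jetR₂ c m)
noncomputable def jetT₁ (c m : ℝ) : Jet → ℝ := Dx (jetS₁ c m)
noncomputable def jetT₂ (c m : ℝ) : Jet → ℝ := Dx (jetS₂ c m)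

/-- The vector with components `k₁`, `k₂` in the frame. -/
noncomputable def frameVec (c m : ℝ) (k₁ k₂ : Jet → ℝ) (j : Jet) : ℝ × ℝ :=
  (kap m (j 0) * (k₂ j - k₁ j), tau c * k₁ j + sig c * k₂ j)

/-- `f` has the derivative `d` at `j` in the direction `η`. -/
def HasJetDir (f : Jet → ℝ) (j η : Jet) (d : ℝ) : Prop :=
  HasDerivAt (fun t : ℝ => f (j + t • η)) d 0

namespace HasJetDir

variable {f g : Jet → ℝ} {j η : Jet} {d e : ℝ}

lemma eq (h : HasJetDir f j η d) : jetDir f j η = d := HasDerivAt.deriv h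

lemma add (hf : HasJetDir f j η d) (hg : HasJetDir g j η e) :
    HasJetDir (fun i => f i + g i) j η (d + e) := HasDerivAt.add hf hg

lemma sub (hf : HasJetDir f j η d) (hg : HasJetDir g j η e) :
    HasJetDir (fun i => f i - g i) j η (d - e) := HasDerivAt.sub hf hg

lemma mul (hf : HasJetDir f j η d) (hg : HasJetDir g j η e) :
    HasJetDir (fun i => f i * g i) j η (d * g j + f j * e) := by
  simpa [HasJetDir] using HasDerivAt.fun_mul hf hg

lemma div (hf : HasJetDir f j η d) (hg : HasJetDir g j η e) (h0 : g j ≠ 0) :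
    HasJetDir (fun i => f i / g i) j η ((d * g j - f j * e) / g j ^ 2) := by
  simpa [HasJetDir] using HasDerivAt.fun_div hf hg (by simpa using h0)

lemma const_mul (a : ℝ) (hf : HasJetDir f j η d) : HasJetDir (fun i => a * f i) j η (a * d) :=
  HasDerivAt.const_mul a hf

lemma pow_two (hf : HasJetDir f j η d) : HasJetDir (fun i => f i ^ 2) j η (2 * f j * d) := by
  simpa [HasJetDir] using HasDerivAt.fun_pow hf 2

end HasJetDir

lemma JetSmooth.hasJetDir_Dx {Ω : Set Jet} (hΩ : IsOpen Ω) {f : Jet → ℝ} (hf : JetSmooth Ω f)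
    {j : Jet} (hj : j ∈ Ω) : HasJetDir f j (jetShift j) (DihedralFlow.Dx f j) := by
  rw [Dx_eq hΩ hf hj]; exact hf.hasDerivAt hΩ hj _

lemma JetSmooth.hasJetDir_evol {Ω : Set Jet} (hΩ : IsOpen Ω) {f : Jet → ℝ} (hf : JetSmooth Ω f)
    {j : Jet} (hj : j ∈ Ω) (X : Jet → ℝ × ℝ) :
    HasJetDir f j (prolong X j) (DihedralFlow.evol X f j) := by
  rw [evol_eq hΩ hf hj]; exact hf.hasDerivAt hΩ hj _

namespace AdmissibleDomain

variable (hU : AdmissibleDomain m U)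
include hU

lemma jetOpen : IsOpen (jetDomain U) := isOpen_jetDomain hU.isOpen

lemma contDiffOn_riemann₁ : ContDiffOn ℝ ∞ (riemann₁ c m) U := hU.contDiffOn_riemann (c + 2)
lemma contDiffOn_riemann₂ : ContDiffOn ℝ ∞ (riemann₂ c m) U := hU.contDiffOn_riemann (c - 2)

lemma jetSmooth_base {h : ℝ × ℝ → ℝ} (hh : ContDiffOn ℝ ∞ h U) :
    JetSmooth (jetDomain U) fun j => h (j 0) := DihedralFlow.jetSmooth_base hU.isOpen subset_rfl hh

lemma jetSmooth_R₁ : JetSmooth (jetDomain U) (jetR₁ c m) :=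
  (hU.jetSmooth_base hU.contDiffOn_riemann₁).Dx hU.jetOpen
lemma jetSmooth_R₂ : JetSmooth (jetDomain U) (jetR₂ c m) :=
  (hU.jetSmooth_base hU.contDiffOn_riemann₂).Dx hU.jetOpen
lemma jetSmooth_S₁ : JetSmooth (jetDomain U) (jetS₁ c m) := hU.jetSmooth_R₁.Dx hU.jetOpen
lemma jetSmooth_S₂ : JetSmooth (jetDomain U) (jetS₂ c m) := hU.jetSmooth_R₂.Dx hU.jetOpen

lemma jetR₁_eq {j : Jet} (hj : j ∈ jetDomain U) :
    jetR₁ c m j = (j 1).2 - sig c / kap m (j 0) * (j 1).1 := by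
  rw [jetR₁, Dx_base hU.isOpen hU.contDiffOn_riemann₁ hj, hU.fderiv_riemann₁ hj]

lemma jetR₂_eq {j : Jet} (hj : j ∈ jetDomain U) :
    jetR₂ c m j = (j 1).2 + tau c / kap m (j 0) * (j 1).1 := by
  rw [jetR₂, Dx_base hU.isOpen hU.contDiffOn_riemann₂ hj, hU.fderiv_riemann₂ hj]

lemma jet_one {j : Jet} (hj : j ∈ jetDomain U) :
    j 1 = (kap m (j 0) * (jetR₂ c m j - jetR₁ c m j), tau c * jetR₁ c m j
      + sig c * jetR₂ c m j) := by
  have hk := (hU.kap_pos hj).ne'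
  rw [hU.jetR₁_eq hj, hU.jetR₂_eq hj]
  refine Prod.ext ?_ ?_
  · simp only [sig, tau]; field_simp; ring
  · simp only [sig, tau]; ring

omit hU in
lemma along_frame_decomp {h : ℝ × ℝ → ℝ} {w : ℝ × ℝ} (x y : ℝ) :
    fderiv ℝ h w (kap m w * (y - x), tau c * x + sig c * y)
      = along (frame₁ c m) h w * x + along (frame₂ c m) h w * y := by
  have : (kap m w * (y - x), tau c * x + sig c * y) = x • frame₁ c m w + y • frame₂ c m w := by
    simp only [frame₁, frame₂, Prod.smul_mk, smul_eq_mul, Prod.mk_add_mk]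
    refine Prod.ext ?_ ?_ <;> ring
  rw [this, map_add, map_smul, map_smul, along, along, smul_eq_mul, smul_eq_mul]
  ring

lemma Dx_base {h : ℝ × ℝ → ℝ} (hh : ContDiffOn ℝ ∞ h U) {j : Jet} (hj : j ∈ jetDomain U) :
    Dx (fun i => h (i 0)) j = along (frame₁ c m) h (j 0) * jetR₁ c m j
      + along (frame₂ c m) h (j 0) * jetR₂ c m j := by
  rw [DihedralFlow.Dx_base hU.isOpen hh hj, hU.jet_one (c := c) hj, along_frame_decomp]

end AdmissibleDomain

namespace SymPair

variable {β : ℝ × ℝ → ℝ × ℝ} {p q : ℝ × ℝ → ℝ} (hS : SymPair c m U β p q)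
  (hU : AdmissibleDomain m U)
include hS hU

lemma law_eq {j : Jet} (hj : j ∈ jetDomain U) : conservationLaw β j =
    (kap m (j 0) * (mu₂ c m p q (j 0) * jetR₂ c m j - mu₁ c m p q (j 0) * jetR₁ c m j),
      tau c * (mu₁ c m p q (j 0) * jetR₁ c m j) + sig c * (mu₂ c m p q (j 0) * jetR₂ c m j)) := by
  have hk := (hU.kap_pos hj).ne'
  rw [conservationLaw, DihedralFlow.Dx_base hU.isOpen hS.smooth hj, hS.jacobian _ hj,
    hU.jet_one (c := c) hj]
  simp only [mu₁, mu₂, lam₁, lam₂, sig, tau]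
  refine Prod.ext ?_ ?_
  · simp only; field_simp; ring
  · simp only; field_simp; ring

lemma jetSmooth_law : JetSmooth (jetDomain U) (conservationLaw β) :=
  jetSmooth_conservationLaw hU.jetOpen hU.isOpen subset_rfl hS.smooth

lemma evol_base {h : ℝ × ℝ → ℝ} (hh : ContDiffOn ℝ ∞ h U) {j : Jet} (hj : j ∈ jetDomain U) :
    evol (conservationLaw β) (fun i => h (i 0)) j =
      along (frame₁ c m) h (j 0) * (mu₁ c m p q (j 0) * jetR₁ c m j)
      + along (frame₂ c m) h (j 0) * (mu₂ c m p q (j 0) * jetR₂ c m j) := by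
  rw [DihedralFlow.evol_base hU.isOpen hh _ hj, hS.law_eq hU hj,
    AdmissibleDomain.along_frame_decomp]

lemma evol_riemann₁ {j : Jet} (hj : j ∈ jetDomain U) :
    evol (conservationLaw β) (fun i => riemann₁ c m (i 0)) j = mu₁ c m p q (j 0) * jetR₁ c m j := by
  have hk := (hU.kap_pos hj).ne'
  rw [DihedralFlow.evol_base hU.isOpen hU.contDiffOn_riemann₁ _ hj, hU.fderiv_riemann₁ hj,
    hS.law_eq hU hj]
  simp only [sig, tau]; field_simp; ring

lemma evol_riemann₂ {j : Jet} (hj : j ∈ jetDomain U) :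
    evol (conservationLaw β) (fun i => riemann₂ c m (i 0)) j = mu₂ c m p q (j 0) * jetR₂ c m j := by
  have hk := (hU.kap_pos hj).ne'
  rw [DihedralFlow.evol_base hU.isOpen hU.contDiffOn_riemann₂ _ hj, hU.fderiv_riemann₂ hj,
    hS.law_eq hU hj]
  simp only [sig, tau]; field_simp; ring

end SymPair

/-- Total derivatives of a velocity, as expressions in the jet variables. -/
noncomputable def velX (c m : ℝ) (μ : ℝ × ℝ → ℝ) (j : Jet) : ℝ :=
  along (frame₁ c m) μ (j 0) * jetR₁ c m j + along (frame₂ c m) μ (j 0) * jetR₂ c m j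

noncomputable def velXX (c m : ℝ) (μ : ℝ × ℝ → ℝ) (j : Jet) : ℝ :=
  (along (frame₁ c m) (along (frame₁ c m) μ) (j 0) * jetR₁ c m j
      + along (frame₂ c m) (along (frame₁ c m) μ) (j 0) * jetR₂ c m j) * jetR₁ c m j
    + along (frame₁ c m) μ (j 0) * jetS₁ c m j
    + ((along (frame₁ c m) (along (frame₂ c m) μ) (j 0) * jetR₁ c m j
      + along (frame₂ c m) (along (frame₂ c m) μ) (j 0) * jetR₂ c m j) * jetR₂ c m j
    + along (frame₂ c m) μ (j 0) * jetS₂ c m j)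

section Prolongation

variable {X : Jet → ℝ × ℝ} {μ : ℝ × ℝ → ℝ} {r : ℝ × ℝ → ℝ}

/-- The evolution of the first and second derivative of a Riemann invariant. -/
lemma evol_jetR (hU : AdmissibleDomain m U) (hX : JetSmooth (jetDomain U) X)
    (hμ : ContDiffOn ℝ ∞ μ U) (hr : ContDiffOn ℝ ∞ r U)
    (h : ∀ j ∈ jetDomain U, evol X (fun i => r (i 0)) j = μ (j 0) * Dx (fun i => r (i 0)) j)
    {j : Jet} (hj : j ∈ jetDomain U) :
    evol X (Dx fun i => r (i 0)) j =
      velX c m μ j * Dx (fun i => r (i 0)) j + μ (j 0) * Dx (Dx fun i => r (i 0)) j := by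
  have hΩ := hU.jetOpen
  have hR := (hU.jetSmooth_base hr).Dx hΩ
  have hm := hU.jetSmooth_base hμ
  rw [evol_Dx hΩ (hU.jetSmooth_base hr) hX hj,
    Dx_eqOn hΩ ((hU.jetSmooth_base hr).evol hΩ hX) h hj, Dx_eq hΩ (hm.mul hR) hj,
    ((hm.hasJetDir_Dx hΩ hj).mul (hR.hasJetDir_Dx hΩ hj)).eq, hU.Dx_base (c := c) hμ hj]
  rfl

lemma Dx_velX (hU : AdmissibleDomain m U) (hμ : ContDiffOn ℝ ∞ μ U) {j : Jet}
    (hj : j ∈ jetDomain U) : Dx (velX c m μ) j = velXX c m μ j := by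
  have hΩ := hU.jetOpen
  have h1 := hU.jetSmooth_base (contDiffOn_along hU.isOpen (hU.contDiffOn_frame₁ (c := c)) hμ)
  have h2 := hU.jetSmooth_base (contDiffOn_along hU.isOpen (hU.contDiffOn_frame₂ (c := c)) hμ)
  have hs := (h1.mul (hU.jetSmooth_R₁ (c := c))).add (h2.mul (hU.jetSmooth_R₂ (c := c)))
  refine (Dx_eq hΩ hs hj).trans ?_
  rw [(((h1.hasJetDir_Dx hΩ hj).mul (hU.jetSmooth_R₁.hasJetDir_Dx hΩ hj)).add
    ((h2.hasJetDir_Dx hΩ hj).mul (hU.jetSmooth_R₂.hasJetDir_Dx hΩ hj))).eq,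
    hU.Dx_base (c := c) (contDiffOn_along hU.isOpen hU.contDiffOn_frame₁ hμ) hj,
    hU.Dx_base (c := c) (contDiffOn_along hU.isOpen hU.contDiffOn_frame₂ hμ) hj]
  rfl

lemma jetSmooth_velX (hU : AdmissibleDomain m U) (hμ : ContDiffOn ℝ ∞ μ U) :
    JetSmooth (jetDomain U) (velX c m μ) :=
  ((hU.jetSmooth_base (contDiffOn_along hU.isOpen hU.contDiffOn_frame₁ hμ)).mul
    hU.jetSmooth_R₁).add ((hU.jetSmooth_base
      (contDiffOn_along hU.isOpen hU.contDiffOn_frame₂ hμ)).mul hU.jetSmooth_R₂)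

lemma evol_jetS (hU : AdmissibleDomain m U) (hX : JetSmooth (jetDomain U) X)
    (hμ : ContDiffOn ℝ ∞ μ U) (hr : ContDiffOn ℝ ∞ r U)
    (h : ∀ j ∈ jetDomain U, evol X (fun i => r (i 0)) j = μ (j 0) * Dx (fun i => r (i 0)) j)
    {j : Jet} (hj : j ∈ jetDomain U) :
    evol X (Dx (Dx fun i => r (i 0))) j =
      velXX c m μ j * Dx (fun i => r (i 0)) j + 2 * velX c m μ j * Dx (Dx fun i => r (i 0)) j
        + μ (j 0) * Dx (Dx (Dx fun i => r (i 0))) j := by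
  have hΩ := hU.jetOpen
  have hR := (hU.jetSmooth_base hr).Dx hΩ
  have hS := hR.Dx hΩ
  have hm := hU.jetSmooth_base hμ
  have hv := jetSmooth_velX (c := c) hU hμ
  rw [evol_Dx hΩ hR hX hj, Dx_eqOn hΩ (hR.evol hΩ hX) (fun i hi => evol_jetR hU hX hμ hr h hi) hj,
    Dx_eq hΩ ((hv.mul hR).add (hm.mul hS)) hj,
    (((hv.hasJetDir_Dx hΩ hj).mul (hR.hasJetDir_Dx hΩ hj)).add
      ((hm.hasJetDir_Dx hΩ hj).mul (hS.hasJetDir_Dx hΩ hj))).eq, Dx_velX hU hμ hj,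
    hU.Dx_base (c := c) hμ hj, velX]
  ring

end Prolongation

namespace SymPair

variable {β : ℝ × ℝ → ℝ × ℝ} {p q : ℝ × ℝ → ℝ} (hS : SymPair c m U β p q)
  (hU : AdmissibleDomain m U)
include hS hU

lemma evol_R₁ {j : Jet} (hj : j ∈ jetDomain U) : evol (conservationLaw β) (jetR₁ c m) j =
    velX c m (mu₁ c m p q) j * jetR₁ c m j + mu₁ c m p q (j 0) * jetS₁ c m j :=
  evol_jetR hU (hS.jetSmooth_law hU) (hS.contDiffOn_mu₁ hU) hU.contDiffOn_riemann₁
    (fun _ hi => hS.evol_riemann₁ hU hi) hj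

lemma evol_R₂ {j : Jet} (hj : j ∈ jetDomain U) : evol (conservationLaw β) (jetR₂ c m) j =
    velX c m (mu₂ c m p q) j * jetR₂ c m j + mu₂ c m p q (j 0) * jetS₂ c m j :=
  evol_jetR hU (hS.jetSmooth_law hU) (hS.contDiffOn_mu₂ hU) hU.contDiffOn_riemann₂
    (fun _ hi => hS.evol_riemann₂ hU hi) hj

lemma evol_S₁ {j : Jet} (hj : j ∈ jetDomain U) : evol (conservationLaw β) (jetS₁ c m) j =
    velXX c m (mu₁ c m p q) j * jetR₁ c m j + 2 * velX c m (mu₁ c m p q) j * jetS₁ c m j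
      + mu₁ c m p q (j 0) * jetT₁ c m j :=
  evol_jetS hU (hS.jetSmooth_law hU) (hS.contDiffOn_mu₁ hU) hU.contDiffOn_riemann₁
    (fun _ hi => hS.evol_riemann₁ hU hi) hj

lemma evol_S₂ {j : Jet} (hj : j ∈ jetDomain U) : evol (conservationLaw β) (jetS₂ c m) j =
    velXX c m (mu₂ c m p q) j * jetR₂ c m j + 2 * velX c m (mu₂ c m p q) j * jetS₂ c m j
      + mu₂ c m p q (j 0) * jetT₂ c m j :=
  evol_jetS hU (hS.jetSmooth_law hU) (hS.contDiffOn_mu₂ hU) hU.contDiffOn_riemann₂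
    (fun _ hi => hS.evol_riemann₂ hU hi) hj

end SymPair

/-- The components of `fluxOp` in the frame. -/
noncomputable def fluxOp₁ (c m : ℝ) (β : ℝ × ℝ → ℝ × ℝ) (p q : ℝ × ℝ → ℝ) (k₁ k₂ : Jet → ℝ)
    (j : Jet) : ℝ :=
  evol (conservationLaw β) k₁ j - mu₁ c m p q (j 0) * Dx k₁ j
    + sig c * rho m (j 0) * q (j 0) * (k₁ j - k₂ j) * jetR₂ c m j

noncomputable def fluxOp₂ (c m : ℝ) (β : ℝ × ℝ → ℝ × ℝ) (p q : ℝ × ℝ → ℝ) (k₁ k₂ : Jet → ℝ)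
    (j : Jet) : ℝ :=
  evol (conservationLaw β) k₂ j - mu₂ c m p q (j 0) * Dx k₂ j
    + tau c * rho m (j 0) * q (j 0) * (k₂ j - k₁ j) * jetR₁ c m j

lemma jetSmooth_frameVec (hU : AdmissibleDomain m U) {Ω : Set Jet} (hΩU : Ω ⊆ jetDomain U)
    {k₁ k₂ : Jet → ℝ} (h₁ : JetSmooth Ω k₁) (h₂ : JetSmooth Ω k₂) :
    JetSmooth Ω (frameVec c m k₁ k₂) :=
  (((hU.jetSmooth_base hU.contDiffOn_kap).mono hΩU).mul (h₂.sub h₁)).prodMk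
    (((jetSmooth_const Ω (tau c)).mul h₁).add ((jetSmooth_const Ω (sig c)).mul h₂))

namespace SymPair

variable {β : ℝ × ℝ → ℝ × ℝ} {p q : ℝ × ℝ → ℝ} (hS : SymPair c m U β p q)
  (hU : AdmissibleDomain m U)
include hS hU

lemma jetSmooth_fluxOp₁ {Ω : Set Jet} (hΩ : IsOpen Ω) (hΩU : Ω ⊆ jetDomain U)
    {k₁ k₂ : Jet → ℝ} (h₁ : JetSmooth Ω k₁) (h₂ : JetSmooth Ω k₂) :
    JetSmooth Ω (fluxOp₁ c m β p q k₁ k₂) :=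
  ((h₁.evol hΩ ((hS.jetSmooth_law hU).mono hΩU)).sub
    (((hU.jetSmooth_base (hS.contDiffOn_mu₁ hU)).mono hΩU).mul (h₁.Dx hΩ))).add
    (((((jetSmooth_const Ω (sig c)).mul ((hU.jetSmooth_base hU.contDiffOn_rho).mono hΩU)).mul
      ((hU.jetSmooth_base hS.smooth_q).mono hΩU)).mul (h₁.sub h₂)).mul (hU.jetSmooth_R₂.mono hΩU))

lemma jetSmooth_fluxOp₂ {Ω : Set Jet} (hΩ : IsOpen Ω) (hΩU : Ω ⊆ jetDomain U)
    {k₁ k₂ : Jet → ℝ} (h₁ : JetSmooth Ω k₁) (h₂ : JetSmooth Ω k₂) :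
    JetSmooth Ω (fluxOp₂ c m β p q k₁ k₂) :=
  ((h₂.evol hΩ ((hS.jetSmooth_law hU).mono hΩU)).sub
    (((hU.jetSmooth_base (hS.contDiffOn_mu₂ hU)).mono hΩU).mul (h₂.Dx hΩ))).add
    (((((jetSmooth_const Ω (tau c)).mul ((hU.jetSmooth_base hU.contDiffOn_rho).mono hΩU)).mul
      ((hU.jetSmooth_base hS.smooth_q).mono hΩU)).mul (h₂.sub h₁)).mul (hU.jetSmooth_R₁.mono hΩU))

/-- In the frame the Jacobian matrix of `β` is diagonal with entries `μ₁`, `μ₂`. The coupling of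
`k₁` and `k₂` comes only from the variation of the frame, that is from the derivatives of `kap`,
whence the factor `rho`. -/
lemma fluxOp_frameVec {Ω : Set Jet} (hΩ : IsOpen Ω) (hΩU : Ω ⊆ jetDomain U)
    {k₁ k₂ : Jet → ℝ} (h₁ : JetSmooth Ω k₁) (h₂ : JetSmooth Ω k₂) {j : Jet} (hj : j ∈ Ω) :
    fluxOp β (frameVec c m k₁ k₂) j =
      frameVec c m (fluxOp₁ c m β p q k₁ k₂) (fluxOp₂ c m β p q k₁ k₂) j := by
  have hjU := hΩU hj
  have hk := (hU.kap_pos hjU).ne'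
  have hK : JetSmooth Ω fun j => kap m (j 0) := (hU.jetSmooth_base hU.contDiffOn_kap).mono hΩU
  have hv := jetSmooth_frameVec (c := c) hU hΩU h₁ h₂
  have key : ∀ {η : Jet} {dK d₁ d₂ : ℝ}, HasJetDir (fun j => kap m (j 0)) j η dK →
      HasJetDir k₁ j η d₁ → HasJetDir k₂ j η d₂ → jetDir (frameVec c m k₁ k₂) j η =
        (dK * (k₂ j - k₁ j) + kap m (j 0) * (d₂ - d₁), tau c * d₁ + sig c * d₂) := by
    intro η dK d₁ d₂ hdK hd₁ hd₂
    exact (HasDerivAt.prodMk (hdK.mul (hd₂.sub hd₁))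
      ((hd₁.const_mul (tau c)).add (hd₂.const_mul (sig c)))).deriv
  have hx : Dx (fun j => kap m (j 0)) j = rho m (j 0) * kap m (j 0) ^ 2 *
      (jetR₂ c m j - jetR₁ c m j) := by
    rw [hU.Dx_base (c := c) hU.contDiffOn_kap hjU, hU.along_kap hjU, hU.along_kap hjU]
    simp only [frame₁, frame₂]; ring
  have ht : evol (conservationLaw β) (fun j => kap m (j 0)) j = rho m (j 0) * kap m (j 0) ^ 2 *
      (mu₂ c m p q (j 0) * jetR₂ c m j - mu₁ c m p q (j 0) * jetR₁ c m j) := by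
    rw [hS.evol_base hU hU.contDiffOn_kap hjU, hU.along_kap hjU, hU.along_kap hjU]
    simp only [frame₁, frame₂]; ring
  rw [fluxOp, evol_eq hΩ hv hj, Dx_eq hΩ hv hj,
    key (hK.hasJetDir_evol hΩ hj _) (h₁.hasJetDir_evol hΩ hj _) (h₂.hasJetDir_evol hΩ hj _),
    key (hK.hasJetDir_Dx hΩ hj) (h₁.hasJetDir_Dx hΩ hj) (h₂.hasJetDir_Dx hΩ hj), hx, ht,
    hS.jacobian _ hjU]
  simp only [frameVec, fluxOp₁, fluxOp₂, mu₁, mu₂, lam₁, lam₂, sig, tau]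
  refine Prod.ext ?_ ?_
  · simp only [Prod.fst_sub]; field_simp; ring
  · simp only [Prod.snd_sub]; field_simp; ring

omit hS hU in
lemma hasJetDir_fluxOp₁ {k₁ k₂ : Jet → ℝ} {j η : Jet} {e dμ ex dr dq d₁ d₂ dR : ℝ}
    (he : HasJetDir (evol (conservationLaw β) k₁) j η e)
    (hμ : HasJetDir (fun i => mu₁ c m p q (i 0)) j η dμ) (hx : HasJetDir (Dx k₁) j η ex)
    (hr : HasJetDir (fun i => rho m (i 0)) j η dr) (hq : HasJetDir (fun i => q (i 0)) j η dq)
    (h₁ : HasJetDir k₁ j η d₁) (h₂ : HasJetDir k₂ j η d₂) (hR : HasJetDir (jetR₂ c m) j η dR) :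
    HasJetDir (fluxOp₁ c m β p q k₁ k₂) j η (e - (dμ * Dx k₁ j + mu₁ c m p q (j 0) * ex) +
      (((sig c * dr * q (j 0) + sig c * rho m (j 0) * dq) * (k₁ j - k₂ j)
        + sig c * rho m (j 0) * q (j 0) * (d₁ - d₂)) * jetR₂ c m j
        + sig c * rho m (j 0) * q (j 0) * (k₁ j - k₂ j) * dR)) :=
  (he.sub (hμ.mul hx)).add (((((hr.const_mul (sig c)).mul hq).mul (h₁.sub h₂))).mul hR)

omit hS hU in
lemma hasJetDir_fluxOp₂ {k₁ k₂ : Jet → ℝ} {j η : Jet} {e dμ ex dr dq d₁ d₂ dR : ℝ}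
    (he : HasJetDir (evol (conservationLaw β) k₂) j η e)
    (hμ : HasJetDir (fun i => mu₂ c m p q (i 0)) j η dμ) (hx : HasJetDir (Dx k₂) j η ex)
    (hr : HasJetDir (fun i => rho m (i 0)) j η dr) (hq : HasJetDir (fun i => q (i 0)) j η dq)
    (h₁ : HasJetDir k₁ j η d₁) (h₂ : HasJetDir k₂ j η d₂) (hR : HasJetDir (jetR₁ c m) j η dR) :
    HasJetDir (fluxOp₂ c m β p q k₁ k₂) j η (e - (dμ * Dx k₂ j + mu₂ c m p q (j 0) * ex) +
      (((tau c * dr * q (j 0) + tau c * rho m (j 0) * dq) * (k₂ j - k₁ j)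
        + tau c * rho m (j 0) * q (j 0) * (d₂ - d₁)) * jetR₁ c m j
        + tau c * rho m (j 0) * q (j 0) * (k₂ j - k₁ j) * dR)) :=
  (he.sub (hμ.mul hx)).add (((((hr.const_mul (tau c)).mul hq).mul (h₂.sub h₁))).mul hR)

/-- The composition of two of the operators, first component. -/
lemma fluxOp₁_comp {β' : ℝ × ℝ → ℝ × ℝ} {p' q' : ℝ × ℝ → ℝ} (hS' : SymPair c m U β' p' q')
    {Ω : Set Jet} (hΩ : IsOpen Ω) (hΩU : Ω ⊆ jetDomain U)
    {k₁ k₂ : Jet → ℝ} (h₁ : JetSmooth Ω k₁) (h₂ : JetSmooth Ω k₂) {j : Jet} (hj : j ∈ Ω) :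
    fluxOp₁ c m β p q (fluxOp₁ c m β' p' q' k₁ k₂) (fluxOp₂ c m β' p' q' k₁ k₂) j -
      fluxOp₁ c m β' p' q' (fluxOp₁ c m β p q k₁ k₂) (fluxOp₂ c m β p q k₁ k₂) j =
    evol (conservationLaw β) (evol (conservationLaw β') k₁) j
      - evol (conservationLaw β') (evol (conservationLaw β) k₁) j := by
  -- One composition is expanded in full for arbitrary symmetries; it is then used in both orders
  -- and subtracted.
  have key : ∀ {β β' : ℝ × ℝ → ℝ × ℝ} {p q p' q' : ℝ × ℝ → ℝ}, SymPair c m U β p q →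
      SymPair c m U β' p' q' → fluxOp₁ c m β p q (fluxOp₁ c m β' p' q' k₁ k₂)
        (fluxOp₂ c m β' p' q' k₁ k₂) j =
        (evol (conservationLaw β) (evol (conservationLaw β') k₁) j
          - ((along (frame₁ c m) (mu₁ c m p' q') (j 0) * (mu₁ c m p q (j 0) * jetR₁ c m j)
          + along (frame₂ c m) (mu₁ c m p' q') (j 0) * (mu₂ c m p q (j 0) * jetR₂ c m j)) * Dx k₁ j
          + mu₁ c m p' q' (j 0) * Dx (evol (conservationLaw β) k₁) j)
        + (((sig c * (along (frame₁ c m) (rho m) (j 0) * (mu₁ c m p q (j 0) * jetR₁ c m j)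
          + along (frame₂ c m) (rho m) (j 0) * (mu₂ c m p q (j 0) * jetR₂ c m j)) * q' (j 0)
          + sig c * rho m (j 0) * (along (frame₁ c m) q' (j 0) * (mu₁ c m p q (j 0) * jetR₁ c m j)
          + along (frame₂ c m) q' (j 0) * (mu₂ c m p q (j 0) * jetR₂ c m j))) * (k₁ j - k₂ j)
          + sig c * rho m (j 0) * q' (j 0) * (evol (conservationLaw β) k₁ j
            - evol (conservationLaw β) k₂ j))
            * jetR₂ c m j
          + sig c * rho m (j 0) * q' (j 0) * (k₁ j - k₂ j)
            * (velX c m (mu₂ c m p q) j * jetR₂ c m j + mu₂ c m p q (j 0) * jetS₂ c m j)))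
        - mu₁ c m p q (j 0) * (Dx (evol (conservationLaw β') k₁) j
          - ((along (frame₁ c m) (mu₁ c m p' q') (j 0) * jetR₁ c m j
          + along (frame₂ c m) (mu₁ c m p' q') (j 0) * jetR₂ c m j) * Dx k₁ j
          + mu₁ c m p' q' (j 0) * Dx (Dx k₁) j)
        + (((sig c * (along (frame₁ c m) (rho m) (j 0) * jetR₁ c m j
          + along (frame₂ c m) (rho m) (j 0) * jetR₂ c m j) * q' (j 0)
          + sig c * rho m (j 0) * (along (frame₁ c m) q' (j 0) * jetR₁ c m j
            + along (frame₂ c m) q' (j 0) * jetR₂ c m j)) * (k₁ j - k₂ j)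
          + sig c * rho m (j 0) * q' (j 0) * (Dx k₁ j - Dx k₂ j)) * jetR₂ c m j
          + sig c * rho m (j 0) * q' (j 0) * (k₁ j - k₂ j) * jetS₂ c m j))
        + sig c * rho m (j 0) * q (j 0) * (fluxOp₁ c m β' p' q' k₁ k₂ j
          - fluxOp₂ c m β' p' q' k₁ k₂ j) * jetR₂ c m j := by
    intro β β' p q p' q' hS hS'
    have hjU := hΩU hj
    have hX : JetSmooth Ω (conservationLaw β) := (hS.jetSmooth_law hU).mono hΩU
    have hX' : JetSmooth Ω (conservationLaw β') := (hS'.jetSmooth_law hU).mono hΩU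
    have hf := hS'.jetSmooth_fluxOp₁ hU hΩ hΩU h₁ h₂
    have hμ := hU.jetSmooth_base (hS'.contDiffOn_mu₁ hU)
    have hr := hU.jetSmooth_base hU.contDiffOn_rho
    have hq := hU.jetSmooth_base hS'.smooth_q
    have hR := hU.jetSmooth_R₂ (c := c)
    have e1 := evol_eq hΩ hf hj (conservationLaw β)
    rw [(hasJetDir_fluxOp₁ ((h₁.evol hΩ hX').hasJetDir_evol hΩ hj _)
      (hμ.hasJetDir_evol hU.jetOpen hjU _) ((h₁.Dx hΩ).hasJetDir_evol hΩ hj _)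
      (hr.hasJetDir_evol hU.jetOpen hjU _) (hq.hasJetDir_evol hU.jetOpen hjU _)
      (h₁.hasJetDir_evol hΩ hj _) (h₂.hasJetDir_evol hΩ hj _)
      (hR.hasJetDir_evol hU.jetOpen hjU _)).eq, hS.evol_base hU (hS'.contDiffOn_mu₁ hU) hjU,
      hS.evol_base hU hU.contDiffOn_rho hjU, hS.evol_base hU hS'.smooth_q hjU,
      hS.evol_R₂ hU hjU, evol_Dx hΩ h₁ hX hj] at e1
    have e2 := Dx_eq hΩ hf hj
    rw [(hasJetDir_fluxOp₁ ((h₁.evol hΩ hX').hasJetDir_Dx hΩ hj)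
      (hμ.hasJetDir_Dx hU.jetOpen hjU) ((h₁.Dx hΩ).hasJetDir_Dx hΩ hj)
      (hr.hasJetDir_Dx hU.jetOpen hjU) (hq.hasJetDir_Dx hU.jetOpen hjU)
      (h₁.hasJetDir_Dx hΩ hj) (h₂.hasJetDir_Dx hΩ hj)
      (hR.hasJetDir_Dx hU.jetOpen hjU)).eq, hU.Dx_base (c := c) (hS'.contDiffOn_mu₁ hU) hjU,
      hU.Dx_base (c := c) hU.contDiffOn_rho hjU, hU.Dx_base (c := c) hS'.smooth_q hjU] at e2
    rw [fluxOp₁, e1, e2]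
    rfl
  have hjU := hΩU hj
  rw [key hS hS', key hS' hS]
  simp only [fluxOp₁, fluxOp₂, velX]
  -- With the cross derivatives of the velocities expressed through `q`, and `∂₂μ₂` through `∂₂q`,
  -- everything except the double time derivatives is symmetric in the two symmetries.
  rw [hS'.d2_mu₁ hU hjU, hS.d2_mu₁ hU hjU, hS.d1_mu₂ hU hjU, hS'.d1_mu₂ hU hjU,
    hS.d2_mu₂ hU hjU, hS'.d2_mu₂ hU hjU, mu₂_sub_mu₁ p q, mu₂_sub_mu₁ p' q']
  ring

lemma fluxOp₂_comp {β' : ℝ × ℝ → ℝ × ℝ} {p' q' : ℝ × ℝ → ℝ} (hS' : SymPair c m U β' p' q')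
    {Ω : Set Jet} (hΩ : IsOpen Ω) (hΩU : Ω ⊆ jetDomain U)
    {k₁ k₂ : Jet → ℝ} (h₁ : JetSmooth Ω k₁) (h₂ : JetSmooth Ω k₂) {j : Jet} (hj : j ∈ Ω) :
    fluxOp₂ c m β p q (fluxOp₁ c m β' p' q' k₁ k₂) (fluxOp₂ c m β' p' q' k₁ k₂) j -
      fluxOp₂ c m β' p' q' (fluxOp₁ c m β p q k₁ k₂) (fluxOp₂ c m β p q k₁ k₂) j =
    evol (conservationLaw β) (evol (conservationLaw β') k₂) j
      - evol (conservationLaw β') (evol (conservationLaw β) k₂) j := by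
  have key : ∀ {β β' : ℝ × ℝ → ℝ × ℝ} {p q p' q' : ℝ × ℝ → ℝ}, SymPair c m U β p q →
      SymPair c m U β' p' q' → fluxOp₂ c m β p q (fluxOp₁ c m β' p' q' k₁ k₂)
        (fluxOp₂ c m β' p' q' k₁ k₂) j =
        (evol (conservationLaw β) (evol (conservationLaw β') k₂) j
          - ((along (frame₁ c m) (mu₂ c m p' q') (j 0) * (mu₁ c m p q (j 0) * jetR₁ c m j)
          + along (frame₂ c m) (mu₂ c m p' q') (j 0) * (mu₂ c m p q (j 0) * jetR₂ c m j)) * Dx k₂ j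
          + mu₂ c m p' q' (j 0) * Dx (evol (conservationLaw β) k₂) j)
        + (((tau c * (along (frame₁ c m) (rho m) (j 0) * (mu₁ c m p q (j 0) * jetR₁ c m j)
          + along (frame₂ c m) (rho m) (j 0) * (mu₂ c m p q (j 0) * jetR₂ c m j)) * q' (j 0)
          + tau c * rho m (j 0) * (along (frame₁ c m) q' (j 0) * (mu₁ c m p q (j 0) * jetR₁ c m j)
          + along (frame₂ c m) q' (j 0) * (mu₂ c m p q (j 0) * jetR₂ c m j))) * (k₂ j - k₁ j)
          + tau c * rho m (j 0) * q' (j 0) * (evol (conservationLaw β) k₂ j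
            - evol (conservationLaw β) k₁ j))
            * jetR₁ c m j
          + tau c * rho m (j 0) * q' (j 0) * (k₂ j - k₁ j)
            * (velX c m (mu₁ c m p q) j * jetR₁ c m j + mu₁ c m p q (j 0) * jetS₁ c m j)))
        - mu₂ c m p q (j 0) * (Dx (evol (conservationLaw β') k₂) j
          - ((along (frame₁ c m) (mu₂ c m p' q') (j 0) * jetR₁ c m j
          + along (frame₂ c m) (mu₂ c m p' q') (j 0) * jetR₂ c m j) * Dx k₂ j
          + mu₂ c m p' q' (j 0) * Dx (Dx k₂) j)
        + (((tau c * (along (frame₁ c m) (rho m) (j 0) * jetR₁ c m j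
          + along (frame₂ c m) (rho m) (j 0) * jetR₂ c m j) * q' (j 0)
          + tau c * rho m (j 0) * (along (frame₁ c m) q' (j 0) * jetR₁ c m j
            + along (frame₂ c m) q' (j 0) * jetR₂ c m j)) * (k₂ j - k₁ j)
          + tau c * rho m (j 0) * q' (j 0) * (Dx k₂ j - Dx k₁ j)) * jetR₁ c m j
          + tau c * rho m (j 0) * q' (j 0) * (k₂ j - k₁ j) * jetS₁ c m j))
        + tau c * rho m (j 0) * q (j 0) * (fluxOp₂ c m β' p' q' k₁ k₂ j
          - fluxOp₁ c m β' p' q' k₁ k₂ j) * jetR₁ c m j := by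
    intro β β' p q p' q' hS hS'
    have hjU := hΩU hj
    have hX : JetSmooth Ω (conservationLaw β) := (hS.jetSmooth_law hU).mono hΩU
    have hX' : JetSmooth Ω (conservationLaw β') := (hS'.jetSmooth_law hU).mono hΩU
    have hf := hS'.jetSmooth_fluxOp₂ hU hΩ hΩU h₁ h₂
    have hμ := hU.jetSmooth_base (hS'.contDiffOn_mu₂ hU)
    have hr := hU.jetSmooth_base hU.contDiffOn_rho
    have hq := hU.jetSmooth_base hS'.smooth_q
    have hR := hU.jetSmooth_R₁ (c := c)
    have e1 := evol_eq hΩ hf hj (conservationLaw β)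
    rw [(hasJetDir_fluxOp₂ ((h₂.evol hΩ hX').hasJetDir_evol hΩ hj _)
      (hμ.hasJetDir_evol hU.jetOpen hjU _) ((h₂.Dx hΩ).hasJetDir_evol hΩ hj _)
      (hr.hasJetDir_evol hU.jetOpen hjU _) (hq.hasJetDir_evol hU.jetOpen hjU _)
      (h₁.hasJetDir_evol hΩ hj _) (h₂.hasJetDir_evol hΩ hj _)
      (hR.hasJetDir_evol hU.jetOpen hjU _)).eq, hS.evol_base hU (hS'.contDiffOn_mu₂ hU) hjU,
      hS.evol_base hU hU.contDiffOn_rho hjU, hS.evol_base hU hS'.smooth_q hjU,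
      hS.evol_R₁ hU hjU, evol_Dx hΩ h₂ hX hj] at e1
    have e2 := Dx_eq hΩ hf hj
    rw [(hasJetDir_fluxOp₂ ((h₂.evol hΩ hX').hasJetDir_Dx hΩ hj)
      (hμ.hasJetDir_Dx hU.jetOpen hjU) ((h₂.Dx hΩ).hasJetDir_Dx hΩ hj)
      (hr.hasJetDir_Dx hU.jetOpen hjU) (hq.hasJetDir_Dx hU.jetOpen hjU)
      (h₁.hasJetDir_Dx hΩ hj) (h₂.hasJetDir_Dx hΩ hj)
      (hR.hasJetDir_Dx hU.jetOpen hjU)).eq, hU.Dx_base (c := c) (hS'.contDiffOn_mu₂ hU) hjU,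
      hU.Dx_base (c := c) hU.contDiffOn_rho hjU, hU.Dx_base (c := c) hS'.smooth_q hjU] at e2
    rw [fluxOp₂, e1, e2]
    rfl
  have hjU := hΩU hj
  rw [key hS hS', key hS' hS]
  simp only [fluxOp₁, fluxOp₂, velX]
  rw [hS'.d2_mu₁ hU hjU, hS.d2_mu₁ hU hjU, hS.d1_mu₂ hU hjU, hS'.d1_mu₂ hU hjU,
    hS.d1_mu₁ hU hjU, hS'.d1_mu₁ hU hjU, mu₂_sub_mu₁ p q, mu₂_sub_mu₁ p' q']
  ring

omit hS in
lemma fluxOp_congr (hS : SymPair c m U β p q) {Ω : Set Jet} (hΩ : IsOpen Ω)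
    (hΩU : Ω ⊆ jetDomain U) {k k' : Jet → ℝ × ℝ} (hk : JetSmooth Ω k) (h : Set.EqOn k k' Ω)
    {j : Jet} (hj : j ∈ Ω) : fluxOp β k j = fluxOp β k' j := by
  rw [fluxOp, fluxOp, Dx_eqOn hΩ hk h hj,
    evol_congr hΩ hk ((hS.jetSmooth_law hU).mono hΩU) h (fun _ _ => rfl) hj]

/-- In each component the difference of the two compositions reduces to the commutator of the
evolutionary derivatives on `k₁` or `k₂`, zero by `evol_comm`. The open set `Ω` is kept general
because rational generators are smooth only at regular jets. -/
lemma fluxOp_comm {β' : ℝ × ℝ → ℝ × ℝ} {p' q' : ℝ × ℝ → ℝ} (hS' : SymPair c m U β' p' q')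
    (hcomm : ∀ i ∈ jetDomain U, commutator (conservationLaw β) (conservationLaw β') i = 0)
    {Ω : Set Jet} (hΩ : IsOpen Ω) (hΩU : Ω ⊆ jetDomain U)
    {k₁ k₂ : Jet → ℝ} (h₁ : JetSmooth Ω k₁) (h₂ : JetSmooth Ω k₂) {j : Jet} (hj : j ∈ Ω) :
    fluxOp β (fluxOp β' (frameVec c m k₁ k₂)) j = fluxOp β' (fluxOp β (frameVec c m k₁ k₂)) j := by
  have hv := jetSmooth_frameVec (c := c) hU hΩU h₁ h₂
  have hX : JetSmooth Ω (conservationLaw β) := (hS.jetSmooth_law hU).mono hΩU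
  have hX' : JetSmooth Ω (conservationLaw β') := (hS'.jetSmooth_law hU).mono hΩU
  have hc : ∀ i ∈ Ω, commutator (conservationLaw β) (conservationLaw β') i = 0 :=
    fun i hi => hcomm i (hΩU hi)
  rw [hS.fluxOp_congr hU hΩ hΩU (hv.fluxOp hΩ hU.isOpen hΩU hS'.smooth)
      (fun i hi => hS'.fluxOp_frameVec hU hΩ hΩU h₁ h₂ hi) hj,
    hS'.fluxOp_congr hU hΩ hΩU (hv.fluxOp hΩ hU.isOpen hΩU hS.smooth)
      (fun i hi => hS.fluxOp_frameVec hU hΩ hΩU h₁ h₂ hi) hj,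
    hS.fluxOp_frameVec hU hΩ hΩU (hS'.jetSmooth_fluxOp₁ hU hΩ hΩU h₁ h₂)
      (hS'.jetSmooth_fluxOp₂ hU hΩ hΩU h₁ h₂) hj,
    hS'.fluxOp_frameVec hU hΩ hΩU (hS.jetSmooth_fluxOp₁ hU hΩ hΩU h₁ h₂)
      (hS.jetSmooth_fluxOp₂ hU hΩ hΩU h₁ h₂) hj]
  have e1 := hS.fluxOp₁_comp hU hS' hΩ hΩU h₁ h₂ hj
  have e2 := hS.fluxOp₂_comp hU hS' hΩ hΩU h₁ h₂ hj
  rw [evol_comm hΩ h₁ hX hX' hc hj, sub_self, sub_eq_zero] at e1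
  rw [evol_comm hΩ h₂ hX hX' hc hj, sub_self, sub_eq_zero] at e2
  simp only [frameVec, e1, e2]

end SymPair

end FrameCalculus

/-! ### Degree two fluxes: jet variables versus derivatives of the Riemann invariants. -/

section QuadraticForms

variable {c m : ℝ} {U : Set (ℝ × ℝ)}

/-- The coefficients of a homogeneous differential polynomial of degree two in the derivatives of
the Riemann invariants. -/
structure QuadForm where
  s₁ : ℝ × ℝ → ℝ
  s₂ : ℝ × ℝ → ℝ
  r₁₁ : ℝ × ℝ → ℝ
  r₁₂ : ℝ × ℝ → ℝ
  r₂₂ : ℝ × ℝ → ℝ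

namespace QuadForm

/-- The value of the form on the derivatives `S₁ S₂ R₁ R₂`. -/
def val (Q : QuadForm) (w : ℝ × ℝ) (S₁ S₂ R₁ R₂ : ℝ) : ℝ :=
  Q.s₁ w * S₁ + Q.s₂ w * S₂ + (Q.r₁₁ w * R₁ ^ 2 + Q.r₁₂ w * (R₁ * R₂) + Q.r₂₂ w * R₂ ^ 2)

noncomputable def ev (c m : ℝ) (Q : QuadForm) (j : Jet) : ℝ :=
  Q.val (j 0) (jetS₁ c m j) (jetS₂ c m j) (jetR₁ c m j) (jetR₂ c m j)

/-- All coefficients are smooth. -/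
structure Smooth (Q : QuadForm) (U : Set (ℝ × ℝ)) : Prop where
  s₁ : ContDiffOn ℝ ∞ Q.s₁ U
  s₂ : ContDiffOn ℝ ∞ Q.s₂ U
  r₁₁ : ContDiffOn ℝ ∞ Q.r₁₁ U
  r₁₂ : ContDiffOn ℝ ∞ Q.r₁₂ U
  r₂₂ : ContDiffOn ℝ ∞ Q.r₂₂ U

lemma Smooth.jetSmooth {Q : QuadForm} (hQ : Q.Smooth U) (hU : AdmissibleDomain m U) :
    JetSmooth (jetDomain U) (Q.ev c m) :=
  (((hU.jetSmooth_base hQ.s₁).mul hU.jetSmooth_S₁).add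
    ((hU.jetSmooth_base hQ.s₂).mul hU.jetSmooth_S₂)).add
  ((((hU.jetSmooth_base hQ.r₁₁).mul (hU.jetSmooth_R₁.pow 2)).add
    ((hU.jetSmooth_base hQ.r₁₂).mul (hU.jetSmooth_R₁.mul hU.jetSmooth_R₂))).add
    ((hU.jetSmooth_base hQ.r₂₂).mul (hU.jetSmooth_R₂.pow 2)))

/-- Coefficientwise difference. -/
def sub (Q Q' : QuadForm) : QuadForm where
  s₁ w := Q.s₁ w - Q'.s₁ w
  s₂ w := Q.s₂ w - Q'.s₂ w
  r₁₁ w := Q.r₁₁ w - Q'.r₁₁ w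
  r₁₂ w := Q.r₁₂ w - Q'.r₁₂ w
  r₂₂ w := Q.r₂₂ w - Q'.r₂₂ w

lemma Smooth.sub {Q Q' : QuadForm} (h : Q.Smooth U) (h' : Q'.Smooth U) : (Q.sub Q').Smooth U :=
  ⟨h.s₁.sub h'.s₁, h.s₂.sub h'.s₂, h.r₁₁.sub h'.r₁₁, h.r₁₂.sub h'.r₁₂, h.r₂₂.sub h'.r₂₂⟩

lemma ev_sub (Q Q' : QuadForm) (j : Jet) :
    (Q.sub Q').ev c m j = Q.ev c m j - Q'.ev c m j := by
  simp only [ev, val, sub]; ring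

lemma hasJetDir_ev (Q : QuadForm) {j η : Jet} {ds₁ ds₂ dr₁₁ dr₁₂ dr₂₂ dS₁ dS₂ dR₁ dR₂ : ℝ}
    (h₁ : HasJetDir (fun i => Q.s₁ (i 0)) j η ds₁) (h₂ : HasJetDir (fun i => Q.s₂ (i 0)) j η ds₂)
    (h₁₁ : HasJetDir (fun i => Q.r₁₁ (i 0)) j η dr₁₁)
    (h₁₂ : HasJetDir (fun i => Q.r₁₂ (i 0)) j η dr₁₂)
    (h₂₂ : HasJetDir (fun i => Q.r₂₂ (i 0)) j η dr₂₂) (hS₁ : HasJetDir (jetS₁ c m) j η dS₁)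
    (hS₂ : HasJetDir (jetS₂ c m) j η dS₂) (hR₁ : HasJetDir (jetR₁ c m) j η dR₁)
    (hR₂ : HasJetDir (jetR₂ c m) j η dR₂) :
    HasJetDir (Q.ev c m) j η (ds₁ * jetS₁ c m j + Q.s₁ (j 0) * dS₁
      + (ds₂ * jetS₂ c m j + Q.s₂ (j 0) * dS₂)
      + (dr₁₁ * jetR₁ c m j ^ 2 + Q.r₁₁ (j 0) * (2 * jetR₁ c m j * dR₁)
        + (dr₁₂ * (jetR₁ c m j * jetR₂ c m j)
          + Q.r₁₂ (j 0) * (dR₁ * jetR₂ c m j + jetR₁ c m j * dR₂))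
        + (dr₂₂ * jetR₂ c m j ^ 2 + Q.r₂₂ (j 0) * (2 * jetR₂ c m j * dR₂)))) :=
  ((h₁.mul hS₁).add (h₂.mul hS₂)).add (((h₁₁.mul hR₁.pow_two).add (h₁₂.mul (hR₁.mul hR₂))).add
    (h₂₂.mul hR₂.pow_two))

end QuadForm

/-! ### Second derivatives of the Riemann invariants -/

lemma hasJetDir_eval_fst (j η : Jet) (k : ℕ) : HasJetDir (fun i => (i k).1) j η (η k).1 := by
  have h2 : HasDerivAt (fun t : ℝ => (j k).1 + t * (η k).1) ((η k).1) 0 := by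
    simpa using ((hasDerivAt_id (0 : ℝ)).mul_const (η k).1).const_add (j k).1
  simpa [HasJetDir] using h2

lemma hasJetDir_eval_snd (j η : Jet) (k : ℕ) : HasJetDir (fun i => (i k).2) j η (η k).2 := by
  have h2 : HasDerivAt (fun t : ℝ => (j k).2 + t * (η k).2) ((η k).2) 0 := by
    simpa using ((hasDerivAt_id (0 : ℝ)).mul_const (η k).2).const_add (j k).2
  simpa [HasJetDir] using h2

namespace AdmissibleDomain

variable (hU : AdmissibleDomain m U)
include hU

lemma contDiffOn_div_kap (s : ℝ) : ContDiffOn ℝ ∞ (fun p => s / kap m p) U :=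
  contDiffOn_const.div hU.contDiffOn_kap fun _ hp => (hU.kap_pos hp).ne'

/-- Covers both invariants: their `x`-derivatives have this form with `s = -sig c` and `s = tau c`.
-/
lemma Dx_linear (s : ℝ) {j : Jet} (hj : j ∈ jetDomain U) :
    jetDir (fun i : Jet => (i 1).2 + s / kap m (i 0) * (i 1).1) j (jetShift j)
      = (j 2).2 + s / kap m (j 0) * ((j 2).1 - rho m (j 0) * (j 1).1 ^ 2) := by
  have hk := (hU.kap_pos hj).ne'
  have h := (hU.jetSmooth_base (hU.contDiffOn_div_kap s)).hasJetDir_Dx hU.jetOpen hj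
  rw [((hasJetDir_eval_snd j (jetShift j) 1).add
    (h.mul (hasJetDir_eval_fst j (jetShift j) 1))).eq,
    hU.Dx_base (c := 0) (hU.contDiffOn_div_kap s) hj, hU.along_div_kap s hj, hU.along_div_kap s hj,
    hU.jetR₁_eq hj, hU.jetR₂_eq hj]
  simp only [jetShift, frame₁, frame₂, sig, tau]
  field_simp
  ring

lemma jetS₁_eq {j : Jet} (hj : j ∈ jetDomain U) : jetS₁ c m j =
    (j 2).2 - sig c / kap m (j 0) * ((j 2).1 - rho m (j 0) * (j 1).1 ^ 2) := by
  have h := hU.Dx_linear (-sig c) hj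
  rw [jetS₁, Dx_eq hU.jetOpen hU.jetSmooth_R₁ hj,
    jetDir_congr hU.jetOpen (g := fun i : Jet => (i 1).2 + -sig c / kap m (i 0) * (i 1).1)
      (fun i hi => (hU.jetR₁_eq hi).trans (by ring)) hj, h]
  ring

lemma jetS₂_eq {j : Jet} (hj : j ∈ jetDomain U) : jetS₂ c m j =
    (j 2).2 + tau c / kap m (j 0) * ((j 2).1 - rho m (j 0) * (j 1).1 ^ 2) := by
  rw [jetS₂, Dx_eq hU.jetOpen hU.jetSmooth_R₂ hj,
    jetDir_congr hU.jetOpen (g := fun i : Jet => (i 1).2 + tau c / kap m (i 0) * (i 1).1)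
      (fun i hi => hU.jetR₂_eq hi) hj, hU.Dx_linear _ hj]

lemma jet_two {j : Jet} (hj : j ∈ jetDomain U) :
    j 2 = (kap m (j 0) * (jetS₂ c m j - jetS₁ c m j)
        + rho m (j 0) * kap m (j 0) ^ 2 * (jetR₂ c m j - jetR₁ c m j) ^ 2,
      tau c * jetS₁ c m j + sig c * jetS₂ c m j) := by
  have hk := (hU.kap_pos hj).ne'
  rw [hU.jetS₁_eq hj, hU.jetS₂_eq hj, hU.jetR₁_eq hj, hU.jetR₂_eq hj]
  refine Prod.ext ?_ ?_
  · simp only [sig, tau]; field_simp; ring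
  · simp only [sig, tau]; field_simp; ring

/-- Only the way in which the third derivatives of `w` enter is needed in order to prescribe `jetT₁`
and `jetT₂`; the lower order part stays an unspecified `G`. -/
lemma Dx_quadratic (s : ℝ) : ∃ G : ℝ × ℝ → ℝ × ℝ → ℝ × ℝ → ℝ, ∀ j ∈ jetDomain U,
    jetDir (fun i : Jet => (i 2).2 + s / kap m (i 0) * ((i 2).1 - rho m (i 0) * (i 1).1 ^ 2)) j
      (jetShift j) = (j 3).2 + s / kap m (j 0) * (j 3).1 + G (j 0) (j 1) (j 2) := by
  refine ⟨fun w x y => fderiv ℝ (fun p => s / kap m p) w x * (y.1 - rho m w * x.1 ^ 2)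
    - s / kap m w * (fderiv ℝ (rho m) w x * x.1 ^ 2 + rho m w * (2 * x.1 * y.1)),
    fun j hj => ?_⟩
  have h := (hU.jetSmooth_base (hU.contDiffOn_div_kap s)).hasJetDir_Dx hU.jetOpen hj
  have h' := (hU.jetSmooth_base hU.contDiffOn_rho).hasJetDir_Dx hU.jetOpen hj
  rw [((hasJetDir_eval_snd j (jetShift j) 2).add
    (h.mul ((hasJetDir_eval_fst j (jetShift j) 2).sub
      (h'.mul (hasJetDir_eval_fst j (jetShift j) 1).pow_two)))).eq,
    DihedralFlow.Dx_base hU.isOpen (hU.contDiffOn_div_kap s) hj,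
    DihedralFlow.Dx_base hU.isOpen hU.contDiffOn_rho hj]
  simp only [jetShift]
  ring

/-- The derivatives of the Riemann invariants can be prescribed. -/
lemma exists_jet {w : ℝ × ℝ} (hw : w ∈ U) (R₁ R₂ S₁ S₂ T₁ T₂ : ℝ) :
    ∃ j : Jet, j 0 = w ∧ jetR₁ c m j = R₁ ∧ jetR₂ c m j = R₂ ∧ jetS₁ c m j = S₁ ∧
      jetS₂ c m j = S₂ ∧ jetT₁ c m j = T₁ ∧ jetT₂ c m j = T₂ := by
  have hk := (hU.kap_pos hw).ne'
  obtain ⟨G₁, hG₁⟩ := hU.Dx_quadratic (-sig c)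
  obtain ⟨G₂, hG₂⟩ := hU.Dx_quadratic (tau c)
  have hT₁ : ∀ j ∈ jetDomain U, jetT₁ c m j =
      (j 3).2 + -sig c / kap m (j 0) * (j 3).1 + G₁ (j 0) (j 1) (j 2) := by
    intro j hj
    rw [jetT₁, Dx_eq hU.jetOpen hU.jetSmooth_S₁ hj, ← hG₁ j hj]
    exact jetDir_congr hU.jetOpen (fun i hi => (hU.jetS₁_eq hi).trans (by ring)) hj _
  have hT₂ : ∀ j ∈ jetDomain U, jetT₂ c m j =
      (j 3).2 + tau c / kap m (j 0) * (j 3).1 + G₂ (j 0) (j 1) (j 2) := by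
    intro j hj
    rw [jetT₂, Dx_eq hU.jetOpen hU.jetSmooth_S₂ hj, ← hG₂ j hj]
    exact jetDir_congr hU.jetOpen (fun i hi => hU.jetS₂_eq hi) hj _
  set j1 : ℝ × ℝ := (kap m w * (R₂ - R₁), tau c * R₁ + sig c * R₂) with h1
  set j2 : ℝ × ℝ := (kap m w * (S₂ - S₁) + rho m w * j1.1 ^ 2, tau c * S₁ + sig c * S₂) with h2
  set x₁ : ℝ := T₁ - G₁ w j1 j2
  set x₂ : ℝ := T₂ - G₂ w j1 j2
  -- Each order inverts the same two by two system, lower order terms having been moved to the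
  -- prescribed side. Entries of index at least four are irrelevant and repeat entry three.
  set j : Jet := fun k => match k with
    | 0 => w
    | 1 => j1
    | 2 => j2
    | _ => (kap m w * (x₂ - x₁), tau c * x₁ + sig c * x₂)
  have hj : j ∈ jetDomain U := hw
  refine ⟨j, rfl, ?_, ?_, ?_, ?_, ?_, ?_⟩
  · rw [hU.jetR₁_eq hj]; simp only [j, h1, sig, tau]; field_simp; ring
  · rw [hU.jetR₂_eq hj]; simp only [j, h1, sig, tau]; field_simp; ring
  · rw [hU.jetS₁_eq hj]; simp only [j, h2, sig, tau]; field_simp; ring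
  · rw [hU.jetS₂_eq hj]; simp only [j, h2, sig, tau]; field_simp; ring
  · rw [hT₁ j hj]; simp only [j, x₁, sig, tau]; field_simp; ring
  · rw [hT₂ j hj]; simp only [j, x₂, sig, tau]; field_simp; ring

end AdmissibleDomain

/-! ### Change between the two descriptions of fluxes -/

/-- The flux of a deformation in the frame. -/
lemma SecondOrder.exists_frame (hU : AdmissibleDomain m U) {a : SecondOrder} (ha : a.SmoothOn U) :
    ∃ Q₁ Q₂ : QuadForm, Q₁.Smooth U ∧ Q₂.Smooth U ∧
      ∀ j ∈ jetDomain U, a.toFun j = frameVec c m (Q₁.ev c m) (Q₂.ev c m) j := by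
  obtain ⟨h13, h14, h15, h16, h17, h23, h24, h25, h26, h27⟩ := ha
  have hk := hU.contDiffOn_kap
  have hr := hU.contDiffOn_rho
  have hi := hU.contDiffOn_div_kap
  -- Substitutes `u_x = kap (R₂ - R₁)`, `v_x = tau R₁ + sig R₂` and their `x`-derivatives in one
  -- scalar component.
  let form : (f₃ f₄ f₅ f₆ f₇ : ℝ × ℝ → ℝ) → QuadForm := fun f₃ f₄ f₅ f₆ f₇ =>
    { s₁ := fun w => f₃ w * (-kap m w) + f₄ w * tau c
      s₂ := fun w => f₃ w * kap m w + f₄ w * sig c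
      r₁₁ := fun w => f₃ w * (rho m w * kap m w ^ 2) + f₅ w * kap m w ^ 2 + f₆ w * tau c ^ 2
        + f₇ w * (-(kap m w * tau c))
      r₁₂ := fun w => f₃ w * (-2 * rho m w * kap m w ^ 2) + f₅ w * (-2 * kap m w ^ 2)
        + f₆ w * (2 * sig c * tau c) + f₇ w * (kap m w * (tau c - sig c))
      r₂₂ := fun w => f₃ w * (rho m w * kap m w ^ 2) + f₅ w * kap m w ^ 2 + f₆ w * sig c ^ 2
        + f₇ w * (kap m w * sig c) }
  -- The frame components of a vector `(X, Y)` are `Y + (s / kap) X` with `s = -sig` and `s = tau`.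
  let comb : ℝ → QuadForm → QuadForm → QuadForm := fun s X Y =>
    { s₁ := fun w => Y.s₁ w + s / kap m w * X.s₁ w
      s₂ := fun w => Y.s₂ w + s / kap m w * X.s₂ w
      r₁₁ := fun w => Y.r₁₁ w + s / kap m w * X.r₁₁ w
      r₁₂ := fun w => Y.r₁₂ w + s / kap m w * X.r₁₂ w
      r₂₂ := fun w => Y.r₂₂ w + s / kap m w * X.r₂₂ w }
  have hform : ∀ {f₃ f₄ f₅ f₆ f₇ : ℝ × ℝ → ℝ}, ContDiffOn ℝ ∞ f₃ U → ContDiffOn ℝ ∞ f₄ U →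
      ContDiffOn ℝ ∞ f₅ U → ContDiffOn ℝ ∞ f₆ U → ContDiffOn ℝ ∞ f₇ U →
      (form f₃ f₄ f₅ f₆ f₇).Smooth U := by
    intro f₃ f₄ f₅ f₆ f₇ h₃ h₄ h₅ h₆ h₇
    constructor <;> simp only [form] <;> fun_prop
  have hcomb : ∀ {s : ℝ} {X Y : QuadForm}, X.Smooth U → Y.Smooth U → (comb s X Y).Smooth U :=
    fun hX hY => ⟨hY.s₁.add ((hi _).mul hX.s₁), hY.s₂.add ((hi _).mul hX.s₂),
      hY.r₁₁.add ((hi _).mul hX.r₁₁), hY.r₁₂.add ((hi _).mul hX.r₁₂),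
      hY.r₂₂.add ((hi _).mul hX.r₂₂)⟩
  refine ⟨comb (-sig c) (form a.a13 a.a14 a.a15 a.a16 a.a17)
    (form a.a23 a.a24 a.a25 a.a26 a.a27), comb (tau c) (form a.a13 a.a14 a.a15 a.a16 a.a17)
    (form a.a23 a.a24 a.a25 a.a26 a.a27), hcomb (hform h13 h14 h15 h16 h17)
    (hform h23 h24 h25 h26 h27), hcomb (hform h13 h14 h15 h16 h17)
    (hform h23 h24 h25 h26 h27), fun j hj => ?_⟩
  have hk0 := (hU.kap_pos hj).ne'
  rw [SecondOrder.toFun, hU.jet_one (c := c) hj, hU.jet_two (c := c) hj]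
  simp only [frameVec, QuadForm.ev, QuadForm.val, comb, form]
  have h1 : tau c = 1 - sig c := by rw [← sig_add_tau c]; ring
  refine Prod.ext ?_ ?_
  · simp only; rw [h1]; field_simp; ring
  · simp only; rw [h1]; field_simp; ring

/-- A flux given in the frame comes from a deformation. -/
lemma SecondOrder.exists_of_frame (hU : AdmissibleDomain m U) {Q₁ Q₂ : QuadForm}
    (h₁ : Q₁.Smooth U) (h₂ : Q₂.Smooth U) : ∃ a : SecondOrder, a.SmoothOn U ∧
      ∀ j ∈ jetDomain U, a.toFun j = frameVec c m (Q₁.ev c m) (Q₂.ev c m) j := by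
  have hk := hU.contDiffOn_kap
  have hr := hU.contDiffOn_rho
  have hi := hU.contDiffOn_div_kap 1
  obtain ⟨a₁, a₂, a₃, a₄, a₅⟩ := h₁
  obtain ⟨b₁, b₂, b₃, b₄, b₅⟩ := h₂
  let g₃ : QuadForm → ℝ × ℝ → ℝ := fun Q w => 1 / kap m w * (tau c * Q.s₂ w - sig c * Q.s₁ w)
  let g₄ : QuadForm → ℝ × ℝ → ℝ := fun Q w => Q.s₁ w + Q.s₂ w
  let g₅ : QuadForm → ℝ × ℝ → ℝ := fun Q w =>
    rho m w * (1 / kap m w) * (sig c * Q.s₁ w - tau c * Q.s₂ w)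
      + (1 / kap m w) ^ 2 * (sig c ^ 2 * Q.r₁₁ w - sig c * tau c * Q.r₁₂ w + tau c ^ 2 * Q.r₂₂ w)
  let g₆ : QuadForm → ℝ × ℝ → ℝ := fun Q w => Q.r₁₁ w + Q.r₁₂ w + Q.r₂₂ w
  let g₇ : QuadForm → ℝ × ℝ → ℝ := fun Q w =>
    1 / kap m w * (-2 * sig c * Q.r₁₁ w + (tau c - sig c) * Q.r₁₂ w + 2 * tau c * Q.r₂₂ w)
  refine ⟨⟨fun w => kap m w * (g₃ Q₂ w - g₃ Q₁ w), fun w => kap m w * (g₄ Q₂ w - g₄ Q₁ w),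
    fun w => kap m w * (g₅ Q₂ w - g₅ Q₁ w), fun w => kap m w * (g₆ Q₂ w - g₆ Q₁ w),
    fun w => kap m w * (g₇ Q₂ w - g₇ Q₁ w), fun w => tau c * g₃ Q₁ w + sig c * g₃ Q₂ w,
    fun w => tau c * g₄ Q₁ w + sig c * g₄ Q₂ w, fun w => tau c * g₅ Q₁ w + sig c * g₅ Q₂ w,
    fun w => tau c * g₆ Q₁ w + sig c * g₆ Q₂ w, fun w => tau c * g₇ Q₁ w + sig c * g₇ Q₂ w⟩,
    ?_, fun j hj => ?_⟩
  · refine ⟨?_, ?_, ?_, ?_, ?_, ?_, ?_, ?_, ?_, ?_⟩ <;> simp only [g₃, g₄, g₅, g₆, g₇] <;> fun_prop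
  · have hk0 := (hU.kap_pos hj).ne'
    simp only [frameVec, QuadForm.ev, QuadForm.val, hU.jetS₁_eq hj, hU.jetS₂_eq hj,
      hU.jetR₁_eq hj, hU.jetR₂_eq hj, SecondOrder.toFun, g₃, g₄, g₅, g₆, g₇]
    refine Prod.ext ?_ ?_
    · simp only; field_simp; ring
    · simp only; field_simp; ring

/-- A degree one flux given in the frame comes from a Miura transformation. -/
lemma FirstOrder.exists_of_frame (hU : AdmissibleDomain m U) {b₁₁ b₁₂ b₂₁ b₂₂ : ℝ × ℝ → ℝ}
    (h₁₁ : ContDiffOn ℝ ∞ b₁₁ U) (h₁₂ : ContDiffOn ℝ ∞ b₁₂ U) (h₂₁ : ContDiffOn ℝ ∞ b₂₁ U)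
    (h₂₂ : ContDiffOn ℝ ∞ b₂₂ U) : ∃ b : FirstOrder, b.SmoothOn U ∧ ∀ j ∈ jetDomain U,
      b.toFun j = frameVec c m (fun j => b₁₁ (j 0) * jetR₁ c m j + b₁₂ (j 0) * jetR₂ c m j)
        (fun j => b₂₁ (j 0) * jetR₁ c m j + b₂₂ (j 0) * jetR₂ c m j) j := by
  have hk := hU.contDiffOn_kap
  have hi := hU.contDiffOn_div_kap 1
  refine ⟨⟨fun w => tau c * (b₂₂ w - b₁₂ w) - sig c * (b₂₁ w - b₁₁ w),
    fun w => kap m w * (b₂₁ w + b₂₂ w - b₁₁ w - b₁₂ w),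
    fun w => 1 / kap m w * (tau c * (tau c * b₁₂ w - sig c * b₁₁ w)
      + sig c * (tau c * b₂₂ w - sig c * b₂₁ w)),
    fun w => tau c * (b₁₁ w + b₁₂ w) + sig c * (b₂₁ w + b₂₂ w)⟩, ?_, fun j hj => ?_⟩
  · refine ⟨?_, ?_, ?_, ?_⟩ <;> simp only <;> fun_prop
  · have hk0 := (hU.kap_pos hj).ne'
    simp only [frameVec, hU.jetR₁_eq hj, hU.jetR₂_eq hj, FirstOrder.toFun]
    refine Prod.ext ?_ ?_
    · simp only; field_simp; ring
    · simp only; field_simp; ring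

end QuadraticForms

/-! ### Rational generators with polynomial fluxes. -/

section Generators

variable {c m : ℝ} {U : Set (ℝ × ℝ)}

lemma JetSmooth.continuousOn {E : Type*} [NormedAddCommGroup E] [NormedSpace ℝ E] {Ω : Set Jet}
    {f : Jet → E} (hf : JetSmooth Ω f) : ContinuousOn f Ω := by
  obtain ⟨n, F, O, -, hF, H⟩ := hf
  exact (hF.continuousOn.comp (jetTrunc n).continuous.continuousOn fun j hj => (H j hj).1).congr
    fun j hj => (H j hj).2

/-- The jets at which the `x`-derivatives of the Riemann invariants do not vanish. -/
def regularJets (c m : ℝ) (U : Set (ℝ × ℝ)) : Set Jet :=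
  {j | j ∈ jetDomain U ∧ jetR₁ c m j * jetR₂ c m j ≠ 0}

lemma regularJets_subset : regularJets c m U ⊆ jetDomain U := fun _ hj => hj.1

lemma isOpen_regularJets (hU : AdmissibleDomain m U) : IsOpen (regularJets c m U) :=
  (hU.jetSmooth_R₁.mul hU.jetSmooth_R₂).continuousOn.isOpen_inter_preimage hU.jetOpen
    isOpen_compl_singleton

/-- Smooth differential functions that agree at the regular jets agree. -/
lemma eqOn_of_regularJets {E : Type*} [NormedAddCommGroup E] [NormedSpace ℝ E]
    (hU : AdmissibleDomain m U) {f g : Jet → E} (hf : JetSmooth (jetDomain U) f)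
    (hg : JetSmooth (jetDomain U) g) (h : Set.EqOn f g (regularJets c m U)) :
    Set.EqOn f g (jetDomain U) := by
  intro j hj
  -- Moving `v_x` alone shifts both `R₁` and `R₂` by `t`, so nearby jets on this line are regular
  -- for small `t ≠ 0`; continuity does the rest.
  set e : Jet := Pi.single 1 (0, 1) with he
  have he0 : e 0 = 0 := by simp [e]
  have he1 : e 1 = (0, 1) := by simp [e]
  have hmem : ∀ t : ℝ, j + t • e ∈ jetDomain U := fun t => by
    have : (j + t • e) 0 = j 0 := by simp [he0]
    simpa [jetDomain, this] using hj
  have hR₁ : ∀ t : ℝ, jetR₁ c m (j + t • e) = jetR₁ c m j + t := by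
    intro t
    rw [hU.jetR₁_eq (hmem t), hU.jetR₁_eq hj]
    simp [he0, he1]; ring
  have hR₂ : ∀ t : ℝ, jetR₂ c m (j + t • e) = jetR₂ c m j + t := by
    intro t
    rw [hU.jetR₂_eq (hmem t), hU.jetR₂_eq hj]
    simp [he0, he1]; ring
  have hne : ∀ x : ℝ, ∀ᶠ t in 𝓝[≠] (0 : ℝ), x + t ≠ 0 := by
    intro x
    by_cases hx : x = 0
    · subst hx
      filter_upwards [self_mem_nhdsWithin] with t ht
      simpa using ht
    · have hc : ContinuousAt (fun t : ℝ => x + t) 0 := by fun_prop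
      exact (hc.eventually_ne (by simpa using hx)).filter_mono nhdsWithin_le_nhds
  have hfg : ∀ᶠ t in 𝓝[≠] (0 : ℝ), f (j + t • e) = g (j + t • e) := by
    filter_upwards [hne (jetR₁ c m j), hne (jetR₂ c m j)] with t h₁ h₂
    exact h ⟨hmem t, by rw [hR₁, hR₂]; exact mul_ne_zero h₁ h₂⟩
  have cf := ((hf.hasDerivAt hU.jetOpen hj e).continuousAt.tendsto).mono_left
    (nhdsWithin_le_nhds (s := {0}ᶜ))
  have cg := ((hg.hasDerivAt hU.jetOpen hj e).continuousAt.tendsto).mono_left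
    (nhdsWithin_le_nhds (s := {0}ᶜ))
  have := tendsto_nhds_unique (cf.congr' hfg) cg
  simpa using this

/-- Data of a generator `k = Σ (φᵢ r_{i,xx}/r_{i,x} + Σ_j b_{ij} r_{j,x}) e_i` of a deformation. -/
structure Generator where
  φ₁ : ℝ × ℝ → ℝ
  φ₂ : ℝ × ℝ → ℝ
  b₁₁ : ℝ × ℝ → ℝ
  b₁₂ : ℝ × ℝ → ℝ
  b₂₁ : ℝ × ℝ → ℝ
  b₂₂ : ℝ × ℝ → ℝ

namespace Generator

/-- Smoothness, and the equations on `φ₁`, `φ₂` that make the deformation polynomial. -/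
structure Regular (c m : ℝ) (K : Generator) (U : Set (ℝ × ℝ)) : Prop where
  φ₁ : ContDiffOn ℝ ∞ K.φ₁ U
  φ₂ : ContDiffOn ℝ ∞ K.φ₂ U
  b₁₁ : ContDiffOn ℝ ∞ K.b₁₁ U
  b₁₂ : ContDiffOn ℝ ∞ K.b₁₂ U
  b₂₁ : ContDiffOn ℝ ∞ K.b₂₁ U
  b₂₂ : ContDiffOn ℝ ∞ K.b₂₂ U
  d2_φ₁ : ∀ w ∈ U, along (frame₂ c m) K.φ₁ w = -2 * sig c * rho m w * kap m w * K.φ₁ w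
  d1_φ₂ : ∀ w ∈ U, along (frame₁ c m) K.φ₂ w = 2 * tau c * rho m w * kap m w * K.φ₂ w

noncomputable def comp₁ (c m : ℝ) (K : Generator) (j : Jet) : ℝ :=
  K.φ₁ (j 0) * jetS₁ c m j / jetR₁ c m j
    + (K.b₁₁ (j 0) * jetR₁ c m j + K.b₁₂ (j 0) * jetR₂ c m j)

noncomputable def comp₂ (c m : ℝ) (K : Generator) (j : Jet) : ℝ :=
  K.φ₂ (j 0) * jetS₂ c m j / jetR₂ c m j
    + (K.b₂₁ (j 0) * jetR₁ c m j + K.b₂₂ (j 0) * jetR₂ c m j)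

/-- The deformation generated by `K`, for the symmetry with data `p`, `q`. -/
noncomputable def form₁ (c m : ℝ) (K : Generator) (p q : ℝ × ℝ → ℝ) : QuadForm where
  s₁ w := 2 * K.φ₁ w * along (frame₁ c m) (mu₁ c m p q) w
  s₂ w := sig c * rho m w * q w * (K.φ₁ w - K.φ₂ w) + K.b₁₂ w * (q w / kap m w)
  r₁₁ w := K.φ₁ w * along (frame₁ c m) (along (frame₁ c m) (mu₁ c m p q)) w
    + K.b₁₁ w * along (frame₁ c m) (mu₁ c m p q) w
  r₁₂ w := K.φ₁ w * (along (frame₂ c m) (along (frame₁ c m) (mu₁ c m p q)) w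
      + along (frame₁ c m) (along (frame₂ c m) (mu₁ c m p q)) w)
    + along (frame₂ c m) K.b₁₁ w * (q w / kap m w)
    + sig c * rho m w * q w * (2 * K.b₁₁ w - K.b₂₁ w) + tau c * rho m w * q w * K.b₁₂ w
  r₂₂ w := K.φ₁ w * along (frame₂ c m) (along (frame₂ c m) (mu₁ c m p q)) w
    + along (frame₂ c m) K.b₁₂ w * (q w / kap m w)
    + K.b₁₂ w * along (frame₂ c m) (mu₂ c m p q) w
    + sig c * rho m w * q w * (K.b₁₂ w - K.b₂₂ w)

noncomputable def form₂ (c m : ℝ) (K : Generator) (p q : ℝ × ℝ → ℝ) : QuadForm where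
  s₁ w := tau c * rho m w * q w * (K.φ₂ w - K.φ₁ w) - K.b₂₁ w * (q w / kap m w)
  s₂ w := 2 * K.φ₂ w * along (frame₂ c m) (mu₂ c m p q) w
  r₁₁ w := K.φ₂ w * along (frame₁ c m) (along (frame₁ c m) (mu₂ c m p q)) w
    - along (frame₁ c m) K.b₂₁ w * (q w / kap m w)
    + K.b₂₁ w * along (frame₁ c m) (mu₁ c m p q) w
    + tau c * rho m w * q w * (K.b₂₁ w - K.b₁₁ w)
  r₁₂ w := K.φ₂ w * (along (frame₂ c m) (along (frame₁ c m) (mu₂ c m p q)) w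
      + along (frame₁ c m) (along (frame₂ c m) (mu₂ c m p q)) w)
    - along (frame₁ c m) K.b₂₂ w * (q w / kap m w)
    + tau c * rho m w * q w * (2 * K.b₂₂ w - K.b₁₂ w) + sig c * rho m w * q w * K.b₂₁ w
  r₂₂ w := K.φ₂ w * along (frame₂ c m) (along (frame₂ c m) (mu₂ c m p q)) w
    + K.b₂₂ w * along (frame₂ c m) (mu₂ c m p q) w

lemma Regular.jetSmooth_comp₁ {K : Generator} (hK : K.Regular c m U) (hU : AdmissibleDomain m U) :
    JetSmooth (regularJets c m U) (K.comp₁ c m) := by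
  have h := regularJets_subset (c := c) (m := m) (U := U)
  exact ((((hU.jetSmooth_base hK.φ₁).mono h).mul (hU.jetSmooth_S₁.mono h)).div
    (hU.jetSmooth_R₁.mono h) fun j hj => left_ne_zero_of_mul hj.2).add
    ((((hU.jetSmooth_base hK.b₁₁).mono h).mul (hU.jetSmooth_R₁.mono h)).add
      (((hU.jetSmooth_base hK.b₁₂).mono h).mul (hU.jetSmooth_R₂.mono h)))

lemma Regular.jetSmooth_comp₂ {K : Generator} (hK : K.Regular c m U) (hU : AdmissibleDomain m U) :
    JetSmooth (regularJets c m U) (K.comp₂ c m) := by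
  have h := regularJets_subset (c := c) (m := m) (U := U)
  exact ((((hU.jetSmooth_base hK.φ₂).mono h).mul (hU.jetSmooth_S₂.mono h)).div
    (hU.jetSmooth_R₂.mono h) fun j hj => right_ne_zero_of_mul hj.2).add
    ((((hU.jetSmooth_base hK.b₂₁).mono h).mul (hU.jetSmooth_R₁.mono h)).add
      (((hU.jetSmooth_base hK.b₂₂).mono h).mul (hU.jetSmooth_R₂.mono h)))

lemma hasJetDir_comp₁ (K : Generator) {j η : Jet} {dφ d₁ d₂ dS dR₁ dR₂ : ℝ}
    (hφ : HasJetDir (fun i => K.φ₁ (i 0)) j η dφ) (h₁ : HasJetDir (fun i => K.b₁₁ (i 0)) j η d₁)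
    (h₂ : HasJetDir (fun i => K.b₁₂ (i 0)) j η d₂) (hS : HasJetDir (jetS₁ c m) j η dS)
    (hR₁ : HasJetDir (jetR₁ c m) j η dR₁) (hR₂ : HasJetDir (jetR₂ c m) j η dR₂)
    (h0 : jetR₁ c m j ≠ 0) :
    HasJetDir (K.comp₁ c m) j η (((dφ * jetS₁ c m j + K.φ₁ (j 0) * dS) * jetR₁ c m j
      - K.φ₁ (j 0) * jetS₁ c m j * dR₁) / jetR₁ c m j ^ 2
      + (d₁ * jetR₁ c m j + K.b₁₁ (j 0) * dR₁ + (d₂ * jetR₂ c m j + K.b₁₂ (j 0) * dR₂))) :=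
  ((hφ.mul hS).div hR₁ h0).add ((h₁.mul hR₁).add (h₂.mul hR₂))

lemma hasJetDir_comp₂ (K : Generator) {j η : Jet} {dφ d₁ d₂ dS dR₁ dR₂ : ℝ}
    (hφ : HasJetDir (fun i => K.φ₂ (i 0)) j η dφ) (h₁ : HasJetDir (fun i => K.b₂₁ (i 0)) j η d₁)
    (h₂ : HasJetDir (fun i => K.b₂₂ (i 0)) j η d₂) (hS : HasJetDir (jetS₂ c m) j η dS)
    (hR₁ : HasJetDir (jetR₁ c m) j η dR₁) (hR₂ : HasJetDir (jetR₂ c m) j η dR₂)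
    (h0 : jetR₂ c m j ≠ 0) :
    HasJetDir (K.comp₂ c m) j η (((dφ * jetS₂ c m j + K.φ₂ (j 0) * dS) * jetR₂ c m j
      - K.φ₂ (j 0) * jetS₂ c m j * dR₂) / jetR₂ c m j ^ 2
      + (d₁ * jetR₁ c m j + K.b₂₁ (j 0) * dR₁ + (d₂ * jetR₂ c m j + K.b₂₂ (j 0) * dR₂))) :=
  ((hφ.mul hS).div hR₂ h0).add ((h₁.mul hR₁).add (h₂.mul hR₂))

section

variable {K : Generator} {β : ℝ × ℝ → ℝ × ℝ} {p q : ℝ × ℝ → ℝ}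

/-- The third derivative `T₁` cancels. The only nonpolynomial monomial is `R₂ S₁ / R₁`, with
coefficient `∂₂φ₁ q/kap + 2 sig rho q φ₁`: one half of the second term comes from `∂₂μ₁`, the other
from the variation of the frame. The equation on `φ₁` makes it zero, whatever the symmetry. -/
lemma Regular.fluxOp₁_eq (hK : K.Regular c m U) (hU : AdmissibleDomain m U)
    (hS : SymPair c m U β p q) {j : Jet} (hj : j ∈ regularJets c m U) :
    fluxOp₁ c m β p q (K.comp₁ c m) (K.comp₂ c m) j = (K.form₁ c m p q).ev c m j := by
  have hjU := hj.1
  have hΩ := hU.jetOpen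
  have h1 : jetR₁ c m j ≠ 0 := left_ne_zero_of_mul hj.2
  have h2 : jetR₂ c m j ≠ 0 := right_ne_zero_of_mul hj.2
  have hk := (hU.kap_pos hjU).ne'
  have hφ := hU.jetSmooth_base hK.φ₁
  have ha := hU.jetSmooth_base hK.b₁₁
  have hb := hU.jetSmooth_base hK.b₁₂
  have hc := hK.jetSmooth_comp₁ hU
  rw [fluxOp₁, evol_eq (isOpen_regularJets hU) hc hj, Dx_eq (isOpen_regularJets hU) hc hj,
    (hasJetDir_comp₁ K (hφ.hasJetDir_Dx hΩ hjU) (ha.hasJetDir_Dx hΩ hjU)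
      (hb.hasJetDir_Dx hΩ hjU) (hU.jetSmooth_S₁.hasJetDir_Dx hΩ hjU)
      (hU.jetSmooth_R₁.hasJetDir_Dx hΩ hjU) (hU.jetSmooth_R₂.hasJetDir_Dx hΩ hjU) h1).eq,
    (hasJetDir_comp₁ K (hφ.hasJetDir_evol hΩ hjU _) (ha.hasJetDir_evol hΩ hjU _)
      (hb.hasJetDir_evol hΩ hjU _) (hU.jetSmooth_S₁.hasJetDir_evol hΩ hjU _)
      (hU.jetSmooth_R₁.hasJetDir_evol hΩ hjU _) (hU.jetSmooth_R₂.hasJetDir_evol hΩ hjU _) h1).eq,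
    hU.Dx_base (c := c) hK.φ₁ hjU, hU.Dx_base (c := c) hK.b₁₁ hjU,
    hU.Dx_base (c := c) hK.b₁₂ hjU, hS.evol_base hU hK.φ₁ hjU, hS.evol_base hU hK.b₁₁ hjU,
    hS.evol_base hU hK.b₁₂ hjU, hS.evol_S₁ hU hjU, hS.evol_R₁ hU hjU, hS.evol_R₂ hU hjU]
  simp only [velX, velXX, QuadForm.ev, QuadForm.val, form₁, comp₁, comp₂, jetT₁]
  rw [hS.d2_mu₁ hU hjU, hS.d1_mu₂ hU hjU, SymPair.mu₂_sub_mu₁ p q, hK.d2_φ₁ _ hjU]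
  simp only [show Dx (jetR₁ c m) = jetS₁ c m from rfl, show Dx (jetR₂ c m) = jetS₂ c m from rfl]
  field_simp
  ring

lemma Regular.fluxOp₂_eq (hK : K.Regular c m U) (hU : AdmissibleDomain m U)
    (hS : SymPair c m U β p q) {j : Jet} (hj : j ∈ regularJets c m U) :
    fluxOp₂ c m β p q (K.comp₁ c m) (K.comp₂ c m) j = (K.form₂ c m p q).ev c m j := by
  have hjU := hj.1
  have hΩ := hU.jetOpen
  have h1 : jetR₁ c m j ≠ 0 := left_ne_zero_of_mul hj.2
  have h2 : jetR₂ c m j ≠ 0 := right_ne_zero_of_mul hj.2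
  have hk := (hU.kap_pos hjU).ne'
  have hφ := hU.jetSmooth_base hK.φ₂
  have ha := hU.jetSmooth_base hK.b₂₁
  have hb := hU.jetSmooth_base hK.b₂₂
  have hc := hK.jetSmooth_comp₂ hU
  rw [fluxOp₂, evol_eq (isOpen_regularJets hU) hc hj, Dx_eq (isOpen_regularJets hU) hc hj,
    (hasJetDir_comp₂ K (hφ.hasJetDir_Dx hΩ hjU) (ha.hasJetDir_Dx hΩ hjU)
      (hb.hasJetDir_Dx hΩ hjU) (hU.jetSmooth_S₂.hasJetDir_Dx hΩ hjU)
      (hU.jetSmooth_R₁.hasJetDir_Dx hΩ hjU) (hU.jetSmooth_R₂.hasJetDir_Dx hΩ hjU) h2).eq,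
    (hasJetDir_comp₂ K (hφ.hasJetDir_evol hΩ hjU _) (ha.hasJetDir_evol hΩ hjU _)
      (hb.hasJetDir_evol hΩ hjU _) (hU.jetSmooth_S₂.hasJetDir_evol hΩ hjU _)
      (hU.jetSmooth_R₁.hasJetDir_evol hΩ hjU _) (hU.jetSmooth_R₂.hasJetDir_evol hΩ hjU _) h2).eq,
    hU.Dx_base (c := c) hK.φ₂ hjU, hU.Dx_base (c := c) hK.b₂₁ hjU,
    hU.Dx_base (c := c) hK.b₂₂ hjU, hS.evol_base hU hK.φ₂ hjU, hS.evol_base hU hK.b₂₁ hjU,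
    hS.evol_base hU hK.b₂₂ hjU, hS.evol_S₂ hU hjU, hS.evol_R₁ hU hjU, hS.evol_R₂ hU hjU]
  simp only [velX, velXX, QuadForm.ev, QuadForm.val, form₂, comp₁, comp₂, jetT₂]
  rw [hS.d2_mu₁ hU hjU, hS.d1_mu₂ hU hjU, SymPair.mu₂_sub_mu₁ p q, hK.d1_φ₂ _ hjU]
  simp only [show Dx (jetR₁ c m) = jetS₁ c m from rfl, show Dx (jetR₂ c m) = jetS₂ c m from rfl]
  field_simp
  ring

lemma Regular.smooth_form₁ (hK : K.Regular c m U) (hU : AdmissibleDomain m U)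
    (hS : SymPair c m U β p q) : (K.form₁ c m p q).Smooth U := by
  have hf₁ := hU.contDiffOn_frame₁ (c := c)
  have hf₂ := hU.contDiffOn_frame₂ (c := c)
  have h₁ := contDiffOn_along hU.isOpen hf₁ (hS.contDiffOn_mu₁ hU)
  have h₂ := contDiffOn_along hU.isOpen hf₂ (hS.contDiffOn_mu₁ hU)
  have h₃ := contDiffOn_along hU.isOpen hf₂ (hS.contDiffOn_mu₂ hU)
  have h₁₁ := contDiffOn_along hU.isOpen hf₁ h₁
  have h₂₁ := contDiffOn_along hU.isOpen hf₂ h₁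
  have h₁₂ := contDiffOn_along hU.isOpen hf₁ h₂
  have h₂₂ := contDiffOn_along hU.isOpen hf₂ h₂
  have hb₁ := contDiffOn_along hU.isOpen hf₂ hK.b₁₁
  have hb₂ := contDiffOn_along hU.isOpen hf₂ hK.b₁₂
  have hk := hU.contDiffOn_kap
  have hr := hU.contDiffOn_rho
  obtain ⟨k₁, k₂, k₃, k₄, k₅, k₆, -, -⟩ := hK
  have hq' := hS.smooth_q
  constructor <;> simp only [form₁] <;>
    fun_prop (disch := exact fun p hp => (hU.kap_pos hp).ne')

lemma Regular.smooth_form₂ (hK : K.Regular c m U) (hU : AdmissibleDomain m U)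
    (hS : SymPair c m U β p q) : (K.form₂ c m p q).Smooth U := by
  have hf₁ := hU.contDiffOn_frame₁ (c := c)
  have hf₂ := hU.contDiffOn_frame₂ (c := c)
  have h₁ := contDiffOn_along hU.isOpen hf₁ (hS.contDiffOn_mu₂ hU)
  have h₂ := contDiffOn_along hU.isOpen hf₂ (hS.contDiffOn_mu₂ hU)
  have h₃ := contDiffOn_along hU.isOpen hf₁ (hS.contDiffOn_mu₁ hU)
  have h₁₁ := contDiffOn_along hU.isOpen hf₁ h₁
  have h₂₁ := contDiffOn_along hU.isOpen hf₂ h₁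
  have h₁₂ := contDiffOn_along hU.isOpen hf₁ h₂
  have h₂₂ := contDiffOn_along hU.isOpen hf₂ h₂
  have hb₁ := contDiffOn_along hU.isOpen hf₁ hK.b₂₁
  have hb₂ := contDiffOn_along hU.isOpen hf₁ hK.b₂₂
  have hk := hU.contDiffOn_kap
  have hr := hU.contDiffOn_rho
  obtain ⟨k₁, k₂, k₃, k₄, k₅, k₆, -, -⟩ := hK
  have hq' := hS.smooth_q
  constructor <;> simp only [form₂] <;>
    fun_prop (disch := exact fun p hp => (hU.kap_pos hp).ne')

/-- The flux generated by `K`. -/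
noncomputable def flux (c m : ℝ) (K : Generator) (p q : ℝ × ℝ → ℝ) : Jet → ℝ × ℝ :=
  frameVec c m ((K.form₁ c m p q).ev c m) ((K.form₂ c m p q).ev c m)

lemma Regular.jetSmooth_flux (hK : K.Regular c m U) (hU : AdmissibleDomain m U)
    (hS : SymPair c m U β p q) : JetSmooth (jetDomain U) (K.flux c m p q) :=
  jetSmooth_frameVec hU subset_rfl ((hK.smooth_form₁ hU hS).jetSmooth hU)
    ((hK.smooth_form₂ hU hS).jetSmooth hU)

lemma Regular.fluxOp_eq (hK : K.Regular c m U) (hU : AdmissibleDomain m U)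
    (hS : SymPair c m U β p q) {j : Jet} (hj : j ∈ regularJets c m U) :
    fluxOp β (frameVec c m (K.comp₁ c m) (K.comp₂ c m)) j = K.flux c m p q j := by
  rw [hS.fluxOp_frameVec hU (isOpen_regularJets hU) regularJets_subset (hK.jetSmooth_comp₁ hU)
    (hK.jetSmooth_comp₂ hU) hj]
  simp only [flux, frameVec, hK.fluxOp₁_eq hU hS hj, hK.fluxOp₂_eq hU hS hj]

/-- The deformations generated by `K` of two commuting symmetries are compatible. -/
lemma Regular.flux_compatible (hK : K.Regular c m U) (hU : AdmissibleDomain m U)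
    (hS : SymPair c m U β p q) {β' : ℝ × ℝ → ℝ × ℝ} {p' q' : ℝ × ℝ → ℝ}
    (hS' : SymPair c m U β' p' q')
    (hcomm : ∀ i ∈ jetDomain U, commutator (conservationLaw β) (conservationLaw β') i = 0) :
    Set.EqOn (fluxOp β (K.flux c m p' q')) (fluxOp β' (K.flux c m p q)) (jetDomain U) := by
  have hΩ := isOpen_regularJets (c := c) hU
  -- Both sides are smooth on all jets, so it suffices to compare them where the rational generator
  -- is defined; there `fluxOp_comm` applies.
  refine eqOn_of_regularJets (c := c) hU
    ((hK.jetSmooth_flux hU hS').fluxOp hU.jetOpen hU.isOpen subset_rfl hS.smooth)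
    ((hK.jetSmooth_flux hU hS).fluxOp hU.jetOpen hU.isOpen subset_rfl hS'.smooth) fun j hj => ?_
  have h := hS.fluxOp_comm hU hS' hcomm hΩ regularJets_subset (hK.jetSmooth_comp₁ hU)
    (hK.jetSmooth_comp₂ hU) hj
  have hsub := regularJets_subset (c := c) (m := m) (U := U)
  rw [hS.fluxOp_congr hU hΩ hsub ((hK.jetSmooth_flux hU hS').mono hsub)
      (fun i hi => (hK.fluxOp_eq hU hS' hi).symm) hj, h,
    hS'.fluxOp_congr hU hΩ hsub ((hK.jetSmooth_flux hU hS).mono hsub)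
      (fun i hi => (hK.fluxOp_eq hU hS hi).symm) hj]

/-- For `φ₁ = φ₂ = 0` the generator is polynomial. -/
lemma Regular.fluxOp_polynomial (hK : K.Regular c m U) (hU : AdmissibleDomain m U)
    (hS : SymPair c m U β p q) (h₁ : ∀ w, K.φ₁ w = 0) (h₂ : ∀ w, K.φ₂ w = 0) :
    Set.EqOn (fluxOp β (frameVec c m
      (fun j => K.b₁₁ (j 0) * jetR₁ c m j + K.b₁₂ (j 0) * jetR₂ c m j)
      (fun j => K.b₂₁ (j 0) * jetR₁ c m j + K.b₂₂ (j 0) * jetR₂ c m j)))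
      (K.flux c m p q) (jetDomain U) := by
  have hk := jetSmooth_frameVec (c := c) hU subset_rfl
    (((hU.jetSmooth_base hK.b₁₁).mul (hU.jetSmooth_R₁ (c := c))).add
      ((hU.jetSmooth_base hK.b₁₂).mul (hU.jetSmooth_R₂ (c := c))))
    (((hU.jetSmooth_base hK.b₂₁).mul (hU.jetSmooth_R₁ (c := c))).add
      ((hU.jetSmooth_base hK.b₂₂).mul (hU.jetSmooth_R₂ (c := c))))
  refine eqOn_of_regularJets (c := c) hU (hk.fluxOp hU.jetOpen hU.isOpen subset_rfl hS.smooth)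
    (hK.jetSmooth_flux hU hS) fun j hj => ?_
  rw [← hK.fluxOp_eq hU hS hj]
  congr 2 <;> funext i <;> simp [comp₁, comp₂, h₁, h₂]

end

end Generator

end Generators

/-! ### Symmetries of the primary flow. -/

section Symmetries

variable {c m : ℝ} {U : Set (ℝ × ℝ)}

lemma hasFDerivAt_rpow_fst {w : ℝ × ℝ} (hw : 0 < w.1) (s : ℝ) :
    HasFDerivAt (fun p : ℝ × ℝ => p.1 ^ s)
      ((s * w.1 ^ (s - 1)) • ContinuousLinearMap.fst ℝ ℝ ℝ) w :=
  (Real.hasDerivAt_rpow_const (Or.inl hw.ne')).comp_hasFDerivAt w hasFDerivAt_fst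

lemma symPair_primaryFlux (hU : AdmissibleDomain m U) :
    SymPair c m U (primaryFlux c m) (fun _ => 0) (fun _ => 1) where
  smooth := by
    have h1 := hU.contDiffOn_rpow m
    have h2 := hU.contDiffOn_rpow (2 * m - 1)
    unfold primaryFlux
    fun_prop
  smooth_p := contDiffOn_const
  smooth_q := contDiffOn_const
  jacobian := by
    intro w hw z
    have h0 := hU.pos w hw
    have hm := hU.m_pos
    have hk := (hU.kap_pos hw).ne'
    have h21 : 2 * m - 1 ≠ 0 := by linarith [hU.one_lt]
    have h1 := ((hasFDerivAt_rpow_fst h0 m).const_mul (-2 * c)).add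
      (hasFDerivAt_snd (𝕜 := ℝ) (p := w))
    have h2 := (hasFDerivAt_rpow_fst h0 (2 * m - 1)).const_mul
      (-(m ^ 2 / (2 * m - 1)) * (c ^ 2 - 4))
    have h3 : HasFDerivAt (primaryFlux c m) _ w := h1.prodMk h2
    have h4 : w.1 ^ (2 * m - 1 - 1) = (w.1 ^ (m - 1)) ^ 2 := by
      rw [← Real.rpow_natCast, ← Real.rpow_mul h0.le]; congr 1; push_cast; ring
    rw [h3.fderiv]
    refine Prod.ext ?_ ?_
    · simp [hU.rpow_m_sub_one hw, sig, tau]; field_simp; ring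
    · simp only [h4]
      generalize 2 * m - 1 = d at *
      simp [hU.rpow_m_sub_one hw, sig, tau]; field_simp; ring
  d1_p := fun w _ => by simp [along_const]
  d2_p := fun w _ => by simp [along_const]

/-- The flux of the symmetry `p = v`, `q = u`. -/
noncomputable def scalingFlux (c m : ℝ) (w : ℝ × ℝ) : ℝ × ℝ :=
  (w.1 * w.2 - 2 * c * m / (m + 1) * w.1 ^ (m + 1),
    w.2 ^ 2 / 2 - m / 2 * (c ^ 2 - 4) * w.1 ^ (2 * m))

/-- The test symmetry of the converse direction: its nonconstant `q = u` makes compatibility with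
the primary flow restrictive. -/
lemma symPair_scalingFlux (hU : AdmissibleDomain m U) :
    SymPair c m U (scalingFlux c m) (fun w => w.2) (fun w => w.1) where
  smooth := by
    have h1 := hU.contDiffOn_rpow (m + 1)
    have h2 := hU.contDiffOn_rpow (2 * m)
    unfold scalingFlux
    fun_prop
  smooth_p := contDiff_snd.contDiffOn
  smooth_q := contDiff_fst.contDiffOn
  jacobian := by
    intro w hw z
    have h0 := hU.pos w hw
    have hm := hU.m_pos
    have hk := (hU.kap_pos hw).ne'
    have h21 : m + 1 ≠ 0 := by linarith [hU.one_lt]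
    have hf : HasFDerivAt (fun p : ℝ × ℝ => p.1) (ContinuousLinearMap.fst ℝ ℝ ℝ) w :=
      hasFDerivAt_fst
    have hs : HasFDerivAt (fun p : ℝ × ℝ => p.2) (ContinuousLinearMap.snd ℝ ℝ ℝ) w :=
      hasFDerivAt_snd
    have h1 := (hf.fun_mul hs).fun_sub
      ((hasFDerivAt_rpow_fst h0 (m + 1)).const_mul (2 * c * m / (m + 1)))
    have h2 := ((hs.fun_mul hs).mul_const (1 / 2 : ℝ)).fun_sub
      ((hasFDerivAt_rpow_fst h0 (2 * m)).const_mul (m / 2 * (c ^ 2 - 4)))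
    have h6 : scalingFlux c m = fun y => (y.1 * y.2 - 2 * c * m / (m + 1) * y.1 ^ (m + 1),
        y.2 * y.2 * (1 / 2) - m / 2 * (c ^ 2 - 4) * y.1 ^ (2 * m)) := by
      funext x
      refine Prod.ext rfl ?_
      simp only [scalingFlux]; ring
    have h3 := h1.prodMk h2
    rw [← h6] at h3
    have h4 : w.1 ^ (2 * m - 1) = (w.1 ^ (m - 1)) ^ 2 * w.1 := by
      rw [← Real.rpow_natCast, ← Real.rpow_mul h0.le, ← Real.rpow_add_one h0.ne']
      congr 1; push_cast; ring
    have h5 : w.1 ^ (m + 1 - 1) = w.1 ^ (m - 1) * w.1 := by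
      rw [← Real.rpow_add_one h0.ne']; congr 1; ring
    rw [h3.fderiv]
    refine Prod.ext ?_ ?_
    · simp only [h5]
      simp [hU.rpow_m_sub_one hw, sig, tau]; field_simp; ring
    · simp [h4, hU.rpow_m_sub_one hw, sig, tau]; field_simp; ring
  d1_p := fun w hw => by
    have hk := (hU.kap_pos hw).ne'
    rw [along_fst, along_snd]
    simp only [frame₁, lam₂]; field_simp
  d2_p := fun w hw => by
    have hk := (hU.kap_pos hw).ne'
    rw [along_fst, along_snd]
    simp only [frame₂, lam₁]; field_simp

lemma commutator_law {α β : ℝ × ℝ → ℝ × ℝ} (hU : IsOpen U) (hα : ContDiffOn ℝ ∞ α U)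
    (hβ : ContDiffOn ℝ ∞ β U) {j : Jet} (hj : j ∈ jetDomain U) :
    commutator (conservationLaw α) (conservationLaw β) j =
      Dx (fun i => fderiv ℝ β (i 0) (conservationLaw α i)
        - fderiv ℝ α (i 0) (conservationLaw β i)) j := by
  have hΩ := isOpen_jetDomain hU
  have hA := jetSmooth_conservationLaw hΩ hU subset_rfl hα
  have hB := jetSmooth_conservationLaw hΩ hU subset_rfl hβ
  have e1 := jetSmooth_fderiv_apply hU subset_rfl hβ hA
  have e2 := jetSmooth_fderiv_apply hU subset_rfl hα hB
  rw [commutator, evol_law hU hβ hA hj, evol_law hU hα hB hj, Dx_eq hΩ (e1.sub e2) hj,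
    jetDir_sub hΩ e1 e2 hj, Dx_eq hΩ e1 hj, Dx_eq hΩ e2 hj]

/-- Both Jacobian matrices are of the form `p + qA` and hence commute, so the flux of the commutator
is identically zero. -/
lemma SymPair.commute {β β' : ℝ × ℝ → ℝ × ℝ} {p q p' q' : ℝ × ℝ → ℝ} (hS : SymPair c m U β p q)
    (hS' : SymPair c m U β' p' q') (hU : AdmissibleDomain m U) {j : Jet} (hj : j ∈ jetDomain U) :
    commutator (conservationLaw β) (conservationLaw β') j = 0 := by
  rw [commutator_law hU.isOpen hS.smooth hS'.smooth hj]
  have h : Set.EqOn (fun i : Jet => fderiv ℝ β' (i 0) (conservationLaw β i)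
        - fderiv ℝ β (i 0) (conservationLaw β' i)) (fun _ => 0) (jetDomain U) := by
    intro i hi
    simp only
    rw [hS.law_eq hU hi, hS'.law_eq hU hi, hS.jacobian _ hi, hS'.jacobian _ hi]
    have hk := (hU.kap_pos hi).ne'
    simp only [mu₁, mu₂, lam₁, lam₂, sig, tau]
    refine Prod.ext ?_ ?_
    · simp only [Prod.mk_sub_mk, Prod.fst_zero]; field_simp; ring
    · simp only [Prod.mk_sub_mk, Prod.snd_zero]; field_simp; ring
  rw [Dx_eqOn hU.jetOpen ((jetSmooth_const _ 0).congr h) h hj,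
    Dx_eq hU.jetOpen (jetSmooth_const _ 0) hj]
  simp [jetDir]

lemma SymPair.isSymmetry {β : ℝ × ℝ → ℝ × ℝ} {p q : ℝ × ℝ → ℝ} (hS : SymPair c m U β p q)
    (hU : AdmissibleDomain m U) : IsSymmetry U (primaryFlux c m) β :=
  ⟨hS.smooth, fun _ hj => (symPair_primaryFlux hU).commute hS hU hj⟩

lemma along_frame₁ {h : ℝ × ℝ → ℝ} (w : ℝ × ℝ) : along (frame₁ c m) h w =
    -kap m w * along (fun _ => (1, 0)) h w + tau c * along (fun _ => (0, 1)) h w := by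
  have : frame₁ c m w = (-kap m w) • ((1, 0) : ℝ × ℝ) + tau c • ((0, 1) : ℝ × ℝ) := by
    simp [frame₁]
  rw [along, this, map_add, map_smul, map_smul]; rfl

lemma along_frame₂ {h : ℝ × ℝ → ℝ} (w : ℝ × ℝ) : along (frame₂ c m) h w =
    kap m w * along (fun _ => (1, 0)) h w + sig c * along (fun _ => (0, 1)) h w := by
  have : frame₂ c m w = (kap m w) • ((1, 0) : ℝ × ℝ) + sig c • ((0, 1) : ℝ × ℝ) := by
    simp [frame₂]
  rw [along, this, map_add, map_smul, map_smul]; rfl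

/-- Every symmetry of the primary flow has a Jacobian matrix of the form `p + q A`. -/
lemma IsSymmetry.exists_symPair {β : ℝ × ℝ → ℝ × ℝ} (hU : AdmissibleDomain m U)
    (hβ : IsSymmetry U (primaryFlux c m) β) : ∃ p q, SymPair c m U β p q := by
  obtain ⟨hs, hc⟩ := hβ
  have hα := symPair_primaryFlux (c := c) hU
  have hA : ContDiffOn ℝ ∞ (fderiv ℝ β) U := hs.fderiv_of_isOpen hU.isOpen (by simp)
  have hcomm : ∀ w ∈ U, ∀ z, fderiv ℝ β w (fderiv ℝ (primaryFlux c m) w z)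
      = fderiv ℝ (primaryFlux c m) w (fderiv ℝ β w z) := by
    intro w hw z
    have e1 := jetSmooth_fderiv_apply hU.isOpen subset_rfl hs (hα.jetSmooth_law hU)
    have e2 := jetSmooth_fderiv_apply hU.isOpen subset_rfl hα.smooth
      (jetSmooth_conservationLaw hU.jetOpen hU.isOpen subset_rfl hs)
    -- The flux of the commutator has zero total derivative, so it depends on `w` only; it is linear
    -- in `w_x`, and comparing `w_x = z` with `w_x = 0` shows that the two Jacobian matrices
    -- commute.
    have h := eq_of_Dx_eq_zero hU.isOpen (e1.sub e2)
      (fun j hj => by rw [← commutator_law hU.isOpen hα.smooth hs hj]; exact hc j hj)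
      (j := fun k => if k = 0 then w else z) (j' := fun k => if k = 0 then w else 0)
      (by simpa [jetDomain] using hw) rfl
    have hl : ∀ {γ : ℝ × ℝ → ℝ × ℝ} (_ : ContDiffOn ℝ ∞ γ U) (y : ℝ × ℝ),
        conservationLaw γ (fun k => if k = 0 then w else y) = fderiv ℝ γ w y := by
      intro γ hγ y
      rw [conservationLaw, Dx_base hU.isOpen hγ (by simpa using hw)]
      simp
    rw [hl hα.smooth, hl hα.smooth, hl hs, hl hs] at h
    simp only [if_true, map_zero, sub_zero] at h
    exact sub_eq_zero.1 h
  -- The matrix `A` sends `(0, 1)` to `(1, 0)`, so the second column of `p + qA` is `(q, p)`.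
  -- Commuting with `A` determines the first column from it.
  let p : ℝ × ℝ → ℝ := fun w => (fderiv ℝ β w (0, 1)).2
  let q : ℝ × ℝ → ℝ := fun w => (fderiv ℝ β w (0, 1)).1
  have hv : ContDiffOn ℝ ∞ (fun w => fderiv ℝ β w (0, 1)) U := hA.clm_apply contDiffOn_const
  have hp : ContDiffOn ℝ ∞ p U := hv.snd
  have hq : ContDiffOn ℝ ∞ q U := hv.fst
  have h10 : ∀ w ∈ U, fderiv ℝ β w (1, 0) =
      (p w + (tau c - sig c) / kap m w * q w, sig c * tau c / kap m w ^ 2 * q w) := by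
    intro w hw
    have h := hcomm w hw (0, 1)
    rw [hα.jacobian w hw, hα.jacobian w hw] at h
    simp only [mul_one, mul_zero, zero_add, one_mul, add_zero, zero_mul] at h
    rw [h]
    simp only [p, q]
    refine Prod.ext ?_ ?_
    · simp only; ring
    · rfl
  refine ⟨p, q, ⟨hs, hp, hq, ?_, ?_, ?_⟩⟩
  · intro w hw z
    have hz : z = z.1 • ((1, 0) : ℝ × ℝ) + z.2 • ((0, 1) : ℝ × ℝ) := by simp
    conv_lhs => rw [hz]
    rw [map_add, map_smul, map_smul, h10 w hw]
    refine Prod.ext ?_ ?_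
    · simp [p, q]; ring
    · simp [p, q]; ring
  all_goals
    intro w hw
    have hk := (hU.kap_pos hw).ne'
    have hd : DifferentiableAt ℝ (fderiv ℝ β) w :=
      (hA.contDiffAt (hU.isOpen.mem_nhds hw)).differentiableAt (by simp)
    have hsym : IsSymmSndFDerivAt ℝ β w := (hs.contDiffAt (hU.isOpen.mem_nhds hw)).isSymmSndFDerivAt
      (by simpa using WithTop.coe_le_coe.2 (le_top : (2 : ℕ∞) ≤ ⊤))
    have hfst : ∀ x y, along (fun _ => x) (fun w => (fderiv ℝ β w y).1) w
        = (fderiv ℝ (fderiv ℝ β) w x y).1 := by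
      intro x y
      have := (hd.hasFDerivAt.clm_apply (hasFDerivAt_const y w)).fst
      rw [along, this.fderiv]; simp
    have hsnd : ∀ x y, along (fun _ => x) (fun w => (fderiv ℝ β w y).2) w
        = (fderiv ℝ (fderiv ℝ β) w x y).2 := by
      intro x y
      have := (hd.hasFDerivAt.clm_apply (hasFDerivAt_const y w)).snd
      rw [along, this.fderiv]; simp
    have k1 : ContDiffOn ℝ ∞ (fun w => (tau c - sig c) / kap m w) U := hU.contDiffOn_div_kap _
    have k2 : ContDiffOn ℝ ∞ (fun w => sig c * tau c / kap m w) U := hU.contDiffOn_div_kap _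
    have k3 : ContDiffOn ℝ ∞ (fun w => 1 / kap m w) U := hU.contDiffOn_div_kap _
    -- `r1` and `r2` are the equalities of mixed second derivatives of the two components of `β`.
    -- Rewritten in the frame they are the relations between the derivatives of `p` and `q`.
    have r1 : along (fun _ => (0, 1)) p w
        + (tau c - sig c) / kap m w * along (fun _ => (0, 1)) q w =
          along (fun _ => (1, 0)) q w := by
      have h := hfst (0, 1) (1, 0)
      rw [hsym.eq, ← hfst (1, 0) (0, 1), along_congr hU.isOpen
        (g := fun w => p w + (tau c - sig c) / kap m w * q w) (fun i hi => by rw [h10 i hi]) hw,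
        along_add hU.isOpen hp (k1.mul hq) hw, along_mul hU.isOpen k1 hq hw,
        hU.along_div_kap _ hw] at h
      simp only [mul_zero, zero_mul, add_zero] at h
      exact h
    have r2 : sig c * tau c / kap m w ^ 2 * along (fun _ => (0, 1)) q w
        = along (fun _ => (1, 0)) p w := by
      have h := hsnd (0, 1) (1, 0)
      rw [hsym.eq, ← hsnd (1, 0) (0, 1), along_congr hU.isOpen
        (g := fun w => sig c * tau c / kap m w * (1 / kap m w * q w))
        (fun i hi => by rw [h10 i hi]; simp only; ring) hw,
        along_mul hU.isOpen k2 (k3.mul hq) hw, along_mul hU.isOpen k3 hq hw,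
        hU.along_div_kap _ hw, hU.along_div_kap _ hw] at h
      simp only [mul_zero, zero_mul, add_zero] at h
      refine Eq.trans ?_ h
      ring
    simp only [along_frame₁, along_frame₂, lam₁, lam₂]
    rw [← r1, ← r2]
    simp only [sig, tau]
    field_simp
    ring

/-- The functions `r₁`, `r₂` are Riemann invariants of the primary flow. -/
lemma areRiemannInvariants (hU : AdmissibleDomain m U) :
    AreRiemannInvariants U (primaryFlux c m) (riemann₁ c m) (riemann₂ c m) := by
  have hα := symPair_primaryFlux (c := c) hU
  refine ⟨hU.contDiffOn_riemann₁, hU.contDiffOn_riemann₂, fun w hw => ?_,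
    mu₁ c m (fun _ => 0) (fun _ => 1), mu₂ c m (fun _ => 0) (fun _ => 1),
    hα.contDiffOn_mu₁ hU, hα.contDiffOn_mu₂ hU, fun w hw => ?_,
    fun j hj => ⟨hα.evol_riemann₁ hU hj, hα.evol_riemann₂ hU hj⟩⟩
  · have hk := (hU.kap_pos hw).ne'
    have h1 := ((hU.contDiffOn_riemann₁ (c := c)).contDiffAt
      (hU.isOpen.mem_nhds hw)).differentiableAt (by simp)
    have h2 := ((hU.contDiffOn_riemann₂ (c := c)).contDiffAt
      (hU.isOpen.mem_nhds hw)).differentiableAt (by simp)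
    rw [(h1.hasFDerivAt.prodMk h2.hasFDerivAt).fderiv]
    have hst : sig c = 1 - tau c := by rw [← sig_add_tau c]; ring
    refine Function.bijective_iff_has_inverse.2
      ⟨fun z => (kap m w * (z.2 - z.1), tau c * z.1 + sig c * z.2), fun z => ?_, fun z => ?_⟩
    · simp only [ContinuousLinearMap.prod_apply, hU.fderiv_riemann₁ hw, hU.fderiv_riemann₂ hw]
      refine Prod.ext ?_ ?_
      · simp only [hst]; field_simp; ring
      · simp only [hst]; field_simp; ring
    · simp only [ContinuousLinearMap.prod_apply, hU.fderiv_riemann₁ hw, hU.fderiv_riemann₂ hw]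
      refine Prod.ext ?_ ?_
      · simp only [hst]; field_simp; ring
      · simp only [hst]; field_simp; ring
  · have hk := (hU.kap_pos hw).ne'
    rw [SymPair.mu₂_sub_mu₁]
    simp [hk]

end Symmetries

/-! ### Consequences of compatibility with the test symmetry. -/

section Rigidity

variable {c m : ℝ} {U : Set (ℝ × ℝ)}

/-- The first and second total derivative of a velocity, as polynomials in the derivatives of the
Riemann invariants. -/
noncomputable def linVel (c m : ℝ) (μ : ℝ × ℝ → ℝ) (w : ℝ × ℝ) (R₁ R₂ : ℝ) : ℝ :=
  along (frame₁ c m) μ w * R₁ + along (frame₂ c m) μ w * R₂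

noncomputable def quadVel (c m : ℝ) (μ : ℝ × ℝ → ℝ) (w : ℝ × ℝ) (R₁ R₂ S₁ S₂ : ℝ) : ℝ :=
  (along (frame₁ c m) (along (frame₁ c m) μ) w * R₁
      + along (frame₂ c m) (along (frame₁ c m) μ) w * R₂) * R₁
    + along (frame₁ c m) μ w * S₁
    + ((along (frame₁ c m) (along (frame₂ c m) μ) w * R₁
      + along (frame₂ c m) (along (frame₂ c m) μ) w * R₂) * R₂
    + along (frame₂ c m) μ w * S₂)

/-- The frame components of `fluxOp` on quadratic forms, as polynomials in the derivatives of the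
Riemann invariants. -/
noncomputable def opVal₁ (c m : ℝ) (p q : ℝ × ℝ → ℝ) (Q₁ Q₂ : QuadForm) (w : ℝ × ℝ)
    (R₁ R₂ S₁ S₂ T₂ : ℝ) : ℝ :=
      (along (frame₂ c m) Q₁.s₁ w * S₁ + along (frame₂ c m) Q₁.s₂ w * S₂
        + along (frame₂ c m) Q₁.r₁₁ w * R₁ ^ 2
        + along (frame₂ c m) Q₁.r₁₂ w * (R₁ * R₂)
        + along (frame₂ c m) Q₁.r₂₂ w * R₂ ^ 2) * (q w / kap m w) * R₂
      + Q₁.s₁ w * (quadVel c m (mu₁ c m p q) w R₁ R₂ S₁ S₂ * R₁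
        + 2 * linVel c m (mu₁ c m p q) w R₁ R₂ * S₁)
      + Q₁.s₂ w * (quadVel c m (mu₂ c m p q) w R₁ R₂ S₁ S₂ * R₂
        + 2 * linVel c m (mu₂ c m p q) w R₁ R₂ * S₂ + q w / kap m w * T₂)
      + 2 * Q₁.r₁₁ w * linVel c m (mu₁ c m p q) w R₁ R₂ * R₁ ^ 2
      + Q₁.r₁₂ w * (linVel c m (mu₁ c m p q) w R₁ R₂ * (R₁ * R₂)
        + R₁ * (linVel c m (mu₂ c m p q) w R₁ R₂ * R₂ + q w / kap m w * S₂))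
      + 2 * Q₁.r₂₂ w * R₂ * (linVel c m (mu₂ c m p q) w R₁ R₂ * R₂ + q w / kap m w * S₂)
      + sig c * rho m w * q w * (Q₁.val w S₁ S₂ R₁ R₂ - Q₂.val w S₁ S₂ R₁ R₂) * R₂

noncomputable def opVal₂ (c m : ℝ) (p q : ℝ × ℝ → ℝ) (Q₁ Q₂ : QuadForm) (w : ℝ × ℝ)
    (R₁ R₂ S₁ S₂ T₁ : ℝ) : ℝ :=
      -(along (frame₁ c m) Q₂.s₁ w * S₁ + along (frame₁ c m) Q₂.s₂ w * S₂
        + along (frame₁ c m) Q₂.r₁₁ w * R₁ ^ 2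
        + along (frame₁ c m) Q₂.r₁₂ w * (R₁ * R₂)
        + along (frame₁ c m) Q₂.r₂₂ w * R₂ ^ 2) * (q w / kap m w) * R₁
      + Q₂.s₂ w * (quadVel c m (mu₂ c m p q) w R₁ R₂ S₁ S₂ * R₂
        + 2 * linVel c m (mu₂ c m p q) w R₁ R₂ * S₂)
      + Q₂.s₁ w * (quadVel c m (mu₁ c m p q) w R₁ R₂ S₁ S₂ * R₁
        + 2 * linVel c m (mu₁ c m p q) w R₁ R₂ * S₁ - q w / kap m w * T₁)
      + 2 * Q₂.r₂₂ w * linVel c m (mu₂ c m p q) w R₁ R₂ * R₂ ^ 2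
      + Q₂.r₁₂ w * (linVel c m (mu₂ c m p q) w R₁ R₂ * (R₁ * R₂)
        + R₂ * (linVel c m (mu₁ c m p q) w R₁ R₂ * R₁ - q w / kap m w * S₁))
      + 2 * Q₂.r₁₁ w * R₁ * (linVel c m (mu₁ c m p q) w R₁ R₂ * R₁ - q w / kap m w * S₁)
      + tau c * rho m w * q w * (Q₂.val w S₁ S₂ R₁ R₂ - Q₁.val w S₁ S₂ R₁ R₂) * R₁

namespace SymPair

variable {β : ℝ × ℝ → ℝ × ℝ} {p q : ℝ × ℝ → ℝ}

lemma fluxOp₁_ev (hS : SymPair c m U β p q) (hU : AdmissibleDomain m U) {Q₁ Q₂ : QuadForm}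
    (h : Q₁.Smooth U) {j : Jet} (hj : j ∈ jetDomain U) :
    fluxOp₁ c m β p q (Q₁.ev c m) (Q₂.ev c m) j =
      opVal₁ c m p q Q₁ Q₂ (j 0) (jetR₁ c m j) (jetR₂ c m j) (jetS₁ c m j) (jetS₂ c m j)
        (jetT₂ c m j) := by
  have hΩ := hU.jetOpen
  have e := h.jetSmooth (c := c) hU
  have t := fun {f : ℝ × ℝ → ℝ} (hf : ContDiffOn ℝ ∞ f U) =>
    (hU.jetSmooth_base hf).hasJetDir_evol hΩ hj (conservationLaw β)
  have x := fun {f : ℝ × ℝ → ℝ} (hf : ContDiffOn ℝ ∞ f U) =>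
    (hU.jetSmooth_base hf).hasJetDir_Dx hΩ hj
  rw [fluxOp₁, evol_eq hΩ e hj, Dx_eq hΩ e hj,
    (Q₁.hasJetDir_ev (x h.s₁) (x h.s₂) (x h.r₁₁) (x h.r₁₂) (x h.r₂₂)
      (hU.jetSmooth_S₁.hasJetDir_Dx hΩ hj) (hU.jetSmooth_S₂.hasJetDir_Dx hΩ hj)
      (hU.jetSmooth_R₁.hasJetDir_Dx hΩ hj) (hU.jetSmooth_R₂.hasJetDir_Dx hΩ hj)).eq,
    (Q₁.hasJetDir_ev (t h.s₁) (t h.s₂) (t h.r₁₁) (t h.r₁₂) (t h.r₂₂)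
      (hU.jetSmooth_S₁.hasJetDir_evol hΩ hj _) (hU.jetSmooth_S₂.hasJetDir_evol hΩ hj _)
      (hU.jetSmooth_R₁.hasJetDir_evol hΩ hj _) (hU.jetSmooth_R₂.hasJetDir_evol hΩ hj _)).eq,
    hU.Dx_base (c := c) h.s₁ hj, hU.Dx_base (c := c) h.s₂ hj, hU.Dx_base (c := c) h.r₁₁ hj,
    hU.Dx_base (c := c) h.r₁₂ hj, hU.Dx_base (c := c) h.r₂₂ hj, hS.evol_base hU h.s₁ hj,
    hS.evol_base hU h.s₂ hj, hS.evol_base hU h.r₁₁ hj, hS.evol_base hU h.r₁₂ hj,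
    hS.evol_base hU h.r₂₂ hj, hS.evol_S₁ hU hj, hS.evol_S₂ hU hj, hS.evol_R₁ hU hj,
    hS.evol_R₂ hU hj, SymPair.mu₂_sub_mu₁ p q]
  simp only [show Dx (jetR₁ c m) = jetS₁ c m from rfl, show Dx (jetR₂ c m) = jetS₂ c m from rfl,
    show Dx (jetS₁ c m) = jetT₁ c m from rfl, show Dx (jetS₂ c m) = jetT₂ c m from rfl, opVal₁,
      linVel, quadVel, velX, velXX,
    QuadForm.ev]
  ring

lemma fluxOp₂_ev (hS : SymPair c m U β p q) (hU : AdmissibleDomain m U) {Q₁ Q₂ : QuadForm}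
    (h : Q₂.Smooth U) {j : Jet} (hj : j ∈ jetDomain U) :
    fluxOp₂ c m β p q (Q₁.ev c m) (Q₂.ev c m) j =
      opVal₂ c m p q Q₁ Q₂ (j 0) (jetR₁ c m j) (jetR₂ c m j) (jetS₁ c m j) (jetS₂ c m j)
        (jetT₁ c m j) := by
  have hΩ := hU.jetOpen
  have e := h.jetSmooth (c := c) hU
  have t := fun {f : ℝ × ℝ → ℝ} (hf : ContDiffOn ℝ ∞ f U) =>
    (hU.jetSmooth_base hf).hasJetDir_evol hΩ hj (conservationLaw β)
  have x := fun {f : ℝ × ℝ → ℝ} (hf : ContDiffOn ℝ ∞ f U) =>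
    (hU.jetSmooth_base hf).hasJetDir_Dx hΩ hj
  rw [fluxOp₂, evol_eq hΩ e hj, Dx_eq hΩ e hj,
    (Q₂.hasJetDir_ev (x h.s₁) (x h.s₂) (x h.r₁₁) (x h.r₁₂) (x h.r₂₂)
      (hU.jetSmooth_S₁.hasJetDir_Dx hΩ hj) (hU.jetSmooth_S₂.hasJetDir_Dx hΩ hj)
      (hU.jetSmooth_R₁.hasJetDir_Dx hΩ hj) (hU.jetSmooth_R₂.hasJetDir_Dx hΩ hj)).eq,
    (Q₂.hasJetDir_ev (t h.s₁) (t h.s₂) (t h.r₁₁) (t h.r₁₂) (t h.r₂₂)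
      (hU.jetSmooth_S₁.hasJetDir_evol hΩ hj _) (hU.jetSmooth_S₂.hasJetDir_evol hΩ hj _)
      (hU.jetSmooth_R₁.hasJetDir_evol hΩ hj _) (hU.jetSmooth_R₂.hasJetDir_evol hΩ hj _)).eq,
    hU.Dx_base (c := c) h.s₁ hj, hU.Dx_base (c := c) h.s₂ hj, hU.Dx_base (c := c) h.r₁₁ hj,
    hU.Dx_base (c := c) h.r₁₂ hj, hU.Dx_base (c := c) h.r₂₂ hj, hS.evol_base hU h.s₁ hj,
    hS.evol_base hU h.s₂ hj, hS.evol_base hU h.r₁₁ hj, hS.evol_base hU h.r₁₂ hj,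
    hS.evol_base hU h.r₂₂ hj, hS.evol_S₁ hU hj, hS.evol_S₂ hU hj, hS.evol_R₁ hU hj,
    hS.evol_R₂ hU hj, SymPair.mu₂_sub_mu₁ p q]
  simp only [show Dx (jetR₁ c m) = jetS₁ c m from rfl, show Dx (jetR₂ c m) = jetS₂ c m from rfl,
    show Dx (jetS₁ c m) = jetT₁ c m from rfl, show Dx (jetS₂ c m) = jetT₂ c m from rfl, opVal₂,
      linVel, quadVel, velX, velXX,
    QuadForm.ev]
  ring

end SymPair

/-- The deformations `a` of the primary flow and `b` of the symmetry `p = v`, `q = u` are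
compatible. -/
structure Compatible (c m : ℝ) (U : Set (ℝ × ℝ)) (a₁ a₂ b₁ b₂ : QuadForm) : Prop where
  smooth_a₁ : a₁.Smooth U
  smooth_a₂ : a₂.Smooth U
  smooth_b₁ : b₁.Smooth U
  smooth_b₂ : b₂.Smooth U
  eqOn : Set.EqOn (fluxOp (primaryFlux c m) (frameVec c m (b₁.ev c m) (b₂.ev c m)))
    (fluxOp (scalingFlux c m) (frameVec c m (a₁.ev c m) (a₂.ev c m))) (jetDomain U)

lemma frameVec_inj (hU : AdmissibleDomain m U) {k₁ k₂ l₁ l₂ : Jet → ℝ} {j : Jet}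
    (hj : j ∈ jetDomain U) (h : frameVec c m k₁ k₂ j = frameVec c m l₁ l₂ j) :
    k₁ j = l₁ j ∧ k₂ j = l₂ j := by
  have e1 := mul_left_cancel₀ (hU.kap_pos hj).ne' (congrArg Prod.fst h)
  have e2 := congrArg Prod.snd h
  simp only [frameVec] at e2
  have hst := sig_add_tau c
  constructor
  · linear_combination e2 - sig c * e1 - (k₁ j - l₁ j) * hst
  · linear_combination e2 + tau c * e1 - (k₂ j - l₂ j) * hst

namespace Compatible

variable {a₁ a₂ b₁ b₂ : QuadForm}

/-- The derivatives of the Riemann invariants take arbitrary values at each point, so compatibility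
is a polynomial identity in them and can be read off by specialisation. -/
lemma opVal_eq (h : Compatible c m U a₁ a₂ b₁ b₂) (hU : AdmissibleDomain m U) {w : ℝ × ℝ}
    (hw : w ∈ U) (R₁ R₂ S₁ S₂ T : ℝ) :
    opVal₁ c m (fun _ => 0) (fun _ => 1) b₁ b₂ w R₁ R₂ S₁ S₂ T
      = opVal₁ c m (fun w => w.2) (fun w => w.1) a₁ a₂ w R₁ R₂ S₁ S₂ T ∧
    opVal₂ c m (fun _ => 0) (fun _ => 1) b₁ b₂ w R₁ R₂ S₁ S₂ T
      = opVal₂ c m (fun w => w.2) (fun w => w.1) a₁ a₂ w R₁ R₂ S₁ S₂ T := by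
  obtain ⟨j, rfl, rfl, rfl, rfl, rfl, h₁, h₂⟩ := hU.exists_jet (c := c) hw R₁ R₂ S₁ S₂ T T
  have hα := symPair_primaryFlux (c := c) hU
  have hβ := symPair_scalingFlux (c := c) hU
  have e := h.eqOn hw
  rw [hα.fluxOp_frameVec hU hU.jetOpen subset_rfl (h.smooth_b₁.jetSmooth hU)
      (h.smooth_b₂.jetSmooth hU) hw,
    hβ.fluxOp_frameVec hU hU.jetOpen subset_rfl (h.smooth_a₁.jetSmooth hU)
      (h.smooth_a₂.jetSmooth hU) hw] at e
  have e' := frameVec_inj hU hw e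
  rwa [hα.fluxOp₁_ev hU h.smooth_b₁ hw, hα.fluxOp₂_ev hU h.smooth_b₂ hw,
    hβ.fluxOp₁_ev hU h.smooth_a₁ hw, hβ.fluxOp₂_ev hU h.smooth_a₂ hw, h₁, h₂] at e'

end Compatible

lemma AdmissibleDomain.along_mu_primary (hU : AdmissibleDomain m U) {w : ℝ × ℝ} (hw : w ∈ U) :
    along (frame₁ c m) (mu₁ c m (fun _ => 0) (fun _ => 1)) w = -(sig c * rho m w) ∧
    along (frame₂ c m) (mu₁ c m (fun _ => 0) (fun _ => 1)) w = sig c * rho m w ∧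
    along (frame₁ c m) (mu₂ c m (fun _ => 0) (fun _ => 1)) w = tau c * rho m w ∧
    along (frame₂ c m) (mu₂ c m (fun _ => 0) (fun _ => 1)) w = -(tau c * rho m w) := by
  have h := symPair_primaryFlux (c := c) hU
  rw [h.d1_mu₁ hU hw, h.d2_mu₁ hU hw, h.d1_mu₂ hU hw, h.d2_mu₂ hU hw, along_const, along_const]
  simp

lemma AdmissibleDomain.along_mu_scaling (hU : AdmissibleDomain m U) {w : ℝ × ℝ} (hw : w ∈ U) :
    along (frame₁ c m) (mu₁ c m (fun w => w.2) (fun w => w.1)) w = 1 - w.1 * (sig c * rho m w) ∧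
    along (frame₂ c m) (mu₁ c m (fun w => w.2) (fun w => w.1)) w = sig c * rho m w * w.1 ∧
    along (frame₁ c m) (mu₂ c m (fun w => w.2) (fun w => w.1)) w = tau c * rho m w * w.1 ∧
    along (frame₂ c m) (mu₂ c m (fun w => w.2) (fun w => w.1)) w =
      1 - w.1 * (tau c * rho m w) := by
  have hk := (hU.kap_pos hw).ne'
  have h := symPair_scalingFlux (c := c) hU
  rw [h.d1_mu₁ hU hw, h.d2_mu₁ hU hw, h.d1_mu₂ hU hw, h.d2_mu₂ hU hw, along_fst, along_fst]
  simp [frame₁, frame₂, neg_div, div_self hk]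

namespace Compatible

variable {a₁ a₂ b₁ b₂ : QuadForm}

/-- Comparison of the coefficients of `T₂` in the first component and of `T₁` in the second; the
factor is the value `q = u` of the test symmetry. -/
lemma offdiag (h : Compatible c m U a₁ a₂ b₁ b₂) (hU : AdmissibleDomain m U) {w : ℝ × ℝ}
    (hw : w ∈ U) : b₁.s₂ w = w.1 * a₁.s₂ w ∧ b₂.s₁ w = w.1 * a₂.s₁ w := by
  have hk := (hU.kap_pos hw).ne'
  have e₁ := (h.opVal_eq hU hw 0 0 0 0 1).1
  have e₂ := (h.opVal_eq hU hw 0 0 0 0 1).2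
  simp only [opVal₁, opVal₂, linVel, quadVel, QuadForm.val] at e₁ e₂
  field_simp at e₁ e₂
  constructor
  · linear_combination e₁
  · linear_combination -e₂

/-- Comparison of the coefficients of `R₁ S₁` and of `R₂ S₂`. Each arises three times, once from the
second derivative of the velocity and twice from the first, which explains the factor `1 / 3` in the
proof. -/
lemma diag (h : Compatible c m U a₁ a₂ b₁ b₂) (hU : AdmissibleDomain m U) {w : ℝ × ℝ}
    (hw : w ∈ U) : b₁.s₁ w * (sig c * rho m w) = (w.1 * (sig c * rho m w) - 1) * a₁.s₁ w ∧
      b₂.s₂ w * (tau c * rho m w) = (w.1 * (tau c * rho m w) - 1) * a₂.s₂ w := by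
  obtain ⟨m₁, m₂, m₃, m₄⟩ := hU.along_mu_primary (c := c) hw
  obtain ⟨n₁, n₂, n₃, n₄⟩ := hU.along_mu_scaling (c := c) hw
  have e₁ := (h.opVal_eq hU hw 1 0 1 0 0).1
  have e₁' := (h.opVal_eq hU hw 1 0 0 0 0).1
  have e₂ := (h.opVal_eq hU hw 0 1 0 1 0).2
  have e₂' := (h.opVal_eq hU hw 0 1 0 0 0).2
  simp only [opVal₁, opVal₂, linVel, quadVel, QuadForm.val, m₁, m₂, m₃, m₄, n₁, n₂, n₃, n₄]
    at e₁ e₁' e₂ e₂'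
  constructor
  · linear_combination -(1 / 3) * (e₁ - e₁')
  · linear_combination -(1 / 3) * (e₂ - e₂')

/-- Obtained from the coefficient of `R₂ S₁` in the first component. It is the equation for `φ₁` in
disguise, since a generator has `s₁ = -2 sig rho φ₁` and `rho` is proportional to `1 / u`. -/
lemma along_diag₁ (h : Compatible c m U a₁ a₂ b₁ b₂) (hU : AdmissibleDomain m U) (hσ : sig c ≠ 0)
    {w : ℝ × ℝ} (hw : w ∈ U) :
    along (frame₂ c m) a₁.s₁ w = kap m w * (-2 * (sig c * rho m w) - 1 / w.1) * a₁.s₁ w := by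
  have hk := (hU.kap_pos hw).ne'
  have h0 := (hU.pos w hw).ne'
  have h1 : 1 - m ≠ 0 := by linarith [hU.one_lt]
  obtain ⟨m₁, m₂, m₃, m₄⟩ := hU.along_mu_primary (c := c) hw
  obtain ⟨n₁, n₂, n₃, n₄⟩ := hU.along_mu_scaling (c := c) hw
  have e₁ := (h.opVal_eq hU hw 0 1 1 0 0).1
  have e₁' := (h.opVal_eq hU hw 0 1 0 0 0).1
  -- The relation `diag` divided by `sig rho`. It holds on all of `U`, hence can be differentiated.
  have hb : Set.EqOn b₁.s₁ (fun w => (w.1 * (1 - 1 / (sig c * (1 - m)))) * a₁.s₁ w) U := by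
    intro i hi
    have h0 := (hU.pos i hi).ne'
    have := (h.diag hU hi).1
    simp only [rho] at this ⊢
    field_simp at this ⊢
    linear_combination this
  have hd : along (frame₂ c m) b₁.s₁ w = w.1 * (1 - 1 / (sig c * (1 - m)))
      * along (frame₂ c m) a₁.s₁ w + kap m w * (1 - 1 / (sig c * (1 - m))) * a₁.s₁ w := by
    rw [along_congr hU.isOpen hb hw, along_mul hU.isOpen
      (contDiff_fst.contDiffOn.mul contDiffOn_const) h.smooth_a₁.s₁ hw,
      along_mul hU.isOpen contDiff_fst.contDiffOn contDiffOn_const hw, along_fst, along_const]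
    simp [frame₂]
  simp only [opVal₁, linVel, quadVel, QuadForm.val, m₁, m₂, m₃, m₄, n₁, n₂, n₃, n₄, hd, hb hw,
    (h.offdiag hU hw).1, (h.offdiag hU hw).2, mul_zero, zero_mul, add_zero, zero_add, mul_one,
      ne_eq,
    OfNat.ofNat_ne_zero, not_false_eq_true, zero_pow, one_pow] at e₁ e₁'
  have e := congrArg₂ (· - ·) e₁ e₁'
  simp only [rho] at e ⊢
  field_simp at e ⊢
  refine mul_left_cancel₀ h0 ?_
  linear_combination -e

lemma along_diag₂ (h : Compatible c m U a₁ a₂ b₁ b₂) (hU : AdmissibleDomain m U) (hτ : tau c ≠ 0)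
    {w : ℝ × ℝ} (hw : w ∈ U) :
    along (frame₁ c m) a₂.s₂ w = -kap m w * (-2 * (tau c * rho m w) - 1 / w.1) * a₂.s₂ w := by
  have hk := (hU.kap_pos hw).ne'
  have h0 := (hU.pos w hw).ne'
  have h1 : 1 - m ≠ 0 := by linarith [hU.one_lt]
  obtain ⟨m₁, m₂, m₃, m₄⟩ := hU.along_mu_primary (c := c) hw
  obtain ⟨n₁, n₂, n₃, n₄⟩ := hU.along_mu_scaling (c := c) hw
  have e₁ := (h.opVal_eq hU hw 1 0 0 1 0).2
  have e₁' := (h.opVal_eq hU hw 1 0 0 0 0).2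
  have hb : Set.EqOn b₂.s₂ (fun w => (w.1 * (1 - 1 / (tau c * (1 - m)))) * a₂.s₂ w) U := by
    intro i hi
    have h0 := (hU.pos i hi).ne'
    have := (h.diag hU hi).2
    simp only [rho] at this ⊢
    field_simp at this ⊢
    linear_combination this
  have hd : along (frame₁ c m) b₂.s₂ w = w.1 * (1 - 1 / (tau c * (1 - m)))
      * along (frame₁ c m) a₂.s₂ w + -kap m w * (1 - 1 / (tau c * (1 - m))) * a₂.s₂ w := by
    rw [along_congr hU.isOpen hb hw, along_mul hU.isOpen
      (contDiff_fst.contDiffOn.mul contDiffOn_const) h.smooth_a₂.s₂ hw,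
      along_mul hU.isOpen contDiff_fst.contDiffOn contDiffOn_const hw, along_fst, along_const]
    simp [frame₁]
  simp only [opVal₂, linVel, quadVel, QuadForm.val, m₁, m₂, m₃, m₄, n₁, n₂, n₃, n₄, hd, hb hw,
    (h.offdiag hU hw).1, (h.offdiag hU hw).2, mul_zero, zero_mul, add_zero, zero_add, mul_one,
      ne_eq,
    OfNat.ofNat_ne_zero, not_false_eq_true, zero_pow, one_pow, sub_zero] at e₁ e₁'
  have e := congrArg₂ (· - ·) e₁ e₁'
  simp only [rho] at e ⊢
  field_simp at e ⊢
  refine mul_left_cancel₀ h0 ?_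
  linear_combination e

/-- A compatible deformation of the primary flow vanishes when its diagonal coefficients do. -/
lemma eq_zero (h : Compatible c m U a₁ a₂ b₁ b₂) (hU : AdmissibleDomain m U) (hσ : sig c ≠ 0)
    (hτ : tau c ≠ 0) (z₁ : ∀ w ∈ U, a₁.s₁ w = 0) (z₂ : ∀ w ∈ U, a₁.s₂ w = 0)
    (z₃ : ∀ w ∈ U, a₁.r₁₁ w = 0) (z₄ : ∀ w ∈ U, a₂.s₁ w = 0) (z₅ : ∀ w ∈ U, a₂.s₂ w = 0)
    (z₆ : ∀ w ∈ U, a₂.r₂₂ w = 0) {w : ℝ × ℝ} (hw : w ∈ U) :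
    a₁.r₁₂ w = 0 ∧ a₁.r₂₂ w = 0 ∧ a₂.r₁₁ w = 0 ∧ a₂.r₁₂ w = 0 := by
  have hr : ∀ i ∈ U, rho m i ≠ 0 := fun i hi =>
    div_ne_zero (by linarith [hU.one_lt]) (hU.pos i hi).ne'
  have y₁ : ∀ i ∈ U, b₁.s₁ i = 0 := fun i hi => by
    have := (h.diag hU hi).1
    rw [z₁ i hi, mul_zero] at this
    exact (mul_eq_zero.1 this).resolve_right (mul_ne_zero hσ (hr i hi))
  have y₂ : ∀ i ∈ U, b₁.s₂ i = 0 := fun i hi => by rw [(h.offdiag hU hi).1, z₂ i hi, mul_zero]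
  have y₄ : ∀ i ∈ U, b₂.s₁ i = 0 := fun i hi => by rw [(h.offdiag hU hi).2, z₄ i hi, mul_zero]
  have y₅ : ∀ i ∈ U, b₂.s₂ i = 0 := fun i hi => by
    have := (h.diag hU hi).2
    rw [z₅ i hi, mul_zero] at this
    exact (mul_eq_zero.1 this).resolve_right (mul_ne_zero hτ (hr i hi))
  have dz : ∀ {f : ℝ × ℝ → ℝ} {X : ℝ × ℝ → ℝ × ℝ} {i : ℝ × ℝ} (_ : ∀ w ∈ U, f w = 0) (_ : i ∈ U),
      along X f i = 0 := fun hf hi =>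
    (along_congr hU.isOpen (g := fun _ => 0) (fun w hw => hf w hw) hi).trans (along_const 0 _)
  have E := fun i (hi : i ∈ U) R₁ R₂ S₁ S₂ => h.opVal_eq hU hi R₁ R₂ S₁ S₂ 0
  -- With the second derivative coefficients gone, the `R₁³` term is `2 r₁₁ ∂₁μ₁`, and `∂₁μ₁ = -sig
  -- rho` is nonzero for the primary flow.
  have y₃ : ∀ i ∈ U, b₁.r₁₁ i = 0 := by
    intro i hi
    obtain ⟨m₁, m₂, m₃, m₄⟩ := hU.along_mu_primary (c := c) hi
    have e := (E i hi 1 0 0 0).1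
    simp only [opVal₁, linVel, quadVel, QuadForm.val, m₁, y₁ i hi, z₁ i hi, z₃ i hi,
      mul_zero, zero_mul, add_zero, zero_add, mul_one, ne_eq,
    OfNat.ofNat_ne_zero, not_false_eq_true, zero_pow, one_pow] at e
    exact (mul_eq_zero.1 (show b₁.r₁₁ i * (sig c * rho m i) = 0 by
      linear_combination -(1 / 2) * e)).resolve_right (mul_ne_zero hσ (hr i hi))
  have y₆ : ∀ i ∈ U, b₂.r₂₂ i = 0 := by
    intro i hi
    obtain ⟨m₁, m₂, m₃, m₄⟩ := hU.along_mu_primary (c := c) hi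
    have e := (E i hi 0 1 0 0).2
    simp only [opVal₂, linVel, quadVel, QuadForm.val, m₄, y₅ i hi, z₅ i hi, z₆ i hi,
      mul_zero, zero_mul, add_zero, zero_add, mul_one, ne_eq,
    OfNat.ofNat_ne_zero, not_false_eq_true, zero_pow, one_pow, sub_zero] at e
    exact (mul_eq_zero.1 (show b₂.r₂₂ i * (tau c * rho m i) = 0 by
      linear_combination -(1 / 2) * e)).resolve_right (mul_ne_zero hτ (hr i hi))
  -- The coefficients of `R₁ S₂`, `R₂ S₂` in the first component and of `R₁ S₁`, `R₂ S₁` in the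
  -- second scale with `q`, which is `1` for one flow and `u` for the other.
  have cross : ∀ i ∈ U, b₁.r₁₂ i = i.1 * a₁.r₁₂ i ∧ b₁.r₂₂ i = i.1 * a₁.r₂₂ i ∧
      b₂.r₁₁ i = i.1 * a₂.r₁₁ i ∧ b₂.r₁₂ i = i.1 * a₂.r₁₂ i := by
    intro i hi
    have hk := (hU.kap_pos hi).ne'
    have f₁ := congrArg₂ (· - ·) (E i hi 1 0 0 1).1 (E i hi 1 0 0 0).1
    have f₂ := congrArg₂ (· - ·) (E i hi 0 1 0 1).1 (E i hi 0 1 0 0).1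
    have f₃ := congrArg₂ (· - ·) (E i hi 1 0 1 0).2 (E i hi 1 0 0 0).2
    have f₄ := congrArg₂ (· - ·) (E i hi 0 1 1 0).2 (E i hi 0 1 0 0).2
    simp only [opVal₁, opVal₂, QuadForm.val, dz y₁ hi, dz y₂ hi, dz y₄ hi, dz y₅ hi, dz z₁ hi,
      dz z₂ hi, dz z₄ hi, dz z₅ hi, y₁ i hi, y₂ i hi, y₄ i hi, y₅ i hi, z₁ i hi, z₂ i hi, z₄ i hi,
      z₅ i hi, mul_zero, zero_mul, add_zero, zero_add, mul_one, one_mul, ne_eq,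
    OfNat.ofNat_ne_zero, not_false_eq_true, zero_pow, one_pow, sub_zero] at f₁ f₂ f₃ f₄
    field_simp at f₁ f₂ f₃ f₄
    refine ⟨?_, ?_, ?_, ?_⟩
    · linear_combination f₁
    · linear_combination (1 / 2) * f₂
    · linear_combination -(1 / 2) * f₃
    · linear_combination -f₄
  have dc : ∀ {f g : ℝ × ℝ → ℝ} (X : ℝ × ℝ → ℝ × ℝ) (_ : ∀ i ∈ U, g i = i.1 * f i)
      (_ : ContDiffOn ℝ ∞ f U), along X g w = w.1 * along X f w + (X w).1 * f w :=
        fun X hfg hf => by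
    rw [along_congr hU.isOpen (fun i hi => hfg i hi) hw,
      along_mul hU.isOpen contDiff_fst.contDiffOn hf hw, along_fst]
  obtain ⟨m₁, m₂, m₃, m₄⟩ := hU.along_mu_primary (c := c) hw
  obtain ⟨n₁, n₂, n₃, n₄⟩ := hU.along_mu_scaling (c := c) hw
  have hk := (hU.kap_pos hw).ne'
  obtain ⟨x₁, x₂, x₃, x₄⟩ := cross w hw
  have d₁ := dc (frame₂ c m) (fun i hi => (cross i hi).2.1) h.smooth_a₁.r₂₂
  have d₂ := dc (frame₁ c m) (fun i hi => (cross i hi).2.2.1) h.smooth_a₂.r₁₁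
  have g₁ := (E w hw 0 1 0 0).1
  have g₂ := (E w hw 1 0 0 0).2
  have g₃ := (E w hw 1 1 0 0).1
  have g₄ := (E w hw 1 (-1) 0 0).1
  have g₅ := (E w hw 1 1 0 0).2
  have g₆ := (E w hw (-1) 1 0 0).2
  simp only [opVal₁, opVal₂, linVel, QuadForm.val, dz y₁ hw, dz y₂ hw, dz y₄ hw, dz y₅ hw,
    dz z₁ hw, dz z₂ hw, dz z₄ hw, dz z₅ hw, y₁ w hw, y₂ w hw, y₄ w hw, y₅ w hw, z₁ w hw, z₂ w hw,
    z₄ w hw, z₅ w hw, y₃ w hw, y₆ w hw, z₃ w hw, z₆ w hw, dz y₃ hw, dz y₆ hw, dz z₃ hw, dz z₆ hw,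
    m₁, m₂, m₃, m₄, n₁, n₂, n₃, n₄, x₁, x₂, x₃, x₄, d₁, d₂, frame₁, frame₂,
    mul_zero, zero_mul, add_zero, zero_add, mul_one, one_mul, ne_eq,
    OfNat.ofNat_ne_zero, not_false_eq_true, zero_pow, one_pow, sub_zero] at g₁ g₂ g₃ g₄ g₅ g₆
  field_simp at g₁ g₂ g₃ g₄ g₅ g₆
  -- The cubic terms finish the argument. In the coefficient of `R₂³`, differentiating `b₁.r₂₂ = u
  -- a₁.r₂₂` yields one extra `a₁.r₂₂`, whereas the constant `1` in `∂₂μ₂` of the test symmetry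
  -- yields two, so `a₁.r₂₂ = 0`. The coefficient of `R₁² R₂`, isolated by `R₂ ↦ -R₂`, gives `a₁.r₁₂
  -- = 0`. The second component is symmetric.
  refine ⟨?_, ?_, ?_, ?_⟩
  · refine mul_left_cancel₀ hk ?_
    linear_combination -(1 / 2) * (g₃ - g₄) + g₁
  · refine mul_left_cancel₀ hk ?_
    linear_combination -g₁
  · refine mul_left_cancel₀ hk ?_
    linear_combination -g₂
  · refine mul_left_cancel₀ hk ?_
    linear_combination -(1 / 2) * (g₅ - g₆) + g₂

end Compatible

end Rigidity

/-! ### Integrable deformations are those with a generator. -/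

section Classification

variable {c m : ℝ} {U : Set (ℝ × ℝ)}

lemma fluxOp_sub (hU : IsOpen U) {β : ℝ × ℝ → ℝ × ℝ} {k l n : Jet → ℝ × ℝ}
    (hk : JetSmooth (jetDomain U) k) (hl : JetSmooth (jetDomain U) l)
    (h : Set.EqOn n (fun i => k i - l i) (jetDomain U)) {j : Jet} (hj : j ∈ jetDomain U) :
    fluxOp β n j = fluxOp β k j - fluxOp β l j := by
  have hΩ := isOpen_jetDomain hU
  have hn : JetSmooth (jetDomain U) n := (hk.sub hl).congr h
  have h' : ∀ X : Jet, jetDir n j X = jetDir k j X - jetDir l j X := fun X => by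
    rw [jetDir_congr hΩ h hj, jetDir_sub hΩ hk hl hj]
  simp only [fluxOp, evol_eq hΩ hn hj, evol_eq hΩ hk hj, evol_eq hΩ hl hj, Dx_eq hΩ hn hj,
    Dx_eq hΩ hk hj, Dx_eq hΩ hl hj, h', map_sub]
  abel

lemma frameVec_sub {k₁ k₂ l₁ l₂ n₁ n₂ : Jet → ℝ} {j : Jet} (h₁ : n₁ j = k₁ j - l₁ j)
    (h₂ : n₂ j = k₂ j - l₂ j) :
    frameVec c m n₁ n₂ j = frameVec c m k₁ k₂ j - frameVec c m l₁ l₂ j := by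
  simp only [frameVec, h₁, h₂, Prod.mk_sub_mk]
  refine Prod.ext ?_ ?_
  · simp only; ring
  · simp only; ring

namespace Compatible

variable {a₁ a₂ b₁ b₂ : QuadForm}

/-- Compatibility is linear, and the fluxes of one generator for two commuting symmetries are
compatible. -/
lemma sub_flux (h : Compatible c m U a₁ a₂ b₁ b₂) (hU : AdmissibleDomain m U) {K : Generator}
    (hK : K.Regular c m U) :
    Compatible c m U (a₁.sub (K.form₁ c m (fun _ => 0) (fun _ => 1)))
      (a₂.sub (K.form₂ c m (fun _ => 0) (fun _ => 1)))
      (b₁.sub (K.form₁ c m (fun w => w.2) (fun w => w.1)))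
      (b₂.sub (K.form₂ c m (fun w => w.2) (fun w => w.1))) := by
  have hα := symPair_primaryFlux (c := c) hU
  have hβ := symPair_scalingFlux (c := c) hU
  have hf := fun {Q₁ Q₂ : QuadForm} (h₁ : Q₁.Smooth U) (h₂ : Q₂.Smooth U) =>
    jetSmooth_frameVec (c := c) hU subset_rfl (h₁.jetSmooth (c := c) hU)
      (h₂.jetSmooth (c := c) hU)
  refine ⟨h.smooth_a₁.sub (hK.smooth_form₁ hU hα), h.smooth_a₂.sub (hK.smooth_form₂ hU hα),
    h.smooth_b₁.sub (hK.smooth_form₁ hU hβ), h.smooth_b₂.sub (hK.smooth_form₂ hU hβ),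
    fun j hj => ?_⟩
  rw [fluxOp_sub hU.isOpen (hf h.smooth_b₁ h.smooth_b₂) (hK.jetSmooth_flux hU hβ)
      (fun i _ => frameVec_sub (QuadForm.ev_sub _ _ i) (QuadForm.ev_sub _ _ i)) hj,
    fluxOp_sub hU.isOpen (hf h.smooth_a₁ h.smooth_a₂) (hK.jetSmooth_flux hU hα)
      (fun i _ => frameVec_sub (QuadForm.ev_sub _ _ i) (QuadForm.ev_sub _ _ i)) hj,
    h.eqOn hj, hK.flux_compatible hU hα hβ (fun i hi => hα.commute hβ hU hi) hj]

/-- A compatible deformation of the primary flow has a generator. -/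
theorem exists_generator (h : Compatible c m U a₁ a₂ b₁ b₂) (hU : AdmissibleDomain m U)
    (hσ : sig c ≠ 0) (hτ : tau c ≠ 0) : ∃ K : Generator, K.Regular c m U ∧
      Set.EqOn (frameVec c m (a₁.ev c m) (a₂.ev c m)) (K.flux c m (fun _ => 0) (fun _ => 1))
        (jetDomain U) := by
  have hα := symPair_primaryFlux (c := c) hU
  have h1 : 1 - m ≠ 0 := by linarith [hU.one_lt]
  have hf₁ := hU.contDiffOn_frame₁ (c := c)
  have hf₂ := hU.contDiffOn_frame₂ (c := c)
  have hk := hU.contDiffOn_kap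
  have hr := hU.contDiffOn_rho
  have hr0 : ∀ i ∈ U, rho m i ≠ 0 := fun i hi => div_ne_zero h1 (hU.pos i hi).ne'
  have s₁ := h.smooth_a₁.s₁
  have s₂ := h.smooth_a₁.s₂
  have s₃ := h.smooth_a₁.r₁₁
  have t₁ := h.smooth_a₂.s₁
  have t₂ := h.smooth_a₂.s₂
  have t₃ := h.smooth_a₂.r₂₂
  have d₁ := contDiffOn_along hU.isOpen hf₁ (contDiffOn_along hU.isOpen hf₁
    (hα.contDiffOn_mu₁ hU))
  have d₂ := contDiffOn_along hU.isOpen hf₂ (contDiffOn_along hU.isOpen hf₂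
    (hα.contDiffOn_mu₂ hU))
  -- Solves `s₁ = 2 φ₁ ∂₁μ₁ = -2 sig rho φ₁` with `rho = (1 - m) / u`; `sig ≠ 0` is used here.
  let φ₁ : ℝ × ℝ → ℝ := fun w => a₁.s₁ w * (w.1 * (1 / (-2 * sig c * (1 - m))))
  let φ₂ : ℝ × ℝ → ℝ := fun w => a₂.s₂ w * (w.1 * (1 / (-2 * tau c * (1 - m))))
  have hφ₁ : ContDiffOn ℝ ∞ φ₁ U := s₁.mul (contDiff_fst.contDiffOn.mul contDiffOn_const)
  have hφ₂ : ContDiffOn ℝ ∞ φ₂ U := t₂.mul (contDiff_fst.contDiffOn.mul contDiffOn_const)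
  -- The `b_ij` are solved from the coefficients `r₁₁`, `s₂` of the first component and `s₁`, `r₂₂`
  -- of the second, in each of which one of them occurs algebraically.
  let K : Generator :=
    { φ₁ := φ₁
      φ₂ := φ₂
      b₁₁ := fun w => (φ₁ w * along (frame₁ c m) (along (frame₁ c m)
        (mu₁ c m (fun _ => 0) (fun _ => 1))) w - a₁.r₁₁ w) / rho m w * (1 / sig c)
      b₁₂ := fun w => kap m w * (a₁.s₂ w - sig c * rho m w * (φ₁ w - φ₂ w))
      b₂₁ := fun w => kap m w * (tau c * rho m w * (φ₂ w - φ₁ w) - a₂.s₁ w)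
      b₂₂ := fun w => (φ₂ w * along (frame₂ c m) (along (frame₂ c m)
        (mu₂ c m (fun _ => 0) (fun _ => 1))) w - a₂.r₂₂ w) / rho m w * (1 / tau c) }
  have hK : K.Regular c m U := by
    refine ⟨hφ₁, hφ₂, ?_, ?_, ?_, ?_, fun w hw => ?_, fun w hw => ?_⟩
    · exact (((hφ₁.mul d₁).sub s₃).div hr hr0).mul contDiffOn_const
    · exact hk.mul (s₂.sub ((contDiffOn_const.mul hr).mul (hφ₁.sub hφ₂)))
    · exact hk.mul (((contDiffOn_const.mul hr).mul (hφ₂.sub hφ₁)).sub t₁)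
    · exact (((hφ₂.mul d₂).sub t₃).div hr hr0).mul contDiffOn_const
    · have h0 := (hU.pos w hw).ne'
      refine (along_mul hU.isOpen s₁ (contDiff_fst.contDiffOn.mul contDiffOn_const) hw).trans ?_
      rw [along_mul hU.isOpen contDiff_fst.contDiffOn contDiffOn_const hw, along_fst, along_const,
        h.along_diag₁ hU hσ hw]
      simp only [K, φ₁, frame₂, rho]
      field_simp
      ring
    · have h0 := (hU.pos w hw).ne'
      refine (along_mul hU.isOpen t₂ (contDiff_fst.contDiffOn.mul contDiffOn_const) hw).trans ?_
      rw [along_mul hU.isOpen contDiff_fst.contDiffOn contDiffOn_const hw, along_fst, along_const,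
        h.along_diag₂ hU hτ hw]
      simp only [K, φ₂, frame₁, rho]
      field_simp
      ring
  refine ⟨K, hK, fun j hj => ?_⟩
  -- The difference is compatible and the coefficients matched by `K` vanish, so `eq_zero` disposes
  -- of the other four.
  have hd := h.sub_flux hU hK
  have key : ∀ w ∈ U, (a₁.s₁ w = (K.form₁ c m (fun _ => 0) (fun _ => 1)).s₁ w ∧
      a₁.s₂ w = (K.form₁ c m (fun _ => 0) (fun _ => 1)).s₂ w ∧
      a₁.r₁₁ w = (K.form₁ c m (fun _ => 0) (fun _ => 1)).r₁₁ w) ∧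
      a₂.s₁ w = (K.form₂ c m (fun _ => 0) (fun _ => 1)).s₁ w ∧
      a₂.s₂ w = (K.form₂ c m (fun _ => 0) (fun _ => 1)).s₂ w ∧
      a₂.r₂₂ w = (K.form₂ c m (fun _ => 0) (fun _ => 1)).r₂₂ w := by
    intro w hw
    obtain ⟨m₁, m₂, m₃, m₄⟩ := hU.along_mu_primary (c := c) hw
    have h0 := (hU.pos w hw).ne'
    have hk0 := (hU.kap_pos hw).ne'
    simp only [Generator.form₁, Generator.form₂, K, m₁, m₄, φ₁, φ₂, rho]
    refine ⟨⟨?_, ?_, ?_⟩, ?_, ?_, ?_⟩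
    all_goals
      field_simp
      try ring
  have z := hd.eq_zero hU hσ hτ (fun w hw => sub_eq_zero.2 (key w hw).1.1)
    (fun w hw => sub_eq_zero.2 (key w hw).1.2.1) (fun w hw => sub_eq_zero.2 (key w hw).1.2.2)
    (fun w hw => sub_eq_zero.2 (key w hw).2.1) (fun w hw => sub_eq_zero.2 (key w hw).2.2.1)
    (fun w hw => sub_eq_zero.2 (key w hw).2.2.2) hj
  simp only [QuadForm.sub, sub_eq_zero] at z
  obtain ⟨z₁, z₂, z₃, z₄⟩ := z
  obtain ⟨⟨k₁, k₂, k₃⟩, k₄, k₅, k₆⟩ := key _ hj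
  simp only [Generator.flux, frameVec, QuadForm.ev, QuadForm.val, z₁, z₂, z₃, z₄, k₁, k₂, k₃, k₄,
    k₅, k₆]

end Compatible

/-- Commutation to second order, in terms of the fluxes. -/
lemma fluxOp_eq_of_commute {β : ℝ × ℝ → ℝ × ℝ} {p q : ℝ × ℝ → ℝ} (hU : AdmissibleDomain m U)
    (hS : SymPair c m U β p q) {a b : SecondOrder} {a₁ a₂ b₁ b₂ : QuadForm}
    (ha₁ : a₁.Smooth U) (ha₂ : a₂.Smooth U) (hb₁ : b₁.Smooth U) (hb₂ : b₂.Smooth U)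
    (ha : Set.EqOn a.toFun (frameVec c m (a₁.ev c m) (a₂.ev c m)) (jetDomain U))
    (hb : Set.EqOn b.toFun (frameVec c m (b₁.ev c m) (b₂.ev c m)) (jetDomain U))
    (h : CommuteToOrderTwo U (deformedLaw (primaryFlux c m) a) (deformedLaw β b)) :
    Set.EqOn (fluxOp (primaryFlux c m) (frameVec c m (b₁.ev c m) (b₂.ev c m)))
      (fluxOp β (frameVec c m (a₁.ev c m) (a₂.ev c m))) (jetDomain U) := by
  have hα := symPair_primaryFlux (c := c) hU
  have sa := jetSmooth_frameVec (c := c) hU subset_rfl (ha₁.jetSmooth (c := c) hU)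
    (ha₂.jetSmooth (c := c) hU)
  have sb := jetSmooth_frameVec (c := c) hU subset_rfl (hb₁.jetSmooth (c := c) hU)
    (hb₂.jetSmooth (c := c) hU)
  have la := sb.fluxOp hU.jetOpen hU.isOpen subset_rfl hα.smooth
  have lb := sa.fluxOp hU.jetOpen hU.isOpen subset_rfl hS.smooth
  have ta := sa.congr ha
  have tb := sb.congr hb
  have eb := fun j (hj : j ∈ jetDomain U) =>
    hα.fluxOp_congr hU hU.jetOpen subset_rfl tb hb hj
  have ea := fun j (hj : j ∈ jetDomain U) =>
    hS.fluxOp_congr hU hU.jetOpen subset_rfl ta ha hj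
  have hD : ∀ j ∈ jetDomain U, Dx (fun i => fluxOp (primaryFlux c m) (frameVec c m (b₁.ev c m)
      (b₂.ev c m)) i - fluxOp β (frameVec c m (a₁.ev c m) (a₂.ev c m)) i) j = 0 := by
    intro j hj
    have h' := h j hj
    simp only [deformedLaw, commutator_deformed hU.isOpen hα.smooth hS.smooth ta tb hj,
      hα.commute hS hU hj, zero_add] at h'
    rw [isLittleO_sq_iff] at h'
    rw [← h']
    exact Dx_eqOn hU.jetOpen (la.sub lb) (fun i hi => by simp only [ea i hi, eb i hi]) hj
  intro j hj
  -- The difference of the two fluxes depends on `w` only, and vanishes at a jet over the same `w`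
  -- at which the relevant derivatives of the Riemann invariants are zero.
  obtain ⟨j', h0, z⟩ := hU.exists_jet (c := c) hj 0 0 0 0 0 0
  have hj' : j' ∈ jetDomain U := by simpa [jetDomain, h0] using hj
  have hz : ∀ {γ : ℝ × ℝ → ℝ × ℝ} {p q : ℝ × ℝ → ℝ} {Q₁ Q₂ : QuadForm}, SymPair c m U γ p q →
      Q₁.Smooth U → Q₂.Smooth U → fluxOp γ (frameVec c m (Q₁.ev c m) (Q₂.ev c m)) j' = 0 := by
    intro γ p q Q₁ Q₂ hγ h₁ h₂
    rw [hγ.fluxOp_frameVec hU hU.jetOpen subset_rfl (h₁.jetSmooth hU) (h₂.jetSmooth hU) hj']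
    simp only [frameVec, hγ.fluxOp₁_ev hU h₁ hj', hγ.fluxOp₂_ev hU h₂ hj', z, opVal₁, opVal₂]
    simp [QuadForm.val]
  have := eq_of_Dx_eq_zero hU.isOpen (la.sub lb) hD hj h0.symm
  rw [hz hα hb₁ hb₂, hz hS ha₁ ha₂, sub_zero] at this
  exact sub_eq_zero.1 this

/-- An integrable deformation of the primary flow has a generator. -/
theorem IsIntegrable.exists_generator (hU : AdmissibleDomain m U) (hσ : sig c ≠ 0)
    (hτ : tau c ≠ 0) {a : SecondOrder} (ha : a.SmoothOn U)
    (h : IsIntegrable U (primaryFlux c m) a) : ∃ K : Generator, K.Regular c m U ∧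
      Set.EqOn a.toFun (K.flux c m (fun _ => 0) (fun _ => 1)) (jetDomain U) := by
  have hβ := symPair_scalingFlux (c := c) hU
  -- Of the whole integrability condition only the extension of the test symmetry is used.
  obtain ⟨b, hb, hcomm⟩ := h.2 _ (hβ.isSymmetry hU)
  obtain ⟨a₁, a₂, ha₁, ha₂, ea⟩ := SecondOrder.exists_frame (c := c) hU ha
  obtain ⟨b₁, b₂, hb₁, hb₂, eb⟩ := SecondOrder.exists_frame (c := c) hU hb
  have hC : Compatible c m U a₁ a₂ b₁ b₂ := ⟨ha₁, ha₂, hb₁, hb₂,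
    fluxOp_eq_of_commute hU hβ ha₁ ha₂ hb₁ hb₂ ea eb hcomm⟩
  obtain ⟨K, hK, e⟩ := hC.exists_generator hU hσ hτ
  exact ⟨K, hK, fun j hj => (ea j hj).trans (e hj)⟩

/-- A deformation of the primary flow with a generator is integrable. -/
theorem Generator.Regular.isIntegrable {K : Generator} (hK : K.Regular c m U)
    (hU : AdmissibleDomain m U) {a : SecondOrder}
    (ha : Set.EqOn a.toFun (K.flux c m (fun _ => 0) (fun _ => 1)) (jetDomain U)) :
    IsIntegrable U (primaryFlux c m) a := by
  have hα := symPair_primaryFlux (c := c) hU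
  refine ⟨⟨_, _, areRiemannInvariants hU⟩, fun β hβ => ?_⟩
  obtain ⟨p, q, hS⟩ := IsSymmetry.exists_symPair hU hβ
  -- The extension of `β` is the flux that the same generator produces for `β`.
  obtain ⟨b, hb, eb⟩ := SecondOrder.exists_of_frame (c := c) hU (hK.smooth_form₁ hU hS)
    (hK.smooth_form₂ hU hS)
  have sa := hK.jetSmooth_flux hU hα
  have sb := hK.jetSmooth_flux hU hS
  refine ⟨b, hb, fun j hj => ?_⟩
  have hz : Set.EqOn (fun i => fluxOp (primaryFlux c m) b.toFun i - fluxOp β a.toFun i)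
      (fun _ => 0) (jetDomain U) := fun i hi => by
    simp only [hα.fluxOp_congr hU hU.jetOpen subset_rfl (sb.congr eb) eb hi,
      hS.fluxOp_congr hU hU.jetOpen subset_rfl (sa.congr ha) ha hi]
    exact sub_eq_zero.2 (hK.flux_compatible hU hα hS (fun i hi => hα.commute hS hU hi) hi)
  simp only [deformedLaw, commutator_deformed hU.isOpen hα.smooth hS.smooth (sa.congr ha)
    (sb.congr eb) hj, hα.commute hS hU hj, zero_add]
  rw [isLittleO_sq_iff, Dx_eqOn hU.jetOpen ((jetSmooth_const _ 0).congr hz) hz hj,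
    Dx_eq hU.jetOpen (jetSmooth_const _ 0) hj]
  simp [jetDir]

end Classification

/-! ### The functional parameters. -/

section Descent

variable {c m : ℝ} {U V : Set (ℝ × ℝ)}

/-- A function that is constant along the level sets of `v - d u ^ m` is a function of it. -/
lemma AdmissibleDomain.exists_descend (hV : AdmissibleDomain m V) (d : ℝ)
    (hc : ∀ s : ℝ, IsPreconnected {p ∈ V | p.2 - d * p.1 ^ m = s}) {ψ : ℝ × ℝ → ℝ}
    (hψ : ContDiffOn ℝ ∞ ψ V) (h0 : ∀ w ∈ V, fderiv ℝ ψ w (1, d * (m * w.1 ^ (m - 1))) = 0) :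
    ∃ F : ℝ → ℝ, ContDiffOn ℝ ∞ F ((fun p : ℝ × ℝ => p.2 - d * p.1 ^ m) '' V) ∧
      ∀ p ∈ V, ψ p = F (p.2 - d * p.1 ^ m) := by
  classical
  let r : ℝ × ℝ → ℝ := fun p => p.2 - d * p.1 ^ m
  have hconst : ∀ p ∈ V, ∀ p' ∈ V, r p = r p' → ψ p = ψ p' := by
    intro p hp p' hp' hr
    -- The level curve parametrised by `u`. The parameters for which it lies in `V` form the
    -- projection of the connected level set, hence an interval, on which `ψ ∘ γ` has zero
    -- derivative.
    let γ : ℝ → ℝ × ℝ := fun u => (u, r p' + d * u ^ m)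
    let I : Set ℝ := Set.Ioi 0 ∩ γ ⁻¹' V
    have hγd : ∀ u > 0, HasDerivAt γ (1, d * (m * u ^ (m - 1))) u := fun u hu =>
      (hasDerivAt_id u).prodMk
        (((Real.hasDerivAt_rpow_const (Or.inl hu.ne')).const_mul d).const_add (r p'))
    have hγ : ContinuousOn γ (Set.Ioi 0) := fun u hu =>
      (hγd u hu).continuousAt.continuousWithinAt
    have hI : IsOpen I := hγ.isOpen_inter_preimage isOpen_Ioi hV.isOpen
    have hIeq : I = Prod.fst '' {q ∈ V | r q = r p'} := by
      ext u
      constructor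
      · rintro ⟨_, hu⟩
        exact ⟨γ u, ⟨hu, by simp [r, γ]⟩, rfl⟩
      · rintro ⟨q, ⟨hq, hqr⟩, rfl⟩
        refine ⟨hV.pos q hq, ?_⟩
        have : γ q.1 = q := Prod.ext rfl (by simp only [γ, ← hqr, r]; ring)
        simpa [this] using hq
    have hpre : IsPreconnected I := hIeq ▸ (hc (r p')).image _ continuous_fst.continuousOn
    have hmem : ∀ q ∈ V, r q = r p' → q.1 ∈ I ∧ ψ (γ q.1) = ψ q := by
      intro q hq hqr
      refine ⟨hIeq ▸ ⟨q, ⟨hq, hqr⟩, rfl⟩, congrArg ψ (Prod.ext rfl ?_)⟩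
      simp only [γ, ← hqr, r]; ring
    have hd : ∀ u ∈ I, HasDerivAt (fun u => ψ (γ u)) 0 u := by
      rintro u ⟨hu, huV⟩
      have h1 := ((hψ.contDiffAt (hV.isOpen.mem_nhds huV)).differentiableAt
        (by simp)).hasFDerivAt.comp_hasDerivAt u (hγd u hu)
      rw [show fderiv ℝ ψ (γ u) (1, d * (m * u ^ (m - 1))) = 0 from h0 _ huV] at h1
      exact h1
    obtain ⟨i₁, e₁⟩ := hmem p hp hr
    obtain ⟨i₂, e₂⟩ := hmem p' hp' rfl
    rw [← e₁, ← e₂]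
    exact hI.is_const_of_deriv_eq_zero hpre
      (fun u hu => (hd u hu).differentiableAt.differentiableWithinAt)
      (fun u hu => (hd u hu).deriv) i₁ i₂
  -- Off the image of `V` the value is immaterial; zero is a default.
  let F : ℝ → ℝ := fun s => if h : ∃ p ∈ V, r p = s then ψ h.choose else 0
  have hF : ∀ p ∈ V, F (r p) = ψ p := by
    intro p hp
    have h : ∃ p' ∈ V, r p' = r p := ⟨p, hp, rfl⟩
    simp only [F, dif_pos h]
    exact hconst _ h.choose_spec.1 _ hp h.choose_spec.2
  refine ⟨F, ?_, fun p hp => (hF p hp).symm⟩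
  rintro _ ⟨p, hp, rfl⟩
  -- A vertical section of `r` through `p`. Near `r p` the function `F` is `ψ ∘ δ`, hence smooth.
  let δ : ℝ → ℝ × ℝ := fun s => (p.1, s + d * p.1 ^ m)
  have hδ : ContDiff ℝ ∞ δ := contDiff_const.prodMk (contDiff_id.add contDiff_const)
  have hδp : δ (r p) = p := Prod.ext rfl (by simp [δ, r])
  have hψp : ContDiffAt ℝ ∞ ψ (δ (r p)) := hδp.symm ▸ hψ.contDiffAt (hV.isOpen.mem_nhds hp)
  have hsm : ContDiffAt ℝ ∞ (fun s => ψ (δ s)) (r p) := hψp.comp (r p) hδ.contDiffAt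
  have hev : F =ᶠ[𝓝 (r p)] fun s => ψ (δ s) := by
    have : δ ⁻¹' V ∈ 𝓝 (r p) := hδ.continuous.continuousAt.preimage_mem_nhds
      (by rw [hδp]; exact hV.isOpen.mem_nhds hp)
    filter_upwards [this] with s hs
    rw [← hF _ hs]
    simp [r, δ]
  exact (hsm.congr_of_eventuallyEq hev).contDiffWithinAt

lemma AdmissibleDomain.exists_descend₁ (hV : AdmissibleDomain m V)
    (hc : ∀ s : ℝ, IsPreconnected {p ∈ V | riemann₁ c m p = s}) {ψ : ℝ × ℝ → ℝ}
    (hψ : ContDiffOn ℝ ∞ ψ V) (h0 : ∀ w ∈ V, along (frame₂ c m) ψ w = 0) :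
    ∃ F : ℝ → ℝ, ContDiffOn ℝ ∞ F (riemann₁ c m '' V) ∧ ∀ p ∈ V, ψ p = F (riemann₁ c m p) := by
  refine hV.exists_descend (c + 2) hc hψ fun w hw => ?_
  have hk := (hV.kap_pos hw).ne'
  have hm := hV.m_pos.ne'
  have : ((1, (c + 2) * (m * w.1 ^ (m - 1))) : ℝ × ℝ) = (1 / kap m w) • frame₂ c m w := by
    simp only [frame₂, hV.rpow_m_sub_one hw, sig]
    refine Prod.ext ?_ ?_
    · simp [hk]
    · simp; field_simp; ring
  rw [this, map_smul, show fderiv ℝ ψ w (frame₂ c m w) = 0 from h0 w hw, smul_zero]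

lemma AdmissibleDomain.exists_descend₂ (hV : AdmissibleDomain m V)
    (hc : ∀ s : ℝ, IsPreconnected {p ∈ V | riemann₂ c m p = s}) {ψ : ℝ × ℝ → ℝ}
    (hψ : ContDiffOn ℝ ∞ ψ V) (h0 : ∀ w ∈ V, along (frame₁ c m) ψ w = 0) :
    ∃ F : ℝ → ℝ, ContDiffOn ℝ ∞ F (riemann₂ c m '' V) ∧ ∀ p ∈ V, ψ p = F (riemann₂ c m p) := by
  refine hV.exists_descend (c - 2) hc hψ fun w hw => ?_
  have hk := (hV.kap_pos hw).ne'
  have hm := hV.m_pos.ne'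
  have : ((1, (c - 2) * (m * w.1 ^ (m - 1))) : ℝ × ℝ) = (-1 / kap m w) • frame₁ c m w := by
    simp only [frame₁, hV.rpow_m_sub_one hw, tau]
    refine Prod.ext ?_ ?_
    · simp; field_simp
    · simp; field_simp; ring
  rw [this, map_smul, show fderiv ℝ ψ w (frame₁ c m w) = 0 from h0 w hw, smul_zero]

/-- The functional parameters of a pair of solutions of the equations on `φ₁`, `φ₂`. -/
lemma AdmissibleDomain.exists_parameters (hV : AdmissibleDomain m V) {C₁ C₂ : ℝ} (hC₁ : C₁ ≠ 0)
    (hC₂ : C₂ ≠ 0)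
    (hc₁ : ∀ s : ℝ, IsPreconnected {p ∈ V | riemann₁ c m p = s})
    (hc₂ : ∀ s : ℝ, IsPreconnected {p ∈ V | riemann₂ c m p = s}) {φ₁ φ₂ : ℝ × ℝ → ℝ}
    (h₁ : ContDiffOn ℝ ∞ φ₁ V) (h₂ : ContDiffOn ℝ ∞ φ₂ V)
    (e₁ : ∀ w ∈ V, along (frame₂ c m) φ₁ w = -2 * sig c * rho m w * kap m w * φ₁ w)
    (e₂ : ∀ w ∈ V, along (frame₁ c m) φ₂ w = 2 * tau c * rho m w * kap m w * φ₂ w) :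
    ∃ F₁ F₂ : ℝ → ℝ, ContDiffOn ℝ ∞ F₁ (riemann₁ c m '' V) ∧
      ContDiffOn ℝ ∞ F₂ (riemann₂ c m '' V) ∧
      ∀ p ∈ V, φ₁ p = C₁ * p.1 ^ (2 * sig c * (m - 1)) * F₁ (riemann₁ c m p) ∧
        φ₂ p = C₂ * p.1 ^ (2 * tau c * (m - 1)) * F₂ (riemann₂ c m p) := by
  have hpow := hV.contDiffOn_rpow
  -- The factor `u^(-s)` is an integrating factor: `∂₂u = kap`, `∂₁u = -kap` and `rho = (1 - m) / u`
  -- turn the equations into `∂ log φ = s ∂ log u`, with `s = 2 sig (m - 1)` for `φ₁` and `s = 2 tau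
  -- (m - 1)` for `φ₂`.
  have d : ∀ (X : ℝ × ℝ → ℝ × ℝ) (φ : ℝ × ℝ → ℝ) (C s : ℝ) (w : ℝ × ℝ), ContDiffOn ℝ ∞ φ V →
      w ∈ V → along X (fun w => C * (w.1 ^ (-s) * φ w)) w =
        C * (w.1 ^ (-s) * (along X φ w - s / w.1 * (X w).1 * φ w)) := by
    intro X φ C s w hφ hw
    rw [along_mul hV.isOpen contDiffOn_const ((hpow _).mul hφ) hw, along_const,
      along_mul hV.isOpen (hpow _) hφ hw, hV.along_rpow _ hw]
    ring
  obtain ⟨F₁, hF₁, g₁⟩ := hV.exists_descend₁ hc₁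
    (ψ := fun w => 1 / C₁ * (w.1 ^ (-(2 * sig c * (m - 1))) * φ₁ w))
    (contDiffOn_const.mul ((hpow _).mul h₁)) fun w hw => by
      have h0 := (hV.pos w hw).ne'
      rw [d _ _ _ _ _ h₁ hw, e₁ w hw]
      simp only [frame₂, rho]; ring
  obtain ⟨F₂, hF₂, g₂⟩ := hV.exists_descend₂ hc₂
    (ψ := fun w => 1 / C₂ * (w.1 ^ (-(2 * tau c * (m - 1))) * φ₂ w))
    (contDiffOn_const.mul ((hpow _).mul h₂)) fun w hw => by
      have h0 := (hV.pos w hw).ne'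
      rw [d _ _ _ _ _ h₂ hw, e₂ w hw]
      simp only [frame₁, rho]; ring
  refine ⟨F₁, F₂, hF₁, hF₂, fun p hp => ?_⟩
  have h0 := hV.pos p hp
  have k₁ := (Real.rpow_pos_of_pos h0 (2 * sig c * (m - 1))).ne'
  have k₂ := (Real.rpow_pos_of_pos h0 (2 * tau c * (m - 1))).ne'
  rw [← g₁ p hp, ← g₂ p hp, Real.rpow_neg h0.le, Real.rpow_neg h0.le]
  constructor <;> field_simp

/-- The frame vectors are the coordinate fields of `(r₁, r₂)`. In the proof the terms from
differentiating `kap` agree on the two sides. -/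
lemma AdmissibleDomain.along_comm (hU : AdmissibleDomain m U) {f : ℝ × ℝ → ℝ}
    (hf : ContDiffOn ℝ ∞ f U) {w : ℝ × ℝ} (hw : w ∈ U) :
    along (frame₁ c m) (along (frame₂ c m) f) w = along (frame₂ c m) (along (frame₁ c m) f) w := by
  have hd : DifferentiableAt ℝ (fderiv ℝ f) w :=
    ((hf.fderiv_of_isOpen hU.isOpen (m := ∞) (by simp)).contDiffAt
      (hU.isOpen.mem_nhds hw)).differentiableAt (by simp)
  have hsym : IsSymmSndFDerivAt ℝ f w := (hf.contDiffAt (hU.isOpen.mem_nhds hw)).isSymmSndFDerivAt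
    (by simpa using WithTop.coe_le_coe.2 (le_top : (2 : ℕ∞) ≤ ⊤))
  have h1 : ∀ X y, along X (along (fun _ => y) f) w = fderiv ℝ (fderiv ℝ f) w (X w) y := by
    intro X y
    have := hd.hasFDerivAt.clm_apply (hasFDerivAt_const y w)
    rw [along, show along (fun _ => y) f = fun w => fderiv ℝ f w y from rfl, this.fderiv]
    simp
  have h2 := fun y : ℝ × ℝ => contDiffOn_along hU.isOpen (contDiffOn_const (c := y)) hf
  have hk := hU.contDiffOn_kap
  have e₁ : along (frame₁ c m) (along (frame₂ c m) f) w =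
      kap m w * fderiv ℝ (fderiv ℝ f) w (frame₁ c m w) (1, 0)
        + rho m w * kap m w * -kap m w * along (fun _ => (1, 0)) f w
        + sig c * fderiv ℝ (fderiv ℝ f) w (frame₁ c m w) (0, 1) := by
    rw [along_congr hU.isOpen (fun i _ => along_frame₂ (c := c) i) hw,
      along_add hU.isOpen (hk.mul (h2 _)) (contDiffOn_const.mul (h2 _)) hw,
      along_mul hU.isOpen hk (h2 _) hw, along_mul hU.isOpen contDiffOn_const (h2 _) hw,
      along_const, hU.along_kap hw, h1, h1]
    simp [frame₁]
  have e₂ : along (frame₂ c m) (along (frame₁ c m) f) w =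
      -kap m w * fderiv ℝ (fderiv ℝ f) w (frame₂ c m w) (1, 0)
        - rho m w * kap m w * kap m w * along (fun _ => (1, 0)) f w
        + tau c * fderiv ℝ (fderiv ℝ f) w (frame₂ c m w) (0, 1) := by
    rw [along_congr hU.isOpen (g := fun w => kap m w * (-1 * along (fun _ => (1, 0)) f w)
        + tau c * along (fun _ => (0, 1)) f w)
        (fun i _ => (along_frame₁ (c := c) i).trans (by ring)) hw,
      along_add hU.isOpen (hk.mul (contDiffOn_const.mul (h2 _))) (contDiffOn_const.mul (h2 _)) hw,
      along_mul hU.isOpen hk (contDiffOn_const.mul (h2 _)) hw,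
      along_mul hU.isOpen contDiffOn_const (h2 _) hw,
      along_mul hU.isOpen contDiffOn_const (h2 _) hw,
      along_const, along_const, hU.along_kap hw, h1, h1]
    simp only [frame₂]; ring
  have hx : ∀ x y : ℝ, ((x, y) : ℝ × ℝ) = x • ((1, 0) : ℝ × ℝ) + y • ((0, 1) : ℝ × ℝ) := by
    intro x y; simp
  rw [e₁, e₂, frame₁, frame₂, hx, hx (kap m w)]
  simp only [map_add, map_smul, add_apply, smul_apply,
    smul_eq_mul, hsym.eq (0, 1) (1, 0)]
  ring

end Descent

/-! ### First and second derivatives of the solutions `φ₁`, `φ₂`. -/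

section Partials

variable {c m : ℝ} {U : Set (ℝ × ℝ)}

/-- `f` is differentiable at `w` with partial derivatives `x`, `y`. -/
def HasPartials (f : ℝ × ℝ → ℝ) (w : ℝ × ℝ) (x y : ℝ) : Prop :=
  HasFDerivAt f (x • ContinuousLinearMap.fst ℝ ℝ ℝ + y • ContinuousLinearMap.snd ℝ ℝ ℝ) w

namespace HasPartials

variable {f g : ℝ × ℝ → ℝ} {w : ℝ × ℝ} {x y x' y' : ℝ}

lemma du_eq (h : HasPartials f w x y) : du f w = x := by
  rw [du, HasFDerivAt.fderiv h]; simp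

lemma dv_eq (h : HasPartials f w x y) : dv f w = y := by
  rw [dv, HasFDerivAt.fderiv h]; simp

lemma sub (h : HasPartials f w x y) (h' : HasPartials g w x' y') :
    HasPartials (fun p => f p - g p) w (x - x') (y - y') := by
  refine (HasFDerivAt.fun_sub h h').congr_fderiv ?_
  module

lemma mul (h : HasPartials f w x y) (h' : HasPartials g w x' y') :
    HasPartials (fun p => f p * g p) w (f w * x' + x * g w) (f w * y' + y * g w) := by
  refine (HasFDerivAt.fun_mul h h').congr_fderiv ?_
  module

lemma const_mul (a : ℝ) (h : HasPartials f w x y) :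
    HasPartials (fun p => a * f p) w (a * x) (a * y) := by
  refine (HasFDerivAt.const_mul h a).congr_fderiv ?_
  module

lemma congr {U : Set (ℝ × ℝ)} (hU : IsOpen U) (hw : w ∈ U) (h : HasPartials f w x y)
    (e : Set.EqOn g f U) : HasPartials g w x y :=
  HasFDerivAt.congr_of_eventuallyEq h (Filter.eventuallyEq_of_mem (hU.mem_nhds hw) e)

end HasPartials

lemma hasPartials_rpow (s : ℝ) {w : ℝ × ℝ} (h0 : 0 < w.1) :
    HasPartials (fun p => p.1 ^ s) w (s * w.1 ^ s / w.1) 0 := by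
  refine (hasFDerivAt_rpow_fst h0 s).congr_fderiv ?_
  rw [Real.rpow_sub_one h0.ne', zero_smul, add_zero, mul_div_assoc]

lemma hasPartials_of_contDiffOn {f : ℝ × ℝ → ℝ} (hU : IsOpen U) (hf : ContDiffOn ℝ ∞ f U)
    {w : ℝ × ℝ} (hw : w ∈ U) : HasPartials f w (du f w) (dv f w) := by
  refine ((hf.contDiffAt (hU.mem_nhds hw)).differentiableAt (by simp)).hasFDerivAt.congr_fderiv ?_
  ext <;> simp [du, dv]

namespace AdmissibleDomain

variable (hU : AdmissibleDomain m U)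
include hU

lemma contDiffOn_du {f : ℝ × ℝ → ℝ} (hf : ContDiffOn ℝ ∞ f U) : ContDiffOn ℝ ∞ (du f) U :=
  contDiffOn_along hU.isOpen (X := fun _ => (1, 0)) contDiffOn_const hf

lemma contDiffOn_dv {f : ℝ × ℝ → ℝ} (hf : ContDiffOn ℝ ∞ f U) : ContDiffOn ℝ ∞ (dv f) U :=
  contDiffOn_along hU.isOpen (X := fun _ => (0, 1)) contDiffOn_const hf

lemma kap_eq {w : ℝ × ℝ} (hw : w ∈ U) : kap m w = w.1 / (4 * m * w.1 ^ m) := by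
  rw [kap, Real.rpow_sub (hU.pos w hw), Real.rpow_one]; ring

omit hU in
lemma dv_eq_along {f : ℝ × ℝ → ℝ} (w : ℝ × ℝ) :
    dv f w = along (frame₁ c m) f w + along (frame₂ c m) f w := by
  rw [along_frame₁, along_frame₂, show dv f w = along (fun _ => (0, 1)) f w from rfl]
  linear_combination (-along (fun _ => (0, 1)) f w) * sig_add_tau c

lemma du_eq_along {f : ℝ × ℝ → ℝ} {w : ℝ × ℝ} (hw : w ∈ U) :
    du f w = (tau c * along (frame₂ c m) f w - sig c * along (frame₁ c m) f w)
      * (4 * m * w.1 ^ m / w.1) := by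
  have h0 := hU.pos w hw
  have hk := (hU.kap_pos hw).ne'
  have hm := hU.m_pos.ne'
  have hY := (Real.rpow_pos_of_pos h0 m).ne'
  have e : 4 * m * w.1 ^ m / w.1 = 1 / kap m w := by rw [hU.kap_eq hw]; field_simp
  rw [e, along_frame₁, along_frame₂, show du f w = along (fun _ => (1, 0)) f w from rfl]
  field_simp
  linear_combination (-along (fun _ => (1, 0)) f w * kap m w) * sig_add_tau c

/-- The partial derivatives of a solution of the equation on `φ₁`. -/
lemma solution_partials₁ {φ : ℝ × ℝ → ℝ} (hφ : ContDiffOn ℝ ∞ φ U)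
    (e : ∀ w ∈ U, along (frame₂ c m) φ w = -2 * sig c * rho m w * kap m w * φ w) {w : ℝ × ℝ}
    (hw : w ∈ U) {k y A A₁ A₂ pu pv Au Av : ℝ} (hk : k = sig c * (1 - m) / (2 * m))
    (hy : y = w.1 ^ m) (hA : A = along (frame₁ c m) φ w)
    (hA₁ : A₁ = along (frame₁ c m) (along (frame₁ c m) φ) w)
    (hA₂ : A₂ = -(k / y) * (φ w / (4 * y) + A))
    (hpv : pv = A - k / y * φ w)
    (hpu : pu = -2 * sig c * tau c * (1 - m) / w.1 * φ w - 4 * m * sig c * (y / w.1) * A)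
    (hAv : Av = A₁ + A₂) (hAu : Au = (tau c * A₂ - sig c * A₁) * (4 * m * y / w.1)) :
    along (frame₂ c m) (along (frame₁ c m) φ) w = A₂ ∧ HasPartials φ w pu pv ∧
    HasPartials (dv φ) w (Au + k * m / (w.1 * y) * φ w - k / y * pu) (Av - k / y * pv) ∧
    du (du φ) w = 2 * sig c * tau c * (1 - m) / w.1 ^ 2 * φ w
      - 2 * sig c * tau c * (1 - m) / w.1 * pu
      - 4 * m * sig c * (m - 1) * y / w.1 ^ 2 * A - 4 * m * sig c * y / w.1 * Au := by
  have h0 := hU.pos w hw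
  have h0' := h0.ne'
  have hm := hU.m_pos.ne'
  have hf₁ := hU.contDiffOn_frame₁ (c := c)
  have hdA := contDiffOn_along hU.isOpen hf₁ hφ
  have hY := (Real.rpow_pos_of_pos h0 m).ne'
  -- The frame vectors commute, so the mixed derivative is `∂₁` of the equation satisfied by `∂₂φ`.
  -- This leaves `φ`, `∂₁φ` and `∂₁∂₁φ` as the only independent data.
  have e₂ : along (frame₂ c m) (along (frame₁ c m) φ) w = A₂ := by
    rw [← hU.along_comm hφ hw, along_congr hU.isOpen
      (g := fun w => -2 * sig c * (rho m w * kap m w) * φ w)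
      (fun i hi => (e i hi).trans (by ring)) hw,
      along_mul hU.isOpen (contDiffOn_const.mul (hU.contDiffOn_rho.mul hU.contDiffOn_kap)) hφ hw,
      along_mul hU.isOpen contDiffOn_const (hU.contDiffOn_rho.mul hU.contDiffOn_kap) hw,
      along_mul hU.isOpen hU.contDiffOn_rho hU.contDiffOn_kap hw, along_const, hU.along_rho hw,
      hU.along_kap hw, hA₂, hk, hy, hA]
    simp only [frame₁, rho, hU.kap_eq hw]
    field_simp
    ring
  have ev : Set.EqOn (dv φ) (fun w => along (frame₁ c m) φ w - k * (w.1 ^ (-m) * φ w)) U := by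
    intro i hi
    have h0 := hU.pos i hi
    have h0' := h0.ne'
    have hY := (Real.rpow_pos_of_pos h0 m).ne'
    simp only [dv_eq_along (c := c) (m := m), e i hi, rho, hU.kap_eq hi, hk, Real.rpow_neg h0.le]
    field_simp
    ring
  have eu : Set.EqOn (du φ) (fun w => -2 * sig c * tau c * (1 - m) * (w.1 ^ (-1 : ℝ) * φ w)
      - 4 * m * sig c * (w.1 ^ (m - 1) * along (frame₁ c m) φ w)) U := by
    intro i hi
    have h0 := hU.pos i hi
    have h0' := h0.ne'
    have hY := (Real.rpow_pos_of_pos h0 m).ne'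
    simp only [hU.du_eq_along (c := c) hi, e i hi, rho, hU.kap_eq hi, Real.rpow_neg_one,
      Real.rpow_sub_one h0']
    field_simp
  have pφ : HasPartials φ w pu pv := by
    have h := hasPartials_of_contDiffOn hU.isOpen hφ hw
    rw [eu hw, ev hw] at h
    convert h using 1
    · rw [hpu, hy, hA]
      simp only [Real.rpow_neg_one, Real.rpow_sub_one h0']
      field_simp
    · rw [hpv, hA, hy]
      simp only [Real.rpow_neg h0.le]
      field_simp
  have pA : HasPartials (along (frame₁ c m) φ) w Au Av := by
    have h := hasPartials_of_contDiffOn hU.isOpen hdA hw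
    rwa [hU.du_eq_along (c := c) hw, dv_eq_along (c := c) (m := m), e₂, ← hA₁, ← hy, ← hAu,
      ← hAv] at h
  refine ⟨e₂, pφ, ?_, ?_⟩
  · convert (pA.sub (((hasPartials_rpow (-m) h0).mul pφ).const_mul k)).congr hU.isOpen hw ev using 1
    · rw [Real.rpow_neg h0.le, ← hy]
      field_simp
      ring
    · rw [Real.rpow_neg h0.le, ← hy]
      ring
  · rw [(((((hasPartials_rpow (-1) h0).mul pφ).const_mul _).sub
      (((hasPartials_rpow (m - 1) h0).mul pA).const_mul _)).congr hU.isOpen hw eu).du_eq,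
      Real.rpow_neg_one, Real.rpow_sub_one h0', ← hy, ← hA]
    field_simp
    ring

/-- The partial derivatives of a solution of the equation on `φ₂`. -/
lemma solution_partials₂ {φ : ℝ × ℝ → ℝ} (hφ : ContDiffOn ℝ ∞ φ U)
    (e : ∀ w ∈ U, along (frame₁ c m) φ w = 2 * tau c * rho m w * kap m w * φ w) {w : ℝ × ℝ}
    (hw : w ∈ U) {k y A A₁ A₂ pu pv Au Av : ℝ} (hk : k = tau c * (1 - m) / (2 * m))
    (hy : y = w.1 ^ m) (hA : A = along (frame₂ c m) φ w)
    (hA₂ : A₂ = along (frame₂ c m) (along (frame₂ c m) φ) w)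
    (hA₁ : A₁ = k / y * (-(φ w / (4 * y)) + A))
    (hpv : pv = A + k / y * φ w)
    (hpu : pu = -2 * sig c * tau c * (1 - m) / w.1 * φ w + 4 * m * tau c * (y / w.1) * A)
    (hAv : Av = A₁ + A₂) (hAu : Au = (tau c * A₂ - sig c * A₁) * (4 * m * y / w.1)) :
    along (frame₁ c m) (along (frame₂ c m) φ) w = A₁ ∧ HasPartials φ w pu pv ∧
    HasPartials (dv φ) w (Au - k * m / (w.1 * y) * φ w + k / y * pu) (Av + k / y * pv) ∧
    du (du φ) w = 2 * sig c * tau c * (1 - m) / w.1 ^ 2 * φ w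
      - 2 * sig c * tau c * (1 - m) / w.1 * pu
      + 4 * m * tau c * (m - 1) * y / w.1 ^ 2 * A + 4 * m * tau c * y / w.1 * Au := by
  have h0 := hU.pos w hw
  have h0' := h0.ne'
  have hm := hU.m_pos.ne'
  have hf₂ := hU.contDiffOn_frame₂ (c := c)
  have hdA := contDiffOn_along hU.isOpen hf₂ hφ
  have hY := (Real.rpow_pos_of_pos h0 m).ne'
  have e₁ : along (frame₁ c m) (along (frame₂ c m) φ) w = A₁ := by
    rw [hU.along_comm hφ hw, along_congr hU.isOpen
      (g := fun w => 2 * tau c * (rho m w * kap m w) * φ w)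
      (fun i hi => (e i hi).trans (by ring)) hw,
      along_mul hU.isOpen (contDiffOn_const.mul (hU.contDiffOn_rho.mul hU.contDiffOn_kap)) hφ hw,
      along_mul hU.isOpen contDiffOn_const (hU.contDiffOn_rho.mul hU.contDiffOn_kap) hw,
      along_mul hU.isOpen hU.contDiffOn_rho hU.contDiffOn_kap hw, along_const, hU.along_rho hw,
      hU.along_kap hw, hA₁, hk, hy, hA]
    simp only [frame₂, rho, hU.kap_eq hw]
    field_simp
    ring
  have ev : Set.EqOn (dv φ) (fun w => along (frame₂ c m) φ w - (-k) * (w.1 ^ (-m) * φ w)) U := by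
    intro i hi
    have h0 := hU.pos i hi
    have h0' := h0.ne'
    have hY := (Real.rpow_pos_of_pos h0 m).ne'
    simp only [dv_eq_along (c := c) (m := m), e i hi, rho, hU.kap_eq hi, hk, Real.rpow_neg h0.le]
    field_simp
    ring
  have eu : Set.EqOn (du φ) (fun w => -2 * sig c * tau c * (1 - m) * (w.1 ^ (-1 : ℝ) * φ w)
      - (-4) * m * tau c * (w.1 ^ (m - 1) * along (frame₂ c m) φ w)) U := by
    intro i hi
    have h0 := hU.pos i hi
    have h0' := h0.ne'
    have hY := (Real.rpow_pos_of_pos h0 m).ne'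
    simp only [hU.du_eq_along (c := c) hi, e i hi, rho, hU.kap_eq hi, Real.rpow_neg_one,
      Real.rpow_sub_one h0']
    field_simp
    ring
  have pφ : HasPartials φ w pu pv := by
    have h := hasPartials_of_contDiffOn hU.isOpen hφ hw
    rw [eu hw, ev hw] at h
    convert h using 1
    · rw [hpu, hy, hA]
      simp only [Real.rpow_neg_one, Real.rpow_sub_one h0']
      field_simp
      ring
    · rw [hpv, hA, hy]
      simp only [Real.rpow_neg h0.le]
      field_simp
      ring
  have pA : HasPartials (along (frame₂ c m) φ) w Au Av := by
    have h := hasPartials_of_contDiffOn hU.isOpen hdA hw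
    rwa [hU.du_eq_along (c := c) hw, dv_eq_along (c := c) (m := m), e₁, ← hA₂, ← hy, ← hAu,
      ← hAv] at h
  refine ⟨e₁, pφ, ?_, ?_⟩
  · convert (pA.sub (((hasPartials_rpow (-m) h0).mul pφ).const_mul (-k))).congr hU.isOpen hw ev
      using 1
    · rw [Real.rpow_neg h0.le, ← hy]
      field_simp
      ring
    · rw [Real.rpow_neg h0.le, ← hy]
      ring
  · rw [(((((hasPartials_rpow (-1) h0).mul pφ).const_mul _).sub
      (((hasPartials_rpow (m - 1) h0).mul pA).const_mul _)).congr hU.isOpen hw eu).du_eq,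
      Real.rpow_neg_one, Real.rpow_sub_one h0', ← hy, ← hA]
    field_simp
    ring

end AdmissibleDomain

end Partials

/-! ### The coefficients of the normal form as functions of the data of `φ₁`, `φ₂`. -/

section SecondPartials

variable {c m : ℝ} {U : Set (ℝ × ℝ)}

/-- The values of the partial derivatives of a function up to the second order. -/
structure Partials where
  val : ℝ
  u : ℝ
  v : ℝ
  vv : ℝ
  uv : ℝ
  uu : ℝ

/-- The partial derivatives of `f` at `w` have the values `J`. -/
structure HasSecondPartials (f : ℝ × ℝ → ℝ) (w : ℝ × ℝ) (J : Partials) : Prop where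
  val : f w = J.val
  u : du f w = J.u
  v : dv f w = J.v
  vv : dv (dv f) w = J.vv
  uv : du (dv f) w = J.uv
  uu : du (du f) w = J.uu

namespace HasSecondPartials

variable {f g : ℝ × ℝ → ℝ} {w : ℝ × ℝ} {J J' : Partials}

lemma congr (hU : IsOpen U) (hw : w ∈ U) (h : HasSecondPartials f w J) (e : Set.EqOn g f U) :
    HasSecondPartials g w J := by
  have e₁ : Set.EqOn (du g) (du f) U := fun i hi => along_congr hU (X := fun _ => (1, 0)) e hi
  have e₂ : Set.EqOn (dv g) (dv f) U := fun i hi => along_congr hU (X := fun _ => (0, 1)) e hi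
  exact ⟨(e hw).trans h.val, (e₁ hw).trans h.u, (e₂ hw).trans h.v,
    (along_congr hU (X := fun _ => (0, 1)) e₂ hw).trans h.vv,
    (along_congr hU (X := fun _ => (1, 0)) e₂ hw).trans h.uv,
    (along_congr hU (X := fun _ => (1, 0)) e₁ hw).trans h.uu⟩

/-- The partial derivatives of `u ^ s (a f - b g)`. -/
lemma rpow_mul_sub (hU : AdmissibleDomain m U) (hw : w ∈ U) (hf : ContDiffOn ℝ ∞ f U)
    (hg : ContDiffOn ℝ ∞ g U) (h : HasSecondPartials f w J) (h' : HasSecondPartials g w J')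
    (s a b : ℝ) : HasSecondPartials (fun p => p.1 ^ s * (a * f p - b * g p)) w
      { val := w.1 ^ s * (a * J.val - b * J'.val)
        u := w.1 ^ s * (a * J.u - b * J'.u) + s * w.1 ^ s / w.1 * (a * J.val - b * J'.val)
        v := w.1 ^ s * (a * J.v - b * J'.v)
        vv := w.1 ^ s * (a * J.vv - b * J'.vv)
        uv := w.1 ^ s * (a * J.uv - b * J'.uv) + s * w.1 ^ s / w.1 * (a * J.v - b * J'.v)
        uu := w.1 ^ s * (a * J.uu - b * J'.uu) + 2 * (s * w.1 ^ s / w.1 * (a * J.u - b * J'.u))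
          + s * (s - 1) * w.1 ^ s / w.1 ^ 2 * (a * J.val - b * J'.val) } := by
  have h0 := hU.pos w hw
  have h0' := h0.ne'
  have key : ∀ {f g : ℝ × ℝ → ℝ} (_ : ContDiffOn ℝ ∞ f U) (_ : ContDiffOn ℝ ∞ g U) (s : ℝ),
      ∀ i ∈ U, HasPartials (fun p => p.1 ^ s * (a * f p - b * g p)) i
        (i.1 ^ s * (a * du f i - b * du g i) + s * i.1 ^ s / i.1 * (a * f i - b * g i))
        (i.1 ^ s * (a * dv f i - b * dv g i)) := by
    intro f g hf hg s i hi
    have hp := (hasPartials_rpow s (hU.pos i hi)).mul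
      (((hasPartials_of_contDiffOn hU.isOpen hf hi).const_mul a).sub
        ((hasPartials_of_contDiffOn hU.isOpen hg hi).const_mul b))
    simpa using hp
  have k := key hf hg s
  have kv := key (hU.contDiffOn_dv hf) (hU.contDiffOn_dv hg) s w hw
  have ku := key (hU.contDiffOn_du hf) (hU.contDiffOn_du hg) s w hw
  have k' := (key hf hg (s - 1) w hw).const_mul s
  have ev : Set.EqOn (dv fun p => p.1 ^ s * (a * f p - b * g p))
      (fun p => p.1 ^ s * (a * dv f p - b * dv g p)) U := fun i hi => (k i hi).dv_eq
  have eu : Set.EqOn (du fun p => p.1 ^ s * (a * f p - b * g p))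
      (fun p => p.1 ^ s * (a * du f p - b * du g p)
        - -1 * (s * (p.1 ^ (s - 1) * (a * f p - b * g p)))) U := fun i hi => by
    refine (k i hi).du_eq.trans ?_
    simp only [Real.rpow_sub_one (hU.pos i hi).ne']
    ring
  constructor
  · simp only [h.val, h'.val]
  · simp only [(k w hw).du_eq, h.val, h'.val, h.u, h'.u]
  · simp only [(k w hw).dv_eq, h.v, h'.v]
  · simp only [(kv.congr hU.isOpen hw ev).dv_eq, h.vv, h'.vv]
  · simp only [(kv.congr hU.isOpen hw ev).du_eq, h.v, h'.v, h.uv, h'.uv]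
  · rw [((ku.sub (k'.const_mul (-1))).congr hU.isOpen hw eu).du_eq]
    simp only [h.val, h'.val, h.u, h'.u, h.uu, h'.uu, Real.rpow_sub_one h0']
    field_simp
    ring

end HasSecondPartials

/-- The partial derivatives of a solution of the equation on `φ₁`, in terms of its value `x` and
its derivatives `a`, `a'` along the first frame vector. -/
noncomputable def partials₁ (c m u y x a a' : ℝ) : Partials :=
  let k := sig c * (1 - m) / (2 * m)
  let a₂ := -(k / y) * (x / (4 * y) + a)
  let pv := a - k / y * x
  let pu := -2 * sig c * tau c * (1 - m) / u * x - 4 * m * sig c * (y / u) * a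
  let av := a' + a₂
  let au := (tau c * a₂ - sig c * a') * (4 * m * y / u)
  { val := x
    u := pu
    v := pv
    vv := av - k / y * pv
    uv := au + k * m / (u * y) * x - k / y * pu
    uu := 2 * sig c * tau c * (1 - m) / u ^ 2 * x - 2 * sig c * tau c * (1 - m) / u * pu
      - 4 * m * sig c * (m - 1) * y / u ^ 2 * a - 4 * m * sig c * y / u * au }

/-- The partial derivatives of a solution of the equation on `φ₂`, in terms of its value `x` and
its derivatives `a`, `a'` along the second frame vector. -/
noncomputable def partials₂ (c m u y x a a' : ℝ) : Partials :=
  let k := tau c * (1 - m) / (2 * m)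
  let a₁ := k / y * (-(x / (4 * y)) + a)
  let pv := a + k / y * x
  let pu := -2 * sig c * tau c * (1 - m) / u * x + 4 * m * tau c * (y / u) * a
  let av := a₁ + a'
  let au := (tau c * a' - sig c * a₁) * (4 * m * y / u)
  { val := x
    u := pu
    v := pv
    vv := av + k / y * pv
    uv := au - k * m / (u * y) * x + k / y * pu
    uu := 2 * sig c * tau c * (1 - m) / u ^ 2 * x - 2 * sig c * tau c * (1 - m) / u * pu
      + 4 * m * tau c * (m - 1) * y / u ^ 2 * a + 4 * m * tau c * y / u * au }

/-- The partial derivatives of the function `a₂₃`. -/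
noncomputable def leadingPartials (c m u y x a a' z b b' : ℝ) : Partials :=
  let J := partials₁ c m u y x a a'
  let J' := partials₂ c m u y z b b'
  let s := 8 * m * (1 - m) * sig c ^ 2
  let t := 8 * m * (1 - m) * tau c ^ 2
  let e := y / u ^ 2
  { val := e * (s * J.val - t * J'.val)
    u := e * (s * J.u - t * J'.u) + (m - 2) * e / u * (s * J.val - t * J'.val)
    v := e * (s * J.v - t * J'.v)
    vv := e * (s * J.vv - t * J'.vv)
    uv := e * (s * J.uv - t * J'.uv) + (m - 2) * e / u * (s * J.v - t * J'.v)
    uu := e * (s * J.uu - t * J'.uu) + 2 * ((m - 2) * e / u * (s * J.u - t * J'.u))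
      + (m - 2) * (m - 2 - 1) * e / u ^ 2 * (s * J.val - t * J'.val) }

namespace AdmissibleDomain

variable (hU : AdmissibleDomain m U)
include hU

lemma hasSecondPartials₁ {φ : ℝ × ℝ → ℝ} (hφ : ContDiffOn ℝ ∞ φ U)
    (e : ∀ w ∈ U, along (frame₂ c m) φ w = -2 * sig c * rho m w * kap m w * φ w) {w : ℝ × ℝ}
    (hw : w ∈ U) : HasSecondPartials φ w (partials₁ c m w.1 (w.1 ^ m) (φ w)
      (along (frame₁ c m) φ w) (along (frame₁ c m) (along (frame₁ c m) φ) w)) := by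
  obtain ⟨-, h₁, h₂, h₃⟩ := hU.solution_partials₁ hφ e hw rfl rfl rfl rfl rfl rfl rfl rfl rfl
  exact ⟨rfl, h₁.du_eq, h₁.dv_eq, h₂.dv_eq, h₂.du_eq, h₃⟩

lemma hasSecondPartials₂ {φ : ℝ × ℝ → ℝ} (hφ : ContDiffOn ℝ ∞ φ U)
    (e : ∀ w ∈ U, along (frame₁ c m) φ w = 2 * tau c * rho m w * kap m w * φ w) {w : ℝ × ℝ}
    (hw : w ∈ U) : HasSecondPartials φ w (partials₂ c m w.1 (w.1 ^ m) (φ w)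
      (along (frame₂ c m) φ w) (along (frame₂ c m) (along (frame₂ c m) φ) w)) := by
  obtain ⟨-, h₁, h₂, h₃⟩ := hU.solution_partials₂ hφ e hw rfl rfl rfl rfl rfl rfl rfl rfl rfl
  exact ⟨rfl, h₁.du_eq, h₁.dv_eq, h₂.dv_eq, h₂.du_eq, h₃⟩

/-- Expresses every derivative of `g` that occurs in the normal form through six numbers at the
point, so that each coefficient formula becomes a rational identity. -/
lemma hasSecondPartials_leading {φ₁ φ₂ g : ℝ × ℝ → ℝ} (h₁ : ContDiffOn ℝ ∞ φ₁ U)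
    (h₂ : ContDiffOn ℝ ∞ φ₂ U)
    (e₁ : ∀ w ∈ U, along (frame₂ c m) φ₁ w = -2 * sig c * rho m w * kap m w * φ₁ w)
    (e₂ : ∀ w ∈ U, along (frame₁ c m) φ₂ w = 2 * tau c * rho m w * kap m w * φ₂ w)
    (hg : ∀ w ∈ U, g w = w.1 ^ (m - 2) * (8 * m * (1 - m) * sig c ^ 2 * φ₁ w
      - 8 * m * (1 - m) * tau c ^ 2 * φ₂ w)) {w : ℝ × ℝ} (hw : w ∈ U) :
    HasSecondPartials g w (leadingPartials c m w.1 (w.1 ^ m) (φ₁ w) (along (frame₁ c m) φ₁ w)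
      (along (frame₁ c m) (along (frame₁ c m) φ₁) w) (φ₂ w) (along (frame₂ c m) φ₂ w)
      (along (frame₂ c m) (along (frame₂ c m) φ₂) w)) := by
  have h0 := hU.pos w hw
  have h := (HasSecondPartials.rpow_mul_sub hU hw h₁ h₂ (hU.hasSecondPartials₁ h₁ e₁ hw)
    (hU.hasSecondPartials₂ h₂ e₂ hw) (m - 2) (8 * m * (1 - m) * sig c ^ 2)
    (8 * m * (1 - m) * tau c ^ 2)).congr hU.isOpen hw (fun i hi => hg i hi)
  rw [show w.1 ^ (m - 2) = w.1 ^ m / w.1 ^ 2 by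
    rw [Real.rpow_sub h0, Real.rpow_ofNat]] at h
  exact h

end AdmissibleDomain

/-- Powers of `u` in terms of `u` and `y = u ^ m`. -/
lemma rpow_table {u y m : ℝ} (h0 : 0 < u) (hy : y = u ^ m) :
    u ^ (m - 1) = y / u ∧ u ^ (m - 2) = y / u ^ 2 ∧ u ^ (2 * m - 3) = y ^ 2 / u ^ 3 ∧
    u ^ (3 * m - 4) = y ^ 3 / u ^ 4 ∧ u ^ (2 * m - 2) = y ^ 2 / u ^ 2 ∧
    u ^ (3 * m - 3) = y ^ 3 / u ^ 3 ∧ u ^ (3 * m - 2) = y ^ 3 / u ^ 2 ∧ u ^ (m + 1) = y * u ∧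
    u ^ (-m + 3) = u ^ 3 / y ∧ u ^ (-m + 2) = u ^ 2 / y ∧ u ^ (-m + 1) = u / y ∧
    u ^ (2 * m - 1) = y ^ 2 / u := by
  have h2 : u ^ (2 * m) = y ^ 2 := by
    rw [hy, mul_comm, Real.rpow_mul h0.le, Real.rpow_ofNat]
  have h3 : u ^ (3 * m) = y ^ 3 := by
    rw [hy, mul_comm, Real.rpow_mul h0.le, Real.rpow_ofNat]
  simp only [Real.rpow_sub h0, Real.rpow_add h0, Real.rpow_neg h0.le, Real.rpow_ofNat,
    Real.rpow_one, h2, h3, ← hy, true_and, and_true]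
  refine ⟨?_, ?_, ?_⟩ <;> ring

/-- The coefficients `b₁₁`, `b₁₂`, `b₂₁`, `b₂₂` of the generator of the normal form, in terms of the
values of `φ₁`, `φ₂` and their derivatives. -/
noncomputable def weight₁₁ (c m : ℝ) : ℝ :=
  (sig c - m * (2 * sig c - tau c) + (tau c - sig c) * (1 - m) * (2 * sig c - tau c))
    / (tau c - sig c)

noncomputable def weight₂₂ (c m : ℝ) : ℝ :=
  (tau c + m * (sig c - 2 * tau c) + (tau c - sig c) * (1 - m) * (sig c - 2 * tau c))
    / (tau c - sig c)

/-- The coefficients of `R₁ R₂` in the two components of the normal form. -/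
noncomputable def mixed₁ (c m u y x a z : ℝ) : ℝ :=
  let k := u / (4 * m * y)
  let r := (1 - m) / u
  let d := (2 * sig c - tau c) / (tau c - sig c)
  let b₁₁ := weight₁₁ c m * (k / u) * x - d * a
  x * (2 * sig c * r * k / u)
    + (weight₁₁ c m * ((r - 1 / u) * k / u * x - k / u * (2 * sig c * r * x))
      + d * (2 * sig c * r) * (x / (4 * y) + a))
    + sig c * r * (2 * b₁₁ - k * r * (tau c * z + (2 * sig c - tau c) * x))
    + tau c * r * (k * r * (-sig c * x + (sig c - 2 * tau c) * z))

noncomputable def mixed₂ (c m u y x z b : ℝ) : ℝ :=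
  let k := u / (4 * m * y)
  let r := (1 - m) / u
  let d := (sig c - 2 * tau c) / (tau c - sig c)
  let b₂₂ := weight₂₂ c m * (k / u) * z - d * b
  z * (-2 * tau c * r * k / u)
    - (weight₂₂ c m * (k / u * (2 * tau c * r * z) - (r - 1 / u) * k / u * z)
      - d * (2 * tau c * r) * (-(z / (4 * y)) + b))
    + tau c * r * (2 * b₂₂ - k * r * (-sig c * x + (sig c - 2 * tau c) * z))
    + sig c * r * (k * r * (tau c * z + (2 * sig c - tau c) * x))

/-- The coefficients of `R₁²` and of `R₂²` in the normal form. -/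
noncomputable def square₁ (c m u y x a : ℝ) : ℝ :=
  -(sig c * ((1 - m) / u)) * (x * (u / (4 * m * y)) / u + (weight₁₁ c m * (1 / (4 * m * y)) * x
    - (2 * sig c - tau c) / (tau c - sig c) * a))

noncomputable def square₂ (c m u y z b : ℝ) : ℝ :=
  tau c * ((1 - m) / u) * (z * (u / (4 * m * y)) / u - (weight₂₂ c m * (1 / (4 * m * y)) * z
    - (sig c - 2 * tau c) / (tau c - sig c) * b))

section Coefficients

variable {g : ℝ × ℝ → ℝ} {w : ℝ × ℝ} {x a a' z b b' : ℝ}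

/-- The second order part of the expression is a multiple of the symbol of `∂₁∂₂`, as it is in all
the coefficients, so the pure second derivatives `a'`, `b'` cancel. With `y = u^m` as an independent
variable, the claim is an identity of rational functions. -/
lemma coeff24_eq (h0 : 0 < w.1) (hm0 : m ≠ 0) (hm1 : m - 1 ≠ 0) (hc : c ≠ 0) (hc1 : c - 2 ≠ 0)
    (hc2 : c + 2 ≠ 0)
    (h : HasSecondPartials g w (leadingPartials c m w.1 (w.1 ^ m) x a a' z b b')) :
    coeff24 c m g w = -2 * (1 - m) / w.1 * (sig c * x + tau c * z) := by
  obtain ⟨p₁, p₂, p₃, p₄, p₅, p₆, p₇, p₈, p₉, p₁₀, p₁₁, p₁₂⟩ := rpow_table h0 (m := m) rfl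
  have hy := (Real.rpow_pos_of_pos h0 m).ne'
  have h0' := h0.ne'
  simp only [coeff24, h.val, h.u, h.v, h.vv, h.uv, h.uu, p₈, p₉, p₁₀, p₁₁, leadingPartials,
    partials₁, partials₂, sig, tau]
  generalize w.1 ^ m = y at *
  field_simp
  ring

lemma coeff16_eq (h0 : 0 < w.1) (hm0 : m ≠ 0) (hm1 : m - 1 ≠ 0) (hc : c ≠ 0) (hc1 : c - 2 ≠ 0)
    (hc2 : c + 2 ≠ 0)
    (h : HasSecondPartials g w (leadingPartials c m w.1 (w.1 ^ m) x a a' z b b')) :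
    coeff16 c m g w = w.1 / (4 * m * w.1 ^ m) * (mixed₂ c m w.1 (w.1 ^ m) x z b
      - mixed₁ c m w.1 (w.1 ^ m) x a z) := by
  obtain ⟨p₁, p₂, p₃, p₄, p₅, p₆, p₇, p₈, p₉, p₁₀, p₁₁, p₁₂⟩ := rpow_table h0 (m := m) rfl
  have hy := (Real.rpow_pos_of_pos h0 m).ne'
  have h0' := h0.ne'
  -- Exhibits the denominator `tau - sig` of the weights as a multiple of `c`, so that it is known
  -- to be nonzero.
  have hd : (2 - c) / 4 - (2 + c) / 4 = -c / 2 := by ring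
  simp only [coeff16, polyP, mixed₁, mixed₂, weight₁₁, weight₂₂, h.val, h.u, h.v, h.vv, h.uv,
    h.uu, p₂, p₃, p₄, p₅, p₆, p₇,
    leadingPartials, partials₁, partials₂, sig, tau, hd]
  generalize w.1 ^ m = y at *
  field_simp
  ring

/-- The left side is the coefficient of `R₁²` in the second component of the deformation after
`u_x`, `v_x`, `u_xx` are written in the frame; the first term is the contribution of `u_xx`. -/
lemma coeff_square₁_eq (h0 : 0 < w.1) (hm0 : m ≠ 0) (hm1 : m - 1 ≠ 0) (hc : c ≠ 0) (hc1 : c - 2 ≠ 0)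
    (hc2 : c + 2 ≠ 0)
    (h : HasSecondPartials g w (leadingPartials c m w.1 (w.1 ^ m) x a a' z b b')) :
    (1 - m) / w.1 * (w.1 / (4 * m * w.1 ^ m)) ^ 2 * g w
      + coeff25 c m g w * (w.1 / (4 * m * w.1 ^ m)) ^ 2
      + coeff26 c m g w * tau c ^ 2 - coeff27 c m g w * (w.1 / (4 * m * w.1 ^ m)) * tau c
      = square₁ c m w.1 (w.1 ^ m) x a := by
  obtain ⟨p₁, p₂, p₃, p₄, p₅, p₆, p₇, p₈, p₉, p₁₀, p₁₁, p₁₂⟩ := rpow_table h0 (m := m) rfl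
  have hy := (Real.rpow_pos_of_pos h0 m).ne'
  have h0' := h0.ne'
  have hd : (2 - c) / 4 - (2 + c) / 4 = -c / 2 := by ring
  simp only [coeff25, coeff26, coeff27, polyQ, polyR, square₁, weight₁₁, h.val, h.u, h.v, h.vv,
    h.uv, h.uu, p₁, p₂, p₃, p₅,
    p₁₂, leadingPartials, partials₁, partials₂, sig, tau, hd]
  generalize w.1 ^ m = y at *
  field_simp
  ring

lemma coeff_square₂_eq (h0 : 0 < w.1) (hm0 : m ≠ 0) (hm1 : m - 1 ≠ 0) (hc : c ≠ 0) (hc1 : c - 2 ≠ 0)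
    (hc2 : c + 2 ≠ 0)
    (h : HasSecondPartials g w (leadingPartials c m w.1 (w.1 ^ m) x a a' z b b')) :
    (1 - m) / w.1 * (w.1 / (4 * m * w.1 ^ m)) ^ 2 * g w
      + coeff25 c m g w * (w.1 / (4 * m * w.1 ^ m)) ^ 2
      + coeff26 c m g w * sig c ^ 2 + coeff27 c m g w * (w.1 / (4 * m * w.1 ^ m)) * sig c
      = square₂ c m w.1 (w.1 ^ m) z b := by
  obtain ⟨p₁, p₂, p₃, p₄, p₅, p₆, p₇, p₈, p₉, p₁₀, p₁₁, p₁₂⟩ := rpow_table h0 (m := m) rfl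
  have hy := (Real.rpow_pos_of_pos h0 m).ne'
  have h0' := h0.ne'
  have hd : (2 - c) / 4 - (2 + c) / 4 = -c / 2 := by ring
  simp only [coeff25, coeff26, coeff27, polyQ, polyR, square₂, weight₂₂, h.val, h.u, h.v, h.vv,
    h.uv, h.uu, p₁, p₂, p₃, p₅,
    p₁₂, leadingPartials, partials₁, partials₂, sig, tau, hd]
  generalize w.1 ^ m = y at *
  field_simp
  ring

/-- The same comparison for `R₁ R₂`. The right side has the weights `tau`, `sig` because the second
component of a frame vector is `tau k₁ + sig k₂`. -/
lemma coeff_mixed_eq (h0 : 0 < w.1) (hm0 : m ≠ 0) (hm1 : m - 1 ≠ 0) (hc : c ≠ 0) (hc1 : c - 2 ≠ 0)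
    (hc2 : c + 2 ≠ 0)
    (h : HasSecondPartials g w (leadingPartials c m w.1 (w.1 ^ m) x a a' z b b')) :
    -2 * ((1 - m) / w.1) * (w.1 / (4 * m * w.1 ^ m)) ^ 2 * g w
      - 2 * (w.1 / (4 * m * w.1 ^ m)) ^ 2 * coeff25 c m g w
      + 2 * sig c * tau c * coeff26 c m g w +
        (w.1 / (4 * m * w.1 ^ m)) * (tau c - sig c) * coeff27 c m g w
      = tau c * mixed₁ c m w.1 (w.1 ^ m) x a z + sig c * mixed₂ c m w.1 (w.1 ^ m) x z b := by
  obtain ⟨p₁, p₂, p₃, p₄, p₅, p₆, p₇, p₈, p₉, p₁₀, p₁₁, p₁₂⟩ := rpow_table h0 (m := m) rfl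
  have hy := (Real.rpow_pos_of_pos h0 m).ne'
  have h0' := h0.ne'
  have hd : (2 - c) / 4 - (2 + c) / 4 = -c / 2 := by ring
  simp only [coeff25, coeff26, coeff27, polyQ, polyR, mixed₁, mixed₂, weight₁₁, weight₂₂, h.val,
    h.u, h.v, h.vv, h.uv, h.uu, p₁, p₂, p₃, p₅,
    p₁₂, leadingPartials, partials₁, partials₂, sig, tau, hd]
  generalize w.1 ^ m = y at *
  field_simp
  ring

end Coefficients

end SecondPartials

/-! ### The generator of the normal form and its flux. -/

section NormalForm

variable {c m : ℝ} {U : Set (ℝ × ℝ)}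

/-- The generator of the normal form. -/
noncomputable def normalGenerator (c m : ℝ) (φ₁ φ₂ : ℝ × ℝ → ℝ) : Generator where
  φ₁ := φ₁
  φ₂ := φ₂
  b₁₁ w := weight₁₁ c m / (1 - m) * (kap m w * rho m w * φ₁ w)
    + -((2 * sig c - tau c) / (tau c - sig c)) * along (frame₁ c m) φ₁ w
  b₁₂ w := kap m w * rho m w * (-sig c * φ₁ w + (sig c - 2 * tau c) * φ₂ w)
  b₂₁ w := kap m w * rho m w * ((2 * sig c - tau c) * φ₁ w + tau c * φ₂ w)
  b₂₂ w := weight₂₂ c m / (1 - m) * (kap m w * rho m w * φ₂ w)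
    + -((sig c - 2 * tau c) / (tau c - sig c)) * along (frame₂ c m) φ₂ w

/-- The pair `φ₁`, `φ₂` satisfies the equations of a generator. -/
structure IsSolution (c m : ℝ) (U : Set (ℝ × ℝ)) (φ₁ φ₂ : ℝ × ℝ → ℝ) : Prop where
  smooth₁ : ContDiffOn ℝ ∞ φ₁ U
  smooth₂ : ContDiffOn ℝ ∞ φ₂ U
  eq₁ : ∀ w ∈ U, along (frame₂ c m) φ₁ w = -2 * sig c * rho m w * kap m w * φ₁ w
  eq₂ : ∀ w ∈ U, along (frame₁ c m) φ₂ w = 2 * tau c * rho m w * kap m w * φ₂ w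

lemma along_linear {X : ℝ × ℝ → ℝ × ℝ} {f g : ℝ × ℝ → ℝ} (hU : IsOpen U) (hf : ContDiffOn ℝ ∞ f U)
    (hg : ContDiffOn ℝ ∞ g U) (a b : ℝ) {w : ℝ × ℝ} (hw : w ∈ U) :
    along X (fun w => a * f w + b * g w) w = a * along X f w + b * along X g w := by
  rw [along_add hU (contDiffOn_const.mul hf) (contDiffOn_const.mul hg) hw,
    along_mul hU contDiffOn_const hf hw, along_mul hU contDiffOn_const hg hw, along_const,
    along_const]
  ring

namespace AdmissibleDomain

variable (hU : AdmissibleDomain m U)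
include hU

lemma contDiffOn_kap_mul_rho : ContDiffOn ℝ ∞ (fun w => kap m w * rho m w) U :=
  hU.contDiffOn_kap.mul hU.contDiffOn_rho

lemma along_kap_mul_rho_mul {X : ℝ × ℝ → ℝ × ℝ} {f : ℝ × ℝ → ℝ} (hf : ContDiffOn ℝ ∞ f U)
    {w : ℝ × ℝ} (hw : w ∈ U) : along X (fun w => kap m w * rho m w * f w) w =
      kap m w * rho m w * (along X f w + (rho m w - 1 / w.1) * (X w).1 * f w) := by
  rw [along_mul hU.isOpen hU.contDiffOn_kap_mul_rho hf hw,
    along_mul hU.isOpen hU.contDiffOn_kap hU.contDiffOn_rho hw, hU.along_kap hw, hU.along_rho hw]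
  ring

lemma along_along_mu_primary {X : ℝ × ℝ → ℝ × ℝ} {w : ℝ × ℝ} (hw : w ∈ U) :
    along X (along (frame₁ c m) (mu₁ c m (fun _ => 0) (fun _ => 1))) w
      = sig c * rho m w / w.1 * (X w).1 ∧
    along X (along (frame₂ c m) (mu₁ c m (fun _ => 0) (fun _ => 1))) w
      = -(sig c * rho m w / w.1 * (X w).1) ∧
    along X (along (frame₁ c m) (mu₂ c m (fun _ => 0) (fun _ => 1))) w
      = -(tau c * rho m w / w.1 * (X w).1) ∧
    along X (along (frame₂ c m) (mu₂ c m (fun _ => 0) (fun _ => 1))) w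
      = tau c * rho m w / w.1 * (X w).1 := by
  have key : ∀ (a : ℝ) (f : ℝ × ℝ → ℝ), Set.EqOn f (fun w => a * rho m w) U →
      along X f w = -(a * rho m w / w.1 * (X w).1) := by
    intro a f hf
    rw [along_congr hU.isOpen hf hw, along_mul hU.isOpen contDiffOn_const hU.contDiffOn_rho hw,
      along_const, hU.along_rho hw]
    ring
  refine ⟨(key (-sig c) _ fun i hi => ?_).trans (by ring), key _ _ fun i hi => ?_,
    key _ _ fun i hi => ?_, (key (-tau c) _ fun i hi => ?_).trans (by ring)⟩
  · exact (hU.along_mu_primary hi).1.trans (by ring)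
  · exact (hU.along_mu_primary hi).2.1
  · exact (hU.along_mu_primary hi).2.2.1
  · exact (hU.along_mu_primary hi).2.2.2.trans (by ring)

end AdmissibleDomain

namespace IsSolution

variable {φ₁ φ₂ : ℝ × ℝ → ℝ}

lemma regular (h : IsSolution c m U φ₁ φ₂) (hU : AdmissibleDomain m U) :
    (normalGenerator c m φ₁ φ₂).Regular c m U := by
  have hk := hU.contDiffOn_kap_mul_rho
  refine ⟨h.smooth₁, h.smooth₂, ?_, ?_, ?_, ?_, h.eq₁, h.eq₂⟩
  · exact (contDiffOn_const.mul (hk.mul h.smooth₁)).add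
      (contDiffOn_const.mul (contDiffOn_along hU.isOpen hU.contDiffOn_frame₁ h.smooth₁))
  · exact hk.mul ((contDiffOn_const.mul h.smooth₁).add (contDiffOn_const.mul h.smooth₂))
  · exact hk.mul ((contDiffOn_const.mul h.smooth₁).add (contDiffOn_const.mul h.smooth₂))
  · exact (contDiffOn_const.mul (hk.mul h.smooth₂)).add
      (contDiffOn_const.mul (contDiffOn_along hU.isOpen hU.contDiffOn_frame₂ h.smooth₂))

/-- Together with `form₂_eq` this shows the purpose of the chosen `b_ij`: both frame components
share every coefficient except that of `R₁ R₂`. Equality of the `S` coefficients fixes `b₁₂`, `b₂₁`;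
equality of the square coefficients fixes `b₁₁`, `b₂₂` after division by `tau - sig = -c / 2`. -/
lemma form₁_eq (h : IsSolution c m U φ₁ φ₂) (hU : AdmissibleDomain m U) (hc : tau c - sig c ≠ 0)
    {w : ℝ × ℝ} (hw : w ∈ U) {Q : QuadForm}
    (hQ : Q = (normalGenerator c m φ₁ φ₂).form₁ c m (fun _ => 0) (fun _ => 1)) :
    Q.s₁ w = -2 * sig c * rho m w * φ₁ w ∧ Q.s₂ w = -2 * tau c * rho m w * φ₂ w ∧
    Q.r₁₁ w = square₁ c m w.1 (w.1 ^ m) (φ₁ w) (along (frame₁ c m) φ₁ w) ∧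
    Q.r₁₂ w = mixed₁ c m w.1 (w.1 ^ m) (φ₁ w) (along (frame₁ c m) φ₁ w) (φ₂ w) ∧
    Q.r₂₂ w = square₂ c m w.1 (w.1 ^ m) (φ₂ w) (along (frame₂ c m) φ₂ w) := by
  have h0 := hU.pos w hw
  have h0' := h0.ne'
  have hm := hU.m_pos.ne'
  have hm1 : 1 - m ≠ 0 := by linarith [hU.one_lt]
  have hy := (Real.rpow_pos_of_pos h0 m).ne'
  have hk := hU.contDiffOn_kap_mul_rho
  have hA := contDiffOn_along hU.isOpen (hU.contDiffOn_frame₁ (c := c)) h.smooth₁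
  obtain ⟨e, -⟩ := hU.solution_partials₁ h.smooth₁ h.eq₁ hw rfl rfl rfl rfl rfl rfl rfl rfl rfl
  obtain ⟨m₁, -, -, m₄⟩ := hU.along_mu_primary (c := c) hw
  have mm := fun X => hU.along_along_mu_primary (c := c) (X := X) hw
  subst hQ
  have d₁ : along (frame₂ c m) (normalGenerator c m φ₁ φ₂).b₁₁ w = _ :=
    (along_linear hU.isOpen (hk.mul h.smooth₁) hA _ _ hw).trans
      (by rw [hU.along_kap_mul_rho_mul h.smooth₁ hw, e, h.eq₁ w hw])
  have d₂ : along (frame₂ c m) (normalGenerator c m φ₁ φ₂).b₁₂ w = _ :=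
    (hU.along_kap_mul_rho_mul ((contDiffOn_const.mul h.smooth₁).add
      (contDiffOn_const.mul h.smooth₂)) hw).trans
      (by rw [along_linear hU.isOpen h.smooth₁ h.smooth₂ _ _ hw, h.eq₁ w hw])
  simp only [Generator.form₁, d₁, d₂, m₁, m₄, mm]
  simp only [normalGenerator, square₁, square₂, mixed₁, weight₁₁, weight₂₂, frame₁, frame₂, rho,
    hU.kap_eq hw]
  generalize w.1 ^ m = y at *
  have hst : tau c = 1 - sig c := by rw [← sig_add_tau c]; ring
  rw [hst] at hc ⊢
  refine ⟨?_, ?_, ?_, ?_, ?_⟩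
  all_goals
    field_simp
    try ring

lemma form₂_eq (h : IsSolution c m U φ₁ φ₂) (hU : AdmissibleDomain m U) (hc : tau c - sig c ≠ 0)
    {w : ℝ × ℝ} (hw : w ∈ U) {Q : QuadForm}
    (hQ : Q = (normalGenerator c m φ₁ φ₂).form₂ c m (fun _ => 0) (fun _ => 1)) :
    Q.s₁ w = -2 * sig c * rho m w * φ₁ w ∧ Q.s₂ w = -2 * tau c * rho m w * φ₂ w ∧
    Q.r₁₁ w = square₁ c m w.1 (w.1 ^ m) (φ₁ w) (along (frame₁ c m) φ₁ w) ∧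
    Q.r₁₂ w = mixed₂ c m w.1 (w.1 ^ m) (φ₁ w) (φ₂ w) (along (frame₂ c m) φ₂ w) ∧
    Q.r₂₂ w = square₂ c m w.1 (w.1 ^ m) (φ₂ w) (along (frame₂ c m) φ₂ w) := by
  have h0 := hU.pos w hw
  have h0' := h0.ne'
  have hm := hU.m_pos.ne'
  have hm1 : 1 - m ≠ 0 := by linarith [hU.one_lt]
  have hy := (Real.rpow_pos_of_pos h0 m).ne'
  have hk := hU.contDiffOn_kap_mul_rho
  have hA := contDiffOn_along hU.isOpen (hU.contDiffOn_frame₂ (c := c)) h.smooth₂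
  obtain ⟨e, -⟩ := hU.solution_partials₂ h.smooth₂ h.eq₂ hw rfl rfl rfl rfl rfl rfl rfl rfl rfl
  obtain ⟨m₁, -, -, m₄⟩ := hU.along_mu_primary (c := c) hw
  have mm := fun X => hU.along_along_mu_primary (c := c) (X := X) hw
  subst hQ
  have d₁ : along (frame₁ c m) (normalGenerator c m φ₁ φ₂).b₂₂ w = _ :=
    (along_linear hU.isOpen (hk.mul h.smooth₂) hA _ _ hw).trans
      (by rw [hU.along_kap_mul_rho_mul h.smooth₂ hw, e, h.eq₂ w hw])
  have d₂ : along (frame₁ c m) (normalGenerator c m φ₁ φ₂).b₂₁ w = _ :=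
    (hU.along_kap_mul_rho_mul ((contDiffOn_const.mul h.smooth₁).add
      (contDiffOn_const.mul h.smooth₂)) hw).trans
      (by rw [along_linear hU.isOpen h.smooth₁ h.smooth₂ _ _ hw, h.eq₂ w hw])
  simp only [Generator.form₂, d₁, d₂, m₁, m₄, mm]
  simp only [normalGenerator, square₁, square₂, mixed₂, weight₁₁, weight₂₂, frame₁, frame₂, rho,
    hU.kap_eq hw]
  generalize w.1 ^ m = y at *
  have hst : tau c = 1 - sig c := by rw [← sig_add_tau c]; ring
  rw [hst] at hc ⊢
  refine ⟨?_, ?_, ?_, ?_, ?_⟩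
  all_goals
    field_simp
    try ring

end IsSolution

end NormalForm

/-! ### The explicit normal form equals the generated flux. -/

section Realization

variable {c m : ℝ} {U : Set (ℝ × ℝ)}

lemma along_sub {X : ℝ × ℝ → ℝ × ℝ} {f g : ℝ × ℝ → ℝ} (hU : IsOpen U) (hf : ContDiffOn ℝ ∞ f U)
    (hg : ContDiffOn ℝ ∞ g U) {w : ℝ × ℝ} (hw : w ∈ U) :
    along X (fun w => f w - g w) w = along X f w - along X g w := by
  have hf' := (hf.contDiffAt (hU.mem_nhds hw)).differentiableAt (by simp)
  have hg' := (hg.contDiffAt (hU.mem_nhds hw)).differentiableAt (by simp)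
  rw [along, fderiv_fun_sub hf' hg']; rfl

namespace Generator

/-- Componentwise difference. -/
def sub (K K' : Generator) : Generator where
  φ₁ w := K.φ₁ w - K'.φ₁ w
  φ₂ w := K.φ₂ w - K'.φ₂ w
  b₁₁ w := K.b₁₁ w - K'.b₁₁ w
  b₁₂ w := K.b₁₂ w - K'.b₁₂ w
  b₂₁ w := K.b₂₁ w - K'.b₂₁ w
  b₂₂ w := K.b₂₂ w - K'.b₂₂ w

variable {K K' : Generator}

lemma Regular.mono {V : Set (ℝ × ℝ)} (hK : K.Regular c m U) (hV : V ⊆ U) : K.Regular c m V :=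
  ⟨hK.φ₁.mono hV, hK.φ₂.mono hV, hK.b₁₁.mono hV, hK.b₁₂.mono hV, hK.b₂₁.mono hV, hK.b₂₂.mono hV,
    fun w hw => hK.d2_φ₁ w (hV hw), fun w hw => hK.d1_φ₂ w (hV hw)⟩

lemma Regular.sub (hK : K.Regular c m U) (hK' : K'.Regular c m U) (hU : IsOpen U) :
    (K.sub K').Regular c m U := by
  refine ⟨hK.φ₁.sub hK'.φ₁, hK.φ₂.sub hK'.φ₂, hK.b₁₁.sub hK'.b₁₁, hK.b₁₂.sub hK'.b₁₂,
    hK.b₂₁.sub hK'.b₂₁, hK.b₂₂.sub hK'.b₂₂, fun w hw => ?_, fun w hw => ?_⟩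
  · simp only [Generator.sub]
    rw [along_sub hU hK.φ₁ hK'.φ₁ hw, hK.d2_φ₁ w hw, hK'.d2_φ₁ w hw]; ring
  · simp only [Generator.sub]
    rw [along_sub hU hK.φ₂ hK'.φ₂ hw, hK.d1_φ₂ w hw, hK'.d1_φ₂ w hw]; ring

lemma Regular.flux_sub (hK : K.Regular c m U) (hK' : K'.Regular c m U) (hU : IsOpen U)
    (p q : ℝ × ℝ → ℝ) {j : Jet} (hj : j ∈ jetDomain U) :
    (K.sub K').flux c m p q j = K.flux c m p q j - K'.flux c m p q j := by
  simp only [flux, frameVec, QuadForm.ev, QuadForm.val, form₁, form₂]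
  simp only [Generator.sub, along_sub hU hK.b₁₁ hK'.b₁₁ hj, along_sub hU hK.b₁₂ hK'.b₁₂ hj,
    along_sub hU hK.b₂₁ hK'.b₂₁ hj, along_sub hU hK.b₂₂ hK'.b₂₂ hj]
  refine Prod.ext ?_ ?_ <;> simp only [Prod.mk_sub_mk] <;> ring

end Generator

/-- A flux with a generator differs from the one with the same `φ₁`, `φ₂` by a Miura
transformation. -/
lemma Generator.Regular.miuraReducesTo {K K' : Generator} (hU : AdmissibleDomain m U)
    (hK : K.Regular c m U) (hK' : K'.Regular c m U) (h₁ : K'.φ₁ = K.φ₁) (h₂ : K'.φ₂ = K.φ₂)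
    {a a' : SecondOrder}
    (ha : Set.EqOn a.toFun (K.flux c m (fun _ => 0) (fun _ => 1)) (jetDomain U))
    (ha' : Set.EqOn a'.toFun (K'.flux c m (fun _ => 0) (fun _ => 1)) (jetDomain U)) :
    MiuraReducesTo U (primaryFlux c m) a a' := by
  have hα := symPair_primaryFlux (c := c) hU
  -- The difference of the generators has `φ₁ = φ₂ = 0`, so it is a polynomial of degree one in the
  -- jets, and its `∂_x` defines the Miura transformation.
  have hD := hK'.sub hK hU.isOpen
  obtain ⟨b, hb, eb⟩ := FirstOrder.exists_of_frame (c := c) hU hD.b₁₁ hD.b₁₂ hD.b₂₁ hD.b₂₂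
  have hbs := (jetSmooth_frameVec (c := c) hU subset_rfl
    (((hU.jetSmooth_base hD.b₁₁).mul (hU.jetSmooth_R₁ (c := c))).add
      ((hU.jetSmooth_base hD.b₁₂).mul (hU.jetSmooth_R₂ (c := c))))
    (((hU.jetSmooth_base hD.b₂₁).mul (hU.jetSmooth_R₁ (c := c))).add
      ((hU.jetSmooth_base hD.b₂₂).mul (hU.jetSmooth_R₂ (c := c))))).congr eb
  refine ⟨b, hb, transformsToOrderTwo hU.isOpen hα.smooth ((hK.jetSmooth_flux hU hα).congr ha)
    ((hK'.jetSmooth_flux hU hα).congr ha') hbs fun j hj => ?_⟩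
  rw [hα.fluxOp_congr hU hU.jetOpen subset_rfl hbs eb hj, ha hj, ha' hj,
    hD.fluxOp_polynomial hU hα (fun w => by simp [Generator.sub, h₁])
      (fun w => by simp [Generator.sub, h₂]) hj, hK'.flux_sub hK hU.isOpen _ _ hj]
  abel

/-- The relation between the leading coefficient of the normal form and its generator. -/
def IsLeading (c m : ℝ) (U : Set (ℝ × ℝ)) (φ₁ φ₂ g : ℝ × ℝ → ℝ) : Prop :=
  ∀ w ∈ U, g w = w.1 ^ (m - 2) * (8 * m * (1 - m) * sig c ^ 2 * φ₁ w
    - 8 * m * (1 - m) * tau c ^ 2 * φ₂ w)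

/-- The exponents in (4) split as `(m - 2) + 2 sig (m - 1)` and `(m - 2) + 2 tau (m - 1)`; the
constants in `h` cancel those of `IsLeading`. -/
lemma isLeading_leading (hU : AdmissibleDomain m U) (hσ : sig c ≠ 0) (hτ : tau c ≠ 0)
    {φ₁ φ₂ : ℝ × ℝ → ℝ} {F₁ F₂ : ℝ → ℝ}
    (h : ∀ p ∈ U,
      φ₁ p = 1 / (8 * m * (1 - m) * sig c ^ 2) * p.1 ^ (2 * sig c * (m - 1))
        * F₁ (riemann₁ c m p) ∧
      φ₂ p = -1 / (8 * m * (1 - m) * tau c ^ 2) * p.1 ^ (2 * tau c * (m - 1))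
        * F₂ (riemann₂ c m p)) :
    IsLeading c m U φ₁ φ₂ (leading c m F₁ F₂) := by
  intro p hp
  have h0 := hU.pos p hp
  have hm := hU.m_pos.ne'
  have hm1 : 1 - m ≠ 0 := by linarith [hU.one_lt]
  rw [leading, (h p hp).1, (h p hp).2,
    show c * (m - 1) / 2 + 2 * m - 3 = m - 2 + 2 * sig c * (m - 1) by unfold sig; ring,
    show -(c * (m - 1) / 2) + 2 * m - 3 = m - 2 + 2 * tau c * (m - 1) by unfold tau; ring,
    Real.rpow_add h0, Real.rpow_add h0]
  field_simp
  ring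

/-- The invariant has derivative `1` in `v`, so vertical displacement covers a neighbourhood. This
gives differentiability of the `F_i`, which are assumed smooth only on these images. -/
lemma image_riemann_mem_nhds (hU : IsOpen U) (d : ℝ) {p : ℝ × ℝ} (hp : p ∈ U) :
    (fun p : ℝ × ℝ => p.2 - d * p.1 ^ m) '' U ∈ 𝓝 (p.2 - d * p.1 ^ m) := by
  have hδ : Continuous fun s : ℝ => (p.1, s + d * p.1 ^ m) := by fun_prop
  have : (fun s : ℝ => (p.1, s + d * p.1 ^ m)) ⁻¹' U ∈ 𝓝 (p.2 - d * p.1 ^ m) :=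
    hδ.continuousAt.preimage_mem_nhds (hU.mem_nhds (by simpa using hp))
  filter_upwards [this] with s hs
  exact ⟨_, hs, by simp⟩

/-- A smooth function of a Riemann invariant is constant along the other frame vector. -/
lemma along_comp_eq_zero {r : ℝ × ℝ → ℝ} {F : ℝ → ℝ} {X : ℝ × ℝ → ℝ × ℝ} {w : ℝ × ℝ} {S : Set ℝ}
    (hF : ContDiffOn ℝ ∞ F S) (hS : S ∈ 𝓝 (r w)) (hr : DifferentiableAt ℝ r w)
    (h : fderiv ℝ r w (X w) = 0) : along X (fun w => F (r w)) w = 0 := by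
  have hF' := (hF.contDiffAt hS).differentiableAt (by simp)
  have hd : HasFDerivAt (fun w => F (r w)) _ w := hF'.hasFDerivAt.comp w hr.hasFDerivAt
  rw [along, hd.fderiv]
  simp [h]

lemma isSolution_of_parameters (hU : AdmissibleDomain m U) {F₁ F₂ : ℝ → ℝ}
    (hF₁ : ContDiffOn ℝ ∞ F₁ (riemann₁ c m '' U)) (hF₂ : ContDiffOn ℝ ∞ F₂ (riemann₂ c m '' U))
    (C₁ C₂ : ℝ) :
    IsSolution c m U (fun p => C₁ * p.1 ^ (2 * sig c * (m - 1)) * F₁ (riemann₁ c m p))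
      (fun p => C₂ * p.1 ^ (2 * tau c * (m - 1)) * F₂ (riemann₂ c m p)) := by
  have hr₁ := hU.contDiffOn_riemann₁ (c := c)
  have hr₂ := hU.contDiffOn_riemann₂ (c := c)
  have s₁ : ContDiffOn ℝ ∞ (fun p => F₁ (riemann₁ c m p)) U :=
    hF₁.comp hr₁ (Set.mapsTo_image _ _)
  have s₂ : ContDiffOn ℝ ∞ (fun p => F₂ (riemann₂ c m p)) U :=
    hF₂.comp hr₂ (Set.mapsTo_image _ _)
  have hp := fun s => (contDiffOn_const (c := s)).mul (hU.contDiffOn_rpow (2 * sig c * (m - 1)))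
  have hp' := fun s => (contDiffOn_const (c := s)).mul (hU.contDiffOn_rpow (2 * tau c * (m - 1)))
  refine ⟨(hp C₁).mul s₁, (hp' C₂).mul s₂, fun w hw => ?_, fun w hw => ?_⟩
  · have hk := (hU.kap_pos hw).ne'
    rw [along_mul hU.isOpen (hp C₁) s₁ hw, along_mul hU.isOpen contDiffOn_const
      (hU.contDiffOn_rpow _) hw, along_const, hU.along_rpow _ hw,
      along_comp_eq_zero hF₁ (image_riemann_mem_nhds hU.isOpen (c + 2) hw)
      ((hr₁.contDiffAt (hU.isOpen.mem_nhds hw)).differentiableAt (by simp))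
      (by rw [hU.fderiv_riemann₁ hw, frame₂]; field_simp; ring)]
    simp only [frame₂, rho]
    ring
  · have hk := (hU.kap_pos hw).ne'
    rw [along_mul hU.isOpen (hp' C₂) s₂ hw, along_mul hU.isOpen contDiffOn_const
      (hU.contDiffOn_rpow _) hw, along_const, hU.along_rpow _ hw,
      along_comp_eq_zero hF₂ (image_riemann_mem_nhds hU.isOpen (c - 2) hw)
      ((hr₂.contDiffAt (hU.isOpen.mem_nhds hw)).differentiableAt (by simp))
      (by rw [hU.fderiv_riemann₂ hw, frame₁]; field_simp; ring)]
    simp only [frame₁, rho]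
    ring

/-- The normal form is the deformation generated by `normalGenerator`. -/
lemma IsSolution.normalForm_eqOn {φ₁ φ₂ g : ℝ × ℝ → ℝ} (h : IsSolution c m U φ₁ φ₂)
    (hU : AdmissibleDomain m U) (hc : c ≠ 0) (hc1 : c - 2 ≠ 0) (hc2 : c + 2 ≠ 0)
    (hg : IsLeading c m U φ₁ φ₂ g) :
    Set.EqOn (normalForm c m g).toFun
      ((normalGenerator c m φ₁ φ₂).flux c m (fun _ => 0) (fun _ => 1)) (jetDomain U) := by
  intro j hj
  have hw : j 0 ∈ U := hj
  have h0 := hU.pos _ hw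
  have h0' := h0.ne'
  have hm := hU.m_pos.ne'
  have hm1 : m - 1 ≠ 0 := by linarith [hU.one_lt]
  have hd : tau c - sig c ≠ 0 := by
    rw [show tau c - sig c = -c / 2 by unfold tau sig; ring]
    exact div_ne_zero (neg_ne_zero.2 hc) two_ne_zero
  have hk := (hU.kap_pos hw).ne'
  have H := hU.hasSecondPartials_leading h.smooth₁ h.smooth₂ h.eq₁ h.eq₂ hg hw
  have c24 := coeff24_eq h0 hm hm1 hc hc1 hc2 H
  have c16 := coeff16_eq h0 hm hm1 hc hc1 hc2 H
  have q₁ := coeff_square₁_eq h0 hm hm1 hc hc1 hc2 H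
  have q₂ := coeff_square₂_eq h0 hm hm1 hc hc1 hc2 H
  have q₃ := coeff_mixed_eq h0 hm hm1 hc hc1 hc2 H
  rw [← hU.kap_eq hw] at c16 q₁ q₂ q₃
  obtain ⟨a₁, a₂, a₃, a₄, a₅⟩ := h.form₁_eq hU hd hw rfl
  obtain ⟨b₁, b₂, b₃, b₄, b₅⟩ := h.form₂_eq hU hd hw rfl
  -- With `c24'`, this matches the second derivatives: `a₂₃ u_xx + a₂₄ v_xx` must reproduce `-2 rho
  -- (sig φ₁ S₁ + tau φ₂ S₂)`.
  have hgk : g (j 0) * kap m (j 0)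
      = 2 * rho m (j 0) * (sig c ^ 2 * φ₁ (j 0) - tau c ^ 2 * φ₂ (j 0)) := by
    have hy := (Real.rpow_pos_of_pos h0 m).ne'
    rw [hg _ hw, hU.kap_eq hw, rho, (rpow_table h0 (m := m) rfl).2.1]
    generalize (j 0).1 ^ m = y at *
    field_simp
    ring
  have c24' : coeff24 c m g (j 0) = -2 * rho m (j 0) * (sig c * φ₁ (j 0) + tau c * φ₂ (j 0)) := by
    rw [c24, rho]; ring
  have u₁ := hU.rpow_m_sub_one hw
  have u₂ : (j 0).1 ^ (2 * m - 2) = (1 / (4 * m * kap m (j 0))) ^ 2 := by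
    rw [← u₁, ← Real.rpow_natCast, ← Real.rpow_mul h0.le]; congr 1; push_cast; ring
  simp only [SecondOrder.toFun, normalForm, Generator.flux, frameVec, QuadForm.ev, QuadForm.val,
    a₁, a₂, a₃, a₄, a₅, b₁, b₂, b₃, b₄, b₅]
  rw [u₁, u₂, hU.jet_one (c := c) hj, hU.jet_two (c := c) hj]
  have hst := sig_add_tau c
  have hc' : c = 4 * sig c - 2 := by unfold sig; ring
  rw [← rho] at q₁ q₂ q₃
  refine Prod.ext ?_ ?_
  -- In the first component `kap (k₂ - k₁)` only the `R₁ R₂` terms survive, and `R₁ R₂` is the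
  -- quadratic polynomial in `u_x`, `v_x` of the normal form.
  · rw [c16]
    simp only [sig, tau]
    field_simp
    ring
  · simp only
    rw [c24']
    linear_combination jetR₁ c m j ^ 2 * q₁ + jetR₂ c m j ^ 2 * q₂
      + jetR₁ c m j * jetR₂ c m j * q₃ + (jetS₂ c m j - jetS₁ c m j) * hgk
      - (jetR₁ c m j ^ 2 * square₁ c m (j 0).1 ((j 0).1 ^ m) (φ₁ (j 0)) (along (frame₁ c m) φ₁ (j 0))
        + jetR₂ c m j ^ 2 * square₂ c m (j 0).1 ((j 0).1 ^ m) (φ₂ (j 0))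
          (along (frame₂ c m) φ₂ (j 0))) * hst

/-- The coefficients of the normal form are smooth. -/
lemma smoothOn_normalForm (hU : AdmissibleDomain m U) (hc : c ≠ 0) (hc1 : c - 2 ≠ 0)
    (hc2 : c + 2 ≠ 0) {g : ℝ × ℝ → ℝ} (hg : ContDiffOn ℝ ∞ g U) :
    (normalForm c m g).SmoothOn U := by
  have hm := hU.m_pos.ne'
  have hm1 : m - 1 ≠ 0 := by linarith [hU.one_lt]
  have hu := hU.contDiffOn_du hg
  have hv := hU.contDiffOn_dv hg
  have huu := hU.contDiffOn_du hu
  have huv := hU.contDiffOn_du hv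
  have hvv := hU.contDiffOn_dv hv
  have hp := hU.contDiffOn_rpow
  have h0 := fun p hp => (hU.pos p hp).ne'
  have hy := fun s p hp => (Real.rpow_pos_of_pos (hU.pos p hp) s).ne'
  have h16 : ContDiffOn ℝ ∞ (coeff16 c m g) U := by
    unfold coeff16
    fun_prop (disch := intro p hp; simp [hy _ p hp, *])
  have h24 : ContDiffOn ℝ ∞ (coeff24 c m g) U := by
    unfold coeff24
    fun_prop (disch := intro p hp; simp [hy _ p hp, h0 p hp, *])
  have h25 : ContDiffOn ℝ ∞ (coeff25 c m g) U := by
    unfold coeff25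
    fun_prop (disch := intro p hp; simp [h0 p hp, *])
  have h26 : ContDiffOn ℝ ∞ (coeff26 c m g) U := by
    unfold coeff26
    fun_prop (disch := intro p hp; simp [hy _ p hp, *])
  have h27 : ContDiffOn ℝ ∞ (coeff27 c m g) U := by
    unfold coeff27
    fun_prop (disch := intro p hp; simp [hy _ p hp, *])
  refine ⟨contDiffOn_const, contDiffOn_const, h16.mul ?_, h16, h16.mul ?_, hg, h24, h25, h26, h27⟩
  · exact ((hp _).mul contDiffOn_const).mul contDiffOn_const
  · exact contDiffOn_const.mul (hp _)

end Realization

/-! ### Reduction to the normal form and its converse. -/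

section MainResult

variable {c m : ℝ} {U V : Set (ℝ × ℝ)}

lemma Generator.Regular.isSolution {K : Generator} (hK : K.Regular c m U) :
    IsSolution c m U K.φ₁ K.φ₂ := ⟨hK.φ₁, hK.φ₂, hK.d2_φ₁, hK.d1_φ₂⟩

/-- An integrable deformation can be reduced to the normal form. -/
theorem IsIntegrable.miuraReducesTo_normalForm (hU : AdmissibleDomain m U) (hc : c ≠ 0)
    (hc1 : c - 2 ≠ 0) (hc2 : c + 2 ≠ 0) {a : SecondOrder} (ha : a.SmoothOn U)
    (h : IsIntegrable U (primaryFlux c m) a) (hVU : V ⊆ U) (hVo : IsOpen V)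
    (h₁ : ∀ s : ℝ, IsPreconnected {p ∈ V | riemann₁ c m p = s})
    (h₂ : ∀ s : ℝ, IsPreconnected {p ∈ V | riemann₂ c m p = s}) :
    ∃ F₁ F₂ : ℝ → ℝ, ContDiffOn ℝ ∞ F₁ (riemann₁ c m '' V) ∧
      ContDiffOn ℝ ∞ F₂ (riemann₂ c m '' V) ∧
      MiuraReducesTo V (primaryFlux c m) a (normalForm c m (leading c m F₁ F₂)) := by
  have hσ : sig c ≠ 0 := by unfold sig; exact div_ne_zero (by rwa [add_comm]) (by norm_num)
  have hτ : tau c ≠ 0 := by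
    unfold tau; exact div_ne_zero (fun e => hc1 (by linarith)) (by norm_num)
  have hm := hU.m_pos.ne'
  have hm1 : 1 - m ≠ 0 := by linarith [hU.one_lt]
  have hV : AdmissibleDomain m V := ⟨hU.one_lt, hVo, fun p hp => hU.pos p (hVU hp)⟩
  obtain ⟨K, hK, e⟩ := h.exists_generator hU hσ hτ ha
  have hK' := hK.mono hVU
  obtain ⟨F₁, F₂, hF₁, hF₂, hφ⟩ := hV.exists_parameters
    -- Normalised so that `a₂₃` carries `F₁` and `F₂` with coefficient one.
    (C₁ := 1 / (8 * m * (1 - m) * sig c ^ 2)) (C₂ := -1 / (8 * m * (1 - m) * tau c ^ 2))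
    (by positivity) (div_ne_zero (by norm_num) (by positivity)) h₁ h₂ hK'.φ₁ hK'.φ₂
    hK'.d2_φ₁ hK'.d1_φ₂
  exact ⟨F₁, F₂, hF₁, hF₂, Generator.Regular.miuraReducesTo hV hK' (hK'.isSolution.regular hV)
    rfl rfl (fun j hj => e (hVU hj))
    (hK'.isSolution.normalForm_eqOn hV hc hc1 hc2 (isLeading_leading hV hσ hτ hφ))⟩

/-- The normal form is smooth and integrable for all functional parameters. -/
theorem normalForm_isIntegrable (hU : AdmissibleDomain m U) (hc : c ≠ 0)
    (hc1 : c - 2 ≠ 0) (hc2 : c + 2 ≠ 0) {F₁ F₂ : ℝ → ℝ}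
    (hF₁ : ContDiffOn ℝ ∞ F₁ (riemann₁ c m '' U)) (hF₂ : ContDiffOn ℝ ∞ F₂ (riemann₂ c m '' U)) :
    (normalForm c m (leading c m F₁ F₂)).SmoothOn U ∧
      IsIntegrable U (primaryFlux c m) (normalForm c m (leading c m F₁ F₂)) := by
  have hσ : sig c ≠ 0 := by unfold sig; exact div_ne_zero (by rwa [add_comm]) (by norm_num)
  have hτ : tau c ≠ 0 := by
    unfold tau; exact div_ne_zero (fun e => hc1 (by linarith)) (by norm_num)
  have hS := isSolution_of_parameters hU hF₁ hF₂ (1 / (8 * m * (1 - m) * sig c ^ 2))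
    (-1 / (8 * m * (1 - m) * tau c ^ 2))
  have hg := isLeading_leading hU hσ hτ (F₁ := F₁) (F₂ := F₂) fun p _ => ⟨rfl, rfl⟩
  refine ⟨smoothOn_normalForm hU hc hc1 hc2 ?_,
    (hS.regular hU).isIntegrable hU (hS.normalForm_eqOn hU hc hc1 hc2 hg)⟩
  exact ((hU.contDiffOn_rpow _).mul ((contDiffOn_const.mul hS.smooth₁).sub
    (contDiffOn_const.mul hS.smooth₂))).congr hg

end MainResult

end DihedralFlow

theorem mainTheorem10 (N : ℕ) (hN : 3 ≤ N) (m : ℝ) (hm : 2 * m = N)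
    (c : ℝ) (hc₀ : c ≠ 0) (hc₁ : c ≠ 2) (hc₂ : c ≠ -2)
    (U : Set (ℝ × ℝ)) (hU : IsOpen U) (hpos : ∀ p ∈ U, 0 < p.1) :
    DihedralFlow.AreRiemannInvariants U (DihedralFlow.primaryFlux c m)
        (DihedralFlow.riemann₁ c m) (DihedralFlow.riemann₂ c m) ∧
    (∀ a : DihedralFlow.SecondOrder, a.SmoothOn U →
      DihedralFlow.IsIntegrable U (DihedralFlow.primaryFlux c m) a →
      ∀ V ⊆ U, IsOpen V →
        (∀ s : ℝ, IsPreconnected {p ∈ V | DihedralFlow.riemann₁ c m p = s}) →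
        (∀ s : ℝ, IsPreconnected {p ∈ V | DihedralFlow.riemann₂ c m p = s}) →
        ∃ F₁ F₂ : ℝ → ℝ,
          ContDiffOn ℝ ∞ F₁ (DihedralFlow.riemann₁ c m '' V) ∧
          ContDiffOn ℝ ∞ F₂ (DihedralFlow.riemann₂ c m '' V) ∧
          DihedralFlow.MiuraReducesTo V (DihedralFlow.primaryFlux c m) a
            (DihedralFlow.normalForm c m (DihedralFlow.leading c m F₁ F₂))) ∧
    (∀ F₁ F₂ : ℝ → ℝ,
      ContDiffOn ℝ ∞ F₁ (DihedralFlow.riemann₁ c m '' U) →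
      ContDiffOn ℝ ∞ F₂ (DihedralFlow.riemann₂ c m '' U) →
      (DihedralFlow.normalForm c m (DihedralFlow.leading c m F₁ F₂)).SmoothOn U ∧
      DihedralFlow.IsIntegrable U (DihedralFlow.primaryFlux c m)
        (DihedralFlow.normalForm c m (DihedralFlow.leading c m F₁ F₂))) := by
  have hm1 : 1 < m := by
    have : (3 : ℝ) ≤ N := by exact_mod_cast hN
    linarith
  have hD : DihedralFlow.AdmissibleDomain m U := ⟨hm1, hU, hpos⟩
  have hc1 : c - 2 ≠ 0 := sub_ne_zero.2 hc₁
  have hc2 : c + 2 ≠ 0 := fun e => hc₂ (by linarith)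
  exact ⟨DihedralFlow.areRiemannInvariants hD,
    fun a ha h V hVU hVo h₁ h₂ =>
      h.miuraReducesTo_normalForm hD hc₀ hc1 hc2 ha hVU hVo h₁ h₂,
    fun F₁ F₂ hF₁ hF₂ => DihedralFlow.normalForm_isIntegrable hD hc₀ hc1 hc2 hF₁ hF₂⟩
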